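/- Let $n\ge 3$, $a\in[0,1]$, $H_0=-\Delta$ on $\mathbb R^n$ and $P=-i\nabla$. Let $V\in L^\infty_t H^a_x(\mathbb R^n\times\mathbb R)$ be complex valued (in the nonlinear case $V(x,t)=\mathcal N(x,t,|\psi(x,t)|)$), and let $\psi$ be a global (weakly continuous, distributional) solution of $$i\partial_t\psi-H_0\psi=V(x,t)\,\psi,\qquad (x,t)\in\mathbb R^n\times\mathbb R,$$ with $\sup_{t\in\mathbb R}\|\psi(t)\|_{H^a_x}<\infty$. Let $\bar{\mathcal F}_c:\mathbb R\to\mathbb R$ be a smooth function with $\bar{\mathcal F}_c(k)=1$ for $k\ge1$ and $\bar{\mathcal F}_c(k)=0$ for $k\le 1/2$, and put $\bar{\mathcal F}_c(\lambda>1)=\bar{\mathcal F}_c(\lambda)$, $\mathcal F_c(\lambda\le1)=1-\bar{\mathcal F}_c(\lambda)$. Functions of $|x-2tP|$ are understood through $g(|x-2tP|)=e^{-itH_0}g(|x|)e^{itH_0}$. Let $\alpha\in(0,1-2/n)$. Then, for every $t>0$, both $e^{itH_0}\mathcal F_c\big(\tfrac{|x-2tP|}{t^\alpha}\le1\big)\psi(t)$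 and $e^{itH_0}\bar{\mathcal F}_c\big(\tfrac{|x-2tP|}{t^\alpha}>1\big)\psi(t)$ belong to $H^a_x$, and: 1. the strong limit $$\Omega_\alpha^*\psi(0)=\text{s-}\lim_{t\to\infty}e^{itH_0}\,\mathcal F_c\Big(\frac{|x-2tP|}{t^\alpha}\le1\Big)\psi(t)$$ exists in $H^a_x(\mathbb R^n)$; 2. $$\text{w-}\lim_{t\to\infty}e^{itH_0}\,\bar{\mathcal F}_c\Big(\frac{|x-2tP|}{t^\alpha}>1\Big)\psi(t)=0\quad\text{in }H^a_x(\mathbb R^n);$$ 3. with $\psi_w(t):=\bar{\mathcal F}_c\big(\tfrac{|x-2tP|}{t^\alpha}>1\big)\psi(t)$, $$\lim_{t\to\infty}\big\|\psi(t)-e^{-itH_0}\Omega_\alpha^*\psi(0)-\psi_w(t)\big\|_{H^a_x}=0 .$$ -/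

import Mathlib

open MeasureTheory Filter Topology FourierTransform
open scoped ENNReal NNReal SchwartzMap Laplacian LineDeriv BoundedContinuousFunction ContDiff

noncomputable section

namespace Channel

/-- Euclidean space `ℝⁿ`. -/
abbrev E (n : ℕ) : Type := EuclideanSpace ℝ (Fin n)

/-- The complex Hilbert space `L²(ℝⁿ)`. -/
abbrev L2 (n : ℕ) : Type := Lp (α := E n) ℂ 2 (volume : Measure (E n))

/-- Multiplication by a bounded continuous function. -/
def mulOp {n : ℕ} (m : E n →ᵇ ℂ) (f : L2 n) : L2 n :=
  (m.memLp_top.toLp _ : Lp (α := E n) ℂ ∞ volume) • f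

theorem mulOp_coeFn {n : ℕ} (m : E n →ᵇ ℂ) (f : L2 n) :
    mulOp m f =ᵐ[volume] fun x => m x * f x := by
  filter_upwards [Lp.coeFn_lpSMul (r := 2) (m.memLp_top.toLp _ : Lp (α := E n) ℂ ∞ volume) f,
    (m.memLp_top (μ := (volume : Measure (E n)))).coeFn_toLp] with x hx hm
  rw [mulOp, hx, Pi.smul_apply', hm, smul_eq_mul]

/-! ### The Sobolev spaces `H^a`, `a ≥ 0`, as subspaces of `L²` -/

/-- The `H^a` norm, with value `∞` off `H^a`: the `L²` norm of `(1 + |ξ|²)^(a/2) 𝓕f(ξ)`, where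
`𝓕f(ξ) = ∫ e^{-2πi x·ξ} f(x) dx`. This is the weight of Mathlib's `MemSobolev`; it is comparable
with the weight `(1 + |2πξ|²)^(a/2)` of `⟨P⟩^a`, `P = -i∇`, so the norm is equivalent to
`‖⟨P⟩^a f‖`. -/
def sobolevENorm {n : ℕ} (a : ℝ) (f : L2 n) : ℝ≥0∞ :=
  eLpNorm (fun ξ : E n => ((((1 + ‖ξ‖ ^ 2) ^ (a / 2) : ℝ) : ℂ)) * (𝓕 f : L2 n) ξ) 2 volume

/-- `f ∈ H^a`. -/
def InSobolev {n : ℕ} (a : ℝ) (f : L2 n) : Prop := sobolevENorm a f < ⊤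

/-- The inner product of `H^a` attached to `sobolevENorm a`. -/
def sobolevInner {n : ℕ} (a : ℝ) (f g : L2 n) : ℂ :=
  ∫ ξ : E n, (((1 + ‖ξ‖ ^ 2) ^ a : ℝ) : ℂ) *
    (starRingEnd ℂ ((𝓕 f : L2 n) ξ) * (𝓕 g : L2 n) ξ)

/-- `InSobolev` is Mathlib's Sobolev space `H^{a,2}`. -/
theorem inSobolev_iff_memSobolev {n : ℕ} {a : ℝ} (ha : 0 ≤ a) (f : L2 n) :
    InSobolev a f ↔ TemperedDistribution.MemSobolev a 2 (f : 𝓢'(E n, ℂ)) := by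
  have hw : (fun x : E n => (((1 + ‖x‖ ^ 2) ^ (a / 2) : ℝ) : ℂ)).HasTemperateGrowth := by fun_prop
  have hw' : (fun x : E n => (((1 + ‖x‖ ^ 2) ^ (-a / 2) : ℝ) : ℂ)).HasTemperateGrowth := by fun_prop
  have hww : ∀ x : E n,
      (((1 + ‖x‖ ^ 2) ^ (a / 2) : ℝ) : ℂ) * (((1 + ‖x‖ ^ 2) ^ (-a / 2) : ℝ) : ℂ) = 1 := by
    intro x
    rw [← Complex.ofReal_mul, ← Real.rpow_add (by positivity)]
    simp [neg_div]
  rw [TemperedDistribution.memSobolev_iff_exists_smulLeftCLM_fourier,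
    Lp.fourier_toTemperedDistribution_eq]
  constructor
  · intro h
    have hm : MemLp (fun ξ : E n =>
        ((((1 + ‖ξ‖ ^ 2) ^ (a / 2) : ℝ) : ℂ)) * (𝓕 f : L2 n) ξ) 2 volume :=
      ⟨hw.1.continuous.aestronglyMeasurable.mul (Lp.aestronglyMeasurable _), h⟩
    refine ⟨hm.toLp _, ?_⟩
    ext g
    simp only [TemperedDistribution.smulLeftCLM_apply_apply, Lp.toTemperedDistribution_apply]
    refine integral_congr_ae ?_
    filter_upwards [hm.coeFn_toLp] with x hx
    rw [hx, SchwartzMap.smulLeftCLM_apply_apply hw]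
    simp only [smul_eq_mul]
    ring
  · rintro ⟨f', hf'⟩
    let b : E n →ᵇ ℂ := BoundedContinuousFunction.ofNormedAddCommGroup
      (fun x : E n => (((1 + ‖x‖ ^ 2) ^ (-a / 2) : ℝ) : ℂ)) hw'.1.continuous 1 (fun x => by
        rw [Complex.norm_real, Real.norm_of_nonneg (by positivity)]
        exact Real.rpow_le_one_of_one_le_of_nonpos (by simp) (by linarith))
    have key : ((𝓕 f : L2 n) : 𝓢'(E n, ℂ)) = (mulOp b f' : L2 n) := by
      ext g
      have h1 := congrArg (fun T : 𝓢'(E n, ℂ) =>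
        T (SchwartzMap.smulLeftCLM ℂ (fun x : E n => (((1 + ‖x‖ ^ 2) ^ (-a / 2) : ℝ) : ℂ)) g)) hf'
      simp only [TemperedDistribution.smulLeftCLM_apply_apply] at h1
      rw [SchwartzMap.smulLeftCLM_smulLeftCLM_apply hw hw'] at h1
      have h2 : SchwartzMap.smulLeftCLM ℂ
          ((fun x : E n => (((1 + ‖x‖ ^ 2) ^ (a / 2) : ℝ) : ℂ)) *
            fun x : E n => (((1 + ‖x‖ ^ 2) ^ (-a / 2) : ℝ) : ℂ)) g = g := by
        ext x
        rw [SchwartzMap.smulLeftCLM_apply_apply (hw.mul hw'), Pi.mul_apply, hww, one_smul]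
      rw [h2] at h1
      rw [h1]
      simp only [Lp.toTemperedDistribution_apply]
      refine integral_congr_ae ?_
      filter_upwards [mulOp_coeFn b f'] with x hx
      rw [hx, SchwartzMap.smulLeftCLM_apply_apply hw']
      simp only [smul_eq_mul, b, BoundedContinuousFunction.coe_ofNormedAddCommGroup]
      ring
    have key2 : (𝓕 f : L2 n) = mulOp b f' :=
      LinearMap.ker_eq_bot.mp (Lp.ker_toTemperedDistributionCLM_eq_bot (F := ℂ)
        (μ := (volume : Measure (E n))) (p := 2)) key
    have : (fun ξ : E n => ((((1 + ‖ξ‖ ^ 2) ^ (a / 2) : ℝ) : ℂ)) * (𝓕 f : L2 n) ξ)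
        =ᵐ[volume] f' := by
      rw [key2]
      filter_upwards [mulOp_coeFn b f'] with x hx
      rw [hx]
      simp only [b, BoundedContinuousFunction.coe_ofNormedAddCommGroup]
      rw [← mul_assoc, hww, one_mul]
    rw [InSobolev, sobolevENorm, eLpNorm_congr_ae this]
    exact (Lp.memLp f').2

/-- `u(t) → f` strongly in `H^a` as `t → +∞`. -/
def TendstoSobolev {n : ℕ} (a : ℝ) (u : ℝ → L2 n) (f : L2 n) : Prop :=
  Tendsto (fun t => sobolevENorm a (u t - f)) atTop (𝓝 0)

/-- `u(t) → f` weakly in the Hilbert space `H^a` as `t → +∞`. -/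
def TendstoWeaklySobolev {n : ℕ} (a : ℝ) (u : ℝ → L2 n) (f : L2 n) : Prop :=
  ∀ g : L2 n, InSobolev a g →
    Tendsto (fun t => sobolevInner a g (u t)) atTop (𝓝 (sobolevInner a g f))

/-- `V ∈ L^∞(ℝ_t; H^a)`. (Since `H^a` is a separable Hilbert space embedded in `L²`, strong
measurability in `L²` is the same as in `H^a`.) -/
def LinftySobolev {n : ℕ} (a : ℝ) (V : ℝ → L2 n) : Prop :=
  AEStronglyMeasurable V volume ∧ ∃ C : ℝ≥0, ∀ᵐ t : ℝ, sobolevENorm a (V t) ≤ C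

/-- `sup_t ‖ψ(t)‖_{H^a} < ∞`, the supremum being over every time `t ∈ ℝ`. -/
def UniformlyBounded {n : ℕ} (a : ℝ) (ψ : ℝ → L2 n) : Prop :=
  ∃ C : ℝ≥0, ∀ t : ℝ, sobolevENorm a (ψ t) ≤ C

/-! ### The free flow and the channel cut-offs -/

/-- The function `ξ ↦ e^{-it|2πξ|²}`. -/
def freeSymbol (n : ℕ) (t : ℝ) : E n →ᵇ ℂ :=
  BoundedContinuousFunction.ofNormedAddCommGroup
    (fun ξ : E n => Complex.exp (((-(t * (2 * Real.pi * ‖ξ‖) ^ 2) : ℝ) : ℂ) * Complex.I))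
    (by fun_prop) 1 (fun ξ => (Complex.norm_exp_ofReal_mul_I _).le)

/-- The free Schrödinger group `e^{-itH₀}`, `H₀ = -Δ`, on `L²(ℝⁿ)`. -/
def freeGroup {n : ℕ} (t : ℝ) (f : L2 n) : L2 n :=
  𝓕⁻ (mulOp (freeSymbol n t) (𝓕 f : L2 n))

theorem freeSymbol_hasTemperateGrowth (n : ℕ) (t : ℝ) :
    (freeSymbol n t : E n → ℂ).HasTemperateGrowth := by
  have h1 : Function.HasTemperateGrowth
      (fun y : ℝ => Complex.exp ((y : ℂ) * Complex.I)) := by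
    have hd : ∀ y : ℝ, HasDerivAt (fun y : ℝ => Complex.exp ((y : ℂ) * Complex.I))
        (Complex.exp ((y : ℂ) * Complex.I) * Complex.I) y := by
      intro y
      have := ((hasDerivAt_id y).ofReal_comp.mul_const Complex.I).cexp
      simpa using this
    have hit : ∀ k : ℕ, iteratedDeriv k (fun y : ℝ => Complex.exp ((y : ℂ) * Complex.I)) =
        fun y : ℝ => Complex.exp ((y : ℂ) * Complex.I) * Complex.I ^ k := by
      intro k
      induction k with
      | zero => simp
      | succ k ih =>
        rw [iteratedDeriv_succ, ih]
        funext y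
        rw [((hd y).mul_const (Complex.I ^ k)).deriv]
        ring
    refine ⟨((Complex.ofRealCLM.contDiff).mul contDiff_const).cexp, fun k => ⟨0, 1, fun y => ?_⟩⟩
    rw [norm_iteratedFDeriv_eq_norm_iteratedDeriv, hit]
    simp [Complex.norm_exp_ofReal_mul_I]
  have h2 : Function.HasTemperateGrowth
      (fun ξ : E n => -(t * (2 * Real.pi * ‖ξ‖) ^ 2)) := by
    have : (fun ξ : E n => -(t * (2 * Real.pi * ‖ξ‖) ^ 2)) =
        fun ξ : E n => (-(t * (2 * Real.pi) ^ 2)) * ‖ξ‖ ^ 2 := by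
      funext ξ; ring
    rw [this]
    exact (Function.HasTemperateGrowth.const _).mul (Function.hasTemperateGrowth_norm_sq _)
  exact h1.comp h2

/-- On Schwartz functions `e^{-itH₀}` is the corresponding Fourier multiplier. -/
theorem freeGroup_toLp {n : ℕ} (t : ℝ) (f : 𝓢(E n, ℂ)) :
    freeGroup t (f.toLp 2) = (SchwartzMap.fourierMultiplierCLM ℂ (freeSymbol n t) f).toLp 2 := by
  rw [freeGroup, SchwartzMap.fourierMultiplierCLM_apply, ← SchwartzMap.toLp_fourierInv_eq,
    SchwartzMap.toLp_fourier_eq]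
  congr 1
  apply Lp.ext
  filter_upwards [mulOp_coeFn (freeSymbol n t) ((𝓕 f).toLp 2), (𝓕 f).coeFn_toLp 2 volume,
    (SchwartzMap.smulLeftCLM ℂ (freeSymbol n t) (𝓕 f)).coeFn_toLp 2 volume] with x h1 h2 h3
  rw [h1, h2, h3, SchwartzMap.smulLeftCLM_apply_apply (freeSymbol_hasTemperateGrowth n t),
    smul_eq_mul]

/-- `e^{-itH₀} (x·v) e^{itH₀} = x·v - 2t P·v` on Schwartz functions, `P·v = -i∂_v`. -/
theorem freeGroup_conj_position {n : ℕ} (t : ℝ) (v : E n) (f : 𝓢(E n, ℂ)) :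
    ∃ g : 𝓢(E n, ℂ), freeGroup (-t) (f.toLp 2) = g.toLp 2 ∧
      freeGroup t ((SchwartzMap.smulLeftCLM ℂ (fun x : E n => inner ℝ x v) g).toLp 2) =
        (SchwartzMap.smulLeftCLM ℂ (fun x : E n => inner ℝ x v) f
          - (2 * t : ℂ) • (-Complex.I) • ∂_{v} f).toLp 2 := by
  refine ⟨_, freeGroup_toLp (-t) f, ?_⟩
  rw [freeGroup_toLp]
  congr 1
  set X : 𝓢(E n, ℂ) →L[ℝ] 𝓢(E n, ℂ) :=
    SchwartzMap.smulLeftCLM ℂ (fun x : E n => inner ℝ x v) with hX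
  have hin : (fun x : E n => inner ℝ x v).HasTemperateGrowth := by fun_prop
  have hm := freeSymbol_hasTemperateGrowth n t
  have hm' := freeSymbol_hasTemperateGrowth n (-t)
  set g := SchwartzMap.fourierMultiplierCLM ℂ (freeSymbol n (-t)) f with hg
  have hFg : 𝓕 g = SchwartzMap.smulLeftCLM ℂ (freeSymbol n (-t)) (𝓕 f) := by
    rw [hg, SchwartzMap.fourierMultiplierCLM_apply, fourier_fourierInv_eq]
  have hc : (2 * (Real.pi : ℂ) * Complex.I) ≠ 0 := by
    simp [Real.pi_ne_zero]
  have hXF : ∀ u : 𝓢(E n, ℂ), ∀ ξ : E n, (𝓕 (X u)) ξ =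
      -(2 * (Real.pi : ℂ) * Complex.I)⁻¹ * fderiv ℝ (𝓕 u : 𝓢(E n, ℂ)) ξ v := by
    intro u ξ
    have h := congrArg (fun w : 𝓢(E n, ℂ) => w ξ) (SchwartzMap.lineDerivOp_fourier_eq u v)
    simp only [SchwartzMap.lineDerivOp_apply_eq_fderiv] at h
    rw [h, FourierTransform.fourier_smul, smul_apply, smul_eq_mul]
    field_simp
    rfl
  have hFd : ∀ ξ : E n, (𝓕 (∂_{v} f)) ξ =
      (2 * (Real.pi : ℂ) * Complex.I) * ((inner ℝ ξ v : ℝ) * (𝓕 f) ξ) := by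
    intro ξ
    rw [SchwartzMap.fourier_lineDerivOp_eq, smul_apply,
      SchwartzMap.smulLeftCLM_apply_apply hin, smul_eq_mul, Complex.real_smul]
  have hdm : ∀ ξ : E n, HasFDerivAt (freeSymbol n (-t) : E n → ℂ)
      ((freeSymbol n (-t) ξ * Complex.I * (2 * t * (2 * Real.pi) ^ 2 : ℝ)) •
        (Complex.ofRealCLM ∘L innerSL ℝ ξ)) ξ := by
    intro ξ
    have h1 : HasFDerivAt (fun ξ : E n => ((t * (2 * Real.pi) ^ 2) * ‖ξ‖ ^ 2 : ℝ))
        ((t * (2 * Real.pi) ^ 2) • (2 • innerSL ℝ ξ)) ξ :=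
      (hasStrictFDerivAt_norm_sq ξ).hasFDerivAt.const_mul _
    have h2 := ((Complex.ofRealCLM.hasFDerivAt.comp ξ h1).mul_const Complex.I).cexp
    refine (h2.congr_of_eventuallyEq (Filter.Eventually.of_forall fun ζ => ?_)).congr_fderiv ?_
    · simp only [freeSymbol, BoundedContinuousFunction.coe_ofNormedAddCommGroup,
        Function.comp_apply, Complex.ofRealCLM_apply]
      congr 3
      ring
    · ext w
      simp [freeSymbol]
      ring_nf
  have hmm : ∀ ξ : E n, freeSymbol n t ξ * freeSymbol n (-t) ξ = 1 := by
    intro ξ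
    simp only [freeSymbol, BoundedContinuousFunction.coe_ofNormedAddCommGroup]
    rw [← Complex.exp_add, ← Complex.exp_zero]
    congr 1
    push_cast
    ring
  have hsub : ∀ u w : 𝓢(E n, ℂ), 𝓕 (u - w) = 𝓕 u - 𝓕 w :=
    fun u w => map_sub (FourierTransform.fourierCLM ℂ 𝓢(E n, ℂ)) u w
  have hinj : Function.Injective (fun u : 𝓢(E n, ℂ) => 𝓕 u) := fun u w h => by
    have := congrArg (fun z : 𝓢(E n, ℂ) => 𝓕⁻ z) h
    simpa using this
  apply hinj
  simp only
  rw [SchwartzMap.fourierMultiplierCLM_apply, fourier_fourierInv_eq]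
  ext ξ
  rw [SchwartzMap.smulLeftCLM_apply_apply hm, hXF g ξ,
    hsub,
    FourierTransform.fourier_smul, FourierTransform.fourier_smul, sub_apply, hXF f ξ,
    smul_apply, smul_apply, hFd ξ]
  have hprod : fderiv ℝ (𝓕 g : 𝓢(E n, ℂ)) ξ v =
      freeSymbol n (-t) ξ * fderiv ℝ (𝓕 f : 𝓢(E n, ℂ)) ξ v +
      (freeSymbol n (-t) ξ * Complex.I * (2 * t * (2 * Real.pi) ^ 2 : ℝ)) * (inner ℝ ξ v : ℝ) *
        (𝓕 f) ξ := by
    have h1 : ((𝓕 g : 𝓢(E n, ℂ)) : E n → ℂ) = fun ζ => freeSymbol n (-t) ζ * (𝓕 f) ζ := by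
      funext ζ
      rw [hFg, SchwartzMap.smulLeftCLM_apply_apply hm', smul_eq_mul]
    rw [h1, ((hdm ξ).fun_mul (𝓕 f : 𝓢(E n, ℂ)).differentiableAt.hasFDerivAt).fderiv]
    simp
    ring
  rw [hprod]
  simp only [smul_eq_mul]
  have h1 := hmm ξ
  have hI : Complex.I ^ 2 = -1 := Complex.I_sq
  field_simp
  push_cast
  linear_combination (-(fderiv ℝ (𝓕 f : 𝓢(E n, ℂ)) ξ v) -
      Complex.I * (2 * t * (2 * Real.pi) ^ 2) * (inner ℝ ξ v : ℝ) * (𝓕 f) ξ) * h1 -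
    8 * Complex.I * t * Real.pi ^ 2 * (inner ℝ ξ v : ℝ) * (𝓕 f) ξ * hI

/-- A smooth characteristic function of `[1, ∞)`: smooth, equal to `1` on `[1, ∞)` and to `0` on
`(-∞, 1/2]`. -/
structure SmoothCutoff where
  toFun : ℝ → ℝ
  smooth : ContDiff ℝ ∞ toFun
  eq_one : ∀ k : ℝ, 1 ≤ k → toFun k = 1
  eq_zero : ∀ k : ℝ, k ≤ 1 / 2 → toFun k = 0

theorem SmoothCutoff.exists_bound (F : SmoothCutoff) : ∃ C : ℝ, ∀ k : ℝ, ‖F.toFun k‖ ≤ C := by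
  obtain ⟨C, hC⟩ := (isCompact_Icc (a := (1 / 2 : ℝ)) (b := 1)).exists_bound_of_continuousOn
    F.smooth.continuous.continuousOn
  refine ⟨max C 1, fun k => ?_⟩
  by_cases h1 : 1 ≤ k
  · simp [F.eq_one k h1]
  by_cases h0 : k ≤ 1 / 2
  · simp [F.eq_zero k h0]
  · exact (hC k ⟨by linarith, by linarith⟩).trans (le_max_left _ _)

/-- The function `x ↦ F̄(|x| / r)` on `ℝⁿ`. -/
def SmoothCutoff.radial (F : SmoothCutoff) (n : ℕ) (r : ℝ) : E n →ᵇ ℂ :=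
  BoundedContinuousFunction.ofNormedAddCommGroup
    (fun x : E n => ((F.toFun (‖x‖ / r) : ℝ) : ℂ))
    (Complex.continuous_ofReal.comp (F.smooth.continuous.comp (continuous_norm.div_const r)))
    F.exists_bound.choose
    (fun x => by simpa using F.exists_bound.choose_spec (‖x‖ / r))

/-- `F̄(|x - 2tP| / r > 1)`, `P = -i∇`. The components of `x - 2tP` are the commuting self-adjoint
operators `e^{-itH₀} x_j e^{itH₀}` (see `freeGroup_conj_position`), so a function of them is the
conjugate by `e^{-itH₀}` of the multiplication by that function of `x`. -/
def SmoothCutoff.channelGT (F : SmoothCutoff) {n : ℕ} (t r : ℝ) (f : L2 n) : L2 n :=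
  freeGroup t (mulOp (F.radial n r) (freeGroup (-t) f))

/-- `F(|x - 2tP| / r ≤ 1)`, where `F = 1 - F̄`. -/
def SmoothCutoff.channelLE (F : SmoothCutoff) {n : ℕ} (t r : ℝ) (f : L2 n) : L2 n :=
  freeGroup t (mulOp (1 - F.radial n r) (freeGroup (-t) f))

/-! ### The equation -/

/-- `ψ` is a global (weak) solution of `i∂ₜψ - H₀ψ = V(x,t)ψ` on `ℝⁿ × ℝ`: it is weakly
continuous in time with values in `L²`, and the equation, integrated in time from `0` to `t`, holds
in the sense of tempered distributions in `x`. -/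
structure IsGlobalSolution {n : ℕ} (V ψ : ℝ → L2 n) : Prop where
  weakly_continuous : ∀ g : L2 n, Continuous fun t : ℝ => inner ℂ g (ψ t)
  equation : ∀ (η : 𝓢(E n, ℂ)) (t : ℝ),
    Complex.I * ((∫ x, η x * ψ t x) - ∫ x, η x * ψ 0 x) =
      ∫ s in (0 : ℝ)..t, ((∫ x, (-(Δ η)) x * ψ s x) + ∫ x, η x * (V s x * ψ s x))

end Channel

end

/-!
The proof works with `φ(t) = e^{itH₀}ψ(t)` (`inter`). By Duhamel's formula (`duhamel`)
`φ(t) - φ(s) = -i ∫ₛᵗ e^{irH₀} (V ψ)(r) dr`. The product `V ψ` of two `L²` functions is only in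
`L¹`, but there the free evolution has the dispersive bound `(4πr)^{-n/2}` from `L¹` to `L^∞`
(`norm_evol_le`), which is integrable at infinity as `n ≥ 3`. By duality with Schwartz functions
`|φ(t) - φ(s)| ≤ C s^{1-n/2}` almost everywhere on `ℝⁿ` (`BoundedSolution.ae_inter_sub_le`). So
`φ(k)` converges almost everywhere as `k → ∞` in `ℕ`; the limit `Ω` is the wave operator applied to
`ψ(0)`.

Pointwise closeness becomes `L²` closeness where the cut-off `χ_t = F(|x|/t^α ≤ 1)` lives: the ball
of radius `t^α` has volume of order `t^{αn}`, so `‖χ_t (φ(t) - Ω)‖² ≤ C t^{αn + 2 - n}`, and the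
exponent is negative exactly because `α < 1 - 2/n`.

For the `H^a` norm, `0 ≤ a ≤ 1`, derivatives are replaced by differences. Finite families of
translations `f(· + h) - f` with weights recover the `H^a` norm (`DiffScheme`,
`DiffScheme.sobolevENorm_sq_le`). A difference of `V ψ` is again a sum of two products, so the same
argument bounds the differences of `φ(t) - Ω` pointwise
(`BoundedSolution.ae_diff_inter_sub_limit_le`). Unlike fractional derivatives, differences satisfy
an exact Leibniz rule and keep `V ψ` inside `L¹`; and by the Cauchy-Schwarz inequality in time the
weighted squares of the pointwise bounds sum up to the `H^a` norms of `V` and `ψ`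
(`BoundedSolution.sum_sq_lintegral_driveRate_le`). This gives `χ_t (φ(t) - Ω) → 0` in `H^a`
(`BoundedSolution.tendsto_near`).

Finally `F̄(|x|/r)` is a multiplier of `H^a` bounded uniformly in `r ≥ 1` that tends strongly to
zero as `r → ∞` (`tendsto_radial`). Hence `χ_t Ω → Ω`, which gives the strong limit, and
`F̄(|x|/t^α) φ(t)` is bounded and tends weakly to zero (`tendsto_sobolevInner_radial`). The last
claim is the strong limit transported by the isometry `e^{-itH₀}`.
-/

noncomputable section

namespace Channel

/-! ### The free evolution of Schwartz functions -/

theorem freeSymbol_apply {n : ℕ} (t : ℝ) (ξ : E n) :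
    freeSymbol n t ξ = Complex.exp (((-(t * (2 * Real.pi * ‖ξ‖) ^ 2) : ℝ) : ℂ) * Complex.I) := rfl

theorem norm_freeSymbol {n : ℕ} (t : ℝ) (ξ : E n) : ‖freeSymbol n t ξ‖ = 1 :=
  Complex.norm_exp_ofReal_mul_I _

/-- The backward free evolution `e^{itH₀}η` of a Schwartz function, as a Schwartz function. -/
def evol {n : ℕ} (t : ℝ) (η : 𝓢(E n, ℂ)) : 𝓢(E n, ℂ) :=
  SchwartzMap.fourierMultiplierCLM ℂ (freeSymbol n (-t)) η

theorem fourier_evol {n : ℕ} (t : ℝ) (η : 𝓢(E n, ℂ)) (ξ : E n) :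
    (𝓕 (evol t η)) ξ = freeSymbol n (-t) ξ * (𝓕 η) ξ := by
  rw [evol, SchwartzMap.fourierMultiplierCLM_apply, fourier_fourierInv_eq,
    SchwartzMap.smulLeftCLM_apply_apply (freeSymbol_hasTemperateGrowth n _), smul_eq_mul]

theorem schwartz_eq_integral_fourier {n : ℕ} (g : 𝓢(E n, ℂ)) (x : E n) :
    g x = ∫ ξ : E n, Complex.exp (2 * Real.pi * Complex.I * (inner ℝ x ξ : ℝ)) * (𝓕 g) ξ := by
  have h : g = 𝓕⁻ (𝓕 g) := (fourierInv_fourier_eq g).symm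
  conv_lhs => rw [h, SchwartzMap.fourierInv_coe, Real.fourierInv_eq']
  refine integral_congr_ae (Eventually.of_forall fun ξ => ?_)
  simp only [smul_eq_mul]
  congr 2
  rw [real_inner_comm]
  push_cast
  ring

/-- A bound, uniform in the damping `ε`, for the kernel of the damped free propagator. -/
theorem gaussian_fourier_bound {n : ℕ} {ε t : ℝ} (hε : 0 < ε) (ht : 0 < t) (x w : E n) :
    ‖𝓕 (fun v : E n => Complex.exp (-((ε : ℂ) - (t * (2 * Real.pi) ^ 2 : ℝ) * Complex.I) * ‖v‖ ^ 2
      + 2 * Real.pi * Complex.I * (inner ℝ x v : ℝ))) w‖ ≤ (4 * Real.pi * t) ^ (-(n / 2 : ℝ)) := by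
  set b : ℂ := (ε : ℂ) - (t * (2 * Real.pi) ^ 2 : ℝ) * Complex.I with hb
  have hre : b.re = ε := by
    rw [hb, Complex.sub_re, Complex.ofReal_re, Complex.re_ofReal_mul, Complex.I_re]
    ring
  have him : b.im = -(t * (2 * Real.pi) ^ 2) := by
    rw [hb, Complex.sub_im, Complex.ofReal_im, Complex.im_ofReal_mul, Complex.I_im]
    ring
  have hbre : 0 < b.re := by rw [hre]; exact hε
  have hb0 : b ≠ 0 := by intro h; rw [h] at hbre; simp at hbre
  rw [fourier_gaussian_innerProductSpace' hbre, norm_mul]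
  have h1 : ‖Complex.exp (-(Real.pi : ℂ) ^ 2 * ‖x - w‖ ^ 2 / b)‖ ≤ 1 := by
    rw [Complex.norm_exp, Real.exp_le_one_iff]
    have : (-(Real.pi : ℂ) ^ 2 * ‖x - w‖ ^ 2 / b) =
        ((-(Real.pi ^ 2 * ‖x - w‖ ^ 2) : ℝ) : ℂ) * b⁻¹ := by push_cast; ring
    rw [this, Complex.re_ofReal_mul, Complex.inv_re, hre]
    have : 0 ≤ ε / Complex.normSq b := div_nonneg hε.le (Complex.normSq_nonneg b)
    have h2 : 0 ≤ Real.pi ^ 2 * ‖x - w‖ ^ 2 := by positivity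
    nlinarith
  have hbn : t * (2 * Real.pi) ^ 2 ≤ ‖b‖ := by
    have := Complex.abs_im_le_norm b
    rw [him, abs_neg, abs_of_pos (by positivity)] at this
    exact this
  have h2 : ‖((Real.pi : ℂ) / b) ^ ((Module.finrank ℝ (E n) : ℂ) / 2)‖ ≤
      (4 * Real.pi * t) ^ (-(n / 2 : ℝ)) := by
    have : ((Module.finrank ℝ (E n) : ℂ) / 2) = ((n / 2 : ℝ) : ℂ) := by
      rw [finrank_euclideanSpace_fin]; push_cast; rfl
    rw [this, Complex.norm_cpow_real, norm_div, Complex.norm_real,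
      Real.norm_of_nonneg Real.pi_pos.le, Real.rpow_neg (by positivity),
      ← Real.inv_rpow (by positivity)]
    refine Real.rpow_le_rpow (by positivity) ?_ (by positivity)
    rw [inv_eq_one_div, div_le_div_iff₀ (by positivity) (by positivity)]
    have hpi := Real.pi_pos
    nlinarith
  calc _ ≤ (4 * Real.pi * t) ^ (-(n / 2 : ℝ)) * 1 :=
        mul_le_mul h2 h1 (norm_nonneg _) (by positivity)
    _ = _ := mul_one _

/-- The dispersive estimate `‖e^{itH₀}η‖_∞ ≤ (4πt)^{-n/2} ‖η‖_1`. The propagator is damped by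
`e^{-ε|ξ|²}`, which turns its kernel into a genuine Gaussian. -/
theorem norm_evol_le {n : ℕ} {t : ℝ} (ht : 0 < t) (η : 𝓢(E n, ℂ)) (x : E n) :
    ‖evol t η x‖ ≤ (4 * Real.pi * t) ^ (-(n / 2 : ℝ)) * ∫ y, ‖η y‖ := by
  set G : ℝ → E n → ℂ := fun ε v =>
    Complex.exp (-((ε : ℂ) - (t * (2 * Real.pi) ^ 2 : ℝ) * Complex.I) * ‖v‖ ^ 2
      + 2 * Real.pi * Complex.I * (inner ℝ x v : ℝ)) with hG
  have hGnorm : ∀ ε : ℝ, ∀ v, ‖G ε v‖ = Real.exp (-(ε * ‖v‖ ^ 2)) := by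
    intro ε v
    rw [hG, Complex.norm_exp]
    congr 1
    have : (-((ε : ℂ) - (t * (2 * Real.pi) ^ 2 : ℝ) * Complex.I) * ‖v‖ ^ 2
      + 2 * Real.pi * Complex.I * (inner ℝ x v : ℝ)) = ((-(ε * ‖v‖ ^ 2) : ℝ) : ℂ) +
        ((t * (2 * Real.pi) ^ 2 * ‖v‖ ^ 2 + 2 * Real.pi * inner ℝ x v : ℝ) : ℂ) * Complex.I := by
      push_cast; ring
    rw [this, Complex.add_re, Complex.ofReal_re, Complex.re_ofReal_mul, Complex.I_re, mul_zero,
      add_zero]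
  have hGcont : ∀ ε, Continuous (G ε) := by
    intro ε
    simp only [hG]
    fun_prop
  have hint : Integrable (𝓕 η : 𝓢(E n, ℂ)) := SchwartzMap.integrable _
  have hbound : ∀ ε : ℝ, 0 < ε →
      ‖∫ ξ, G ε ξ * (𝓕 η) ξ‖ ≤ (4 * Real.pi * t) ^ (-(n / 2 : ℝ)) * ∫ y, ‖η y‖ := by
    intro ε hε
    have hGi : Integrable (G ε) := by
      have := GaussianFourier.integrable_cexp_neg_mul_sq_norm_add (V := E n)
        (b := (ε : ℂ) - (t * (2 * Real.pi) ^ 2 : ℝ) * Complex.I) (by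
          rw [Complex.sub_re, Complex.ofReal_re, Complex.re_ofReal_mul, Complex.I_re]
          simpa using hε)
        (2 * Real.pi * Complex.I) x
      exact this
    have hflip : ∫ ξ, G ε ξ * (𝓕 η) ξ = ∫ y, 𝓕 (G ε) y * η y := by
      have := VectorFourier.integral_fourierIntegral_smul_eq_flip (L := innerₗ (E n))
        Real.continuous_fourierChar continuous_inner hGi (η.integrable (μ := volume))
      simpa using! this.symm
    rw [hflip, ← integral_const_mul]
    refine norm_integral_le_of_norm_le ((η.integrable).norm.const_mul _)
      (Eventually.of_forall fun y => ?_)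
    rw [norm_mul]
    exact mul_le_mul_of_nonneg_right (gaussian_fourier_bound hε ht x y) (norm_nonneg _)
  have hlim : Tendsto (fun k : ℕ => ∫ ξ, G (1 / ((k : ℝ) + 1)) ξ * (𝓕 η) ξ) atTop
      (𝓝 (∫ ξ, G 0 ξ * (𝓕 η) ξ)) := by
    refine tendsto_integral_of_dominated_convergence (fun ξ => ‖(𝓕 η) ξ‖)
      (fun k => ((hGcont _).aestronglyMeasurable.mul hint.aestronglyMeasurable)) hint.norm
      (fun k => Eventually.of_forall fun ξ => ?_) (Eventually.of_forall fun ξ => ?_)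
    · rw [norm_mul, hGnorm]
      refine mul_le_of_le_one_left (norm_nonneg _) (Real.exp_le_one_iff.2 ?_)
      have : 0 ≤ 1 / ((k : ℝ) + 1) * ‖ξ‖ ^ 2 := by positivity
      linarith
    · refine Tendsto.mul_const _ ?_
      have hc : Continuous fun ε : ℝ => G ε ξ := by simp only [hG]; fun_prop
      exact (hc.tendsto 0).comp tendsto_one_div_add_atTop_nhds_zero_nat
  have heq : evol t η x = ∫ ξ, G 0 ξ * (𝓕 η) ξ := by
    rw [schwartz_eq_integral_fourier]
    refine integral_congr_ae (Eventually.of_forall fun ξ => ?_)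
    simp only [fourier_evol]
    rw [← mul_assoc, freeSymbol_apply, ← Complex.exp_add]
    simp only [hG]
    congr 2
    push_cast
    ring
  rw [heq]
  exact le_of_tendsto hlim.norm (Eventually.of_forall fun k => hbound _ (by positivity))

theorem norm_sub_one_exp_le (θ : ℝ) : ‖Complex.exp ((θ : ℂ) * Complex.I) - 1‖ ≤ |θ| := by
  rw [mul_comm]
  exact (Real.norm_exp_I_mul_ofReal_sub_one_le (x := θ))

theorem norm_exp_sub_one_sub_le (θ : ℝ) :
    ‖Complex.exp ((θ : ℂ) * Complex.I) - 1 - (θ : ℂ) * Complex.I‖ ≤ θ ^ 2 := by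
  -- integrate the first-order bound, as the derivative of the remainder is `i(e^{iθ} - 1)`
  have key : ∀ s ∈ Set.uIcc 0 θ, ‖Complex.I * (Complex.exp ((s : ℂ) * Complex.I) - 1)‖ ≤ |θ| := by
    intro s hs
    rw [norm_mul, Complex.norm_I, one_mul]
    refine (norm_sub_one_exp_le s).trans ?_
    have := Set.abs_sub_left_of_mem_uIcc hs
    simpa using this
  have hd : ∀ s ∈ Set.uIcc 0 θ, HasDerivWithinAt
      (fun s : ℝ => Complex.exp ((s : ℂ) * Complex.I) - 1 - (s : ℂ) * Complex.I)
      (Complex.I * (Complex.exp ((s : ℂ) * Complex.I) - 1)) (Set.uIcc 0 θ) s := by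
    intro s _
    have h1 := (Complex.ofRealCLM.hasDerivAt (x := s)).mul_const Complex.I
    have := ((h1.cexp.sub_const 1).sub h1).hasDerivWithinAt (s := Set.uIcc 0 θ)
    refine this.congr_deriv ?_
    simp
    ring
  have := (convex_uIcc (0 : ℝ) θ).norm_image_sub_le_of_norm_hasDerivWithin_le hd key
    Set.left_mem_uIcc Set.right_mem_uIcc
  simpa [← sq, sq_abs] using this

theorem fourier_laplacian {n : ℕ} (η : 𝓢(E n, ℂ)) (ξ : E n) :
    (𝓕 (Δ η)) ξ = ((-(2 * Real.pi * ‖ξ‖) ^ 2 : ℝ) : ℂ) * (𝓕 η) ξ := by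
  have hg : (fun x : E n => ‖x‖ ^ 2).HasTemperateGrowth := Function.hasTemperateGrowth_norm_sq _
  rw [SchwartzMap.laplacian_eq_fourierMultiplierCLM, FourierTransform.fourier_smul,
    SchwartzMap.fourierMultiplierCLM_apply, fourier_fourierInv_eq, smul_apply]
  erw [SchwartzMap.smulLeftCLM_apply_apply hg]
  simp only [Complex.real_smul]
  push_cast
  ring

theorem fourier_sub' {n : ℕ} (u w : 𝓢(E n, ℂ)) : 𝓕 (u - w) = 𝓕 u - 𝓕 w :=
  map_sub (FourierTransform.fourierCLM ℂ 𝓢(E n, ℂ)) u w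

theorem norm_toLp_le_of_fourier_le {n : ℕ} {c : ℝ} {g k : 𝓢(E n, ℂ)}
    (h : ∀ ξ, ‖(𝓕 g) ξ‖ ≤ c * ‖(𝓕 k) ξ‖) : ‖g.toLp 2 volume‖ ≤ c * ‖k.toLp 2 volume‖ := by
  rw [← SchwartzMap.norm_fourier_toL2_eq g, ← SchwartzMap.norm_fourier_toL2_eq k]
  refine Lp.norm_le_mul_norm_of_ae_le_mul ?_
  filter_upwards [(𝓕 g).coeFn_toLp 2 volume, (𝓕 k).coeFn_toLp 2 volume] with ξ h1 h2
  rw [h1, h2]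
  exact h ξ

theorem freeSymbol_eq_mul {n : ℕ} (t s : ℝ) (ξ : E n) :
    freeSymbol n (-t) ξ = freeSymbol n (-s) ξ *
      Complex.exp ((((t - s) * (2 * Real.pi * ‖ξ‖) ^ 2 : ℝ) : ℂ) * Complex.I) := by
  rw [freeSymbol_apply, freeSymbol_apply, ← Complex.exp_add]
  congr 1
  push_cast
  ring

theorem norm_freeSymbol_sub_le {n : ℕ} (t s : ℝ) (ξ : E n) :
    ‖freeSymbol n (-t) ξ - freeSymbol n (-s) ξ‖ ≤ |t - s| * (2 * Real.pi * ‖ξ‖) ^ 2 := by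
  have : freeSymbol n (-t) ξ - freeSymbol n (-s) ξ = freeSymbol n (-s) ξ *
      (Complex.exp ((((t - s) * (2 * Real.pi * ‖ξ‖) ^ 2 : ℝ) : ℂ) * Complex.I) - 1) := by
    rw [freeSymbol_eq_mul t s]; ring
  rw [this, norm_mul, norm_freeSymbol, one_mul]
  refine (norm_sub_one_exp_le _).trans_eq ?_
  rw [abs_mul, abs_of_nonneg (by positivity : (0 : ℝ) ≤ (2 * Real.pi * ‖ξ‖) ^ 2)]

/-- `t ↦ e^{itH₀}η` is Lipschitz in the supremum norm. -/
theorem norm_evol_sub_evol_le {n : ℕ} (η : 𝓢(E n, ℂ)) (t s : ℝ) (x : E n) :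
    ‖evol t η x - evol s η x‖ ≤ |t - s| * ∫ ξ, ‖(𝓕 (Δ η)) ξ‖ := by
  rw [← sub_apply, schwartz_eq_integral_fourier, ← integral_const_mul]
  refine norm_integral_le_of_norm_le
    ((SchwartzMap.integrable (μ := volume) (𝓕 (Δ η))).norm.const_mul _)
    (Eventually.of_forall fun ξ => ?_)
  have h1 : ‖Complex.exp (2 * Real.pi * Complex.I * (inner ℝ x ξ : ℝ))‖ = 1 := by
    rw [show (2 * Real.pi * Complex.I * (inner ℝ x ξ : ℝ) : ℂ) =
      ((2 * Real.pi * inner ℝ x ξ : ℝ) : ℂ) * Complex.I by push_cast; ring]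
    exact Complex.norm_exp_ofReal_mul_I _
  rw [norm_mul, h1, one_mul, fourier_sub', sub_apply, fourier_evol, fourier_evol, ← sub_mul,
    norm_mul, fourier_laplacian, norm_mul, Complex.norm_real, norm_neg,
    Real.norm_of_nonneg (by positivity), ← mul_assoc]
  exact mul_le_mul_of_nonneg_right (norm_freeSymbol_sub_le t s ξ) (norm_nonneg _)

/-- `t ↦ Δ e^{itH₀}η` is Lipschitz in `L²`. -/
theorem norm_laplacian_evol_sub_le {n : ℕ} (η : 𝓢(E n, ℂ)) (t s : ℝ) :
    ‖(Δ (evol t η) - Δ (evol s η)).toLp 2 volume‖ ≤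
      |t - s| * ‖(Δ (Δ η)).toLp 2 volume‖ := by
  refine norm_toLp_le_of_fourier_le fun ξ => ?_
  rw [fourier_sub', sub_apply, fourier_laplacian, fourier_laplacian, fourier_evol, fourier_evol,
    fourier_laplacian, fourier_laplacian, ← mul_sub, ← sub_mul, norm_mul, norm_mul, norm_mul,
    norm_mul, Complex.norm_real, norm_neg, Real.norm_of_nonneg (by positivity)]
  have := norm_freeSymbol_sub_le t s ξ
  calc _ = ‖freeSymbol n (-t) ξ - freeSymbol n (-s) ξ‖ *
        ((2 * Real.pi * ‖ξ‖) ^ 2 * ‖(𝓕 η) ξ‖) := by ring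
    _ ≤ (|t - s| * (2 * Real.pi * ‖ξ‖) ^ 2) * ((2 * Real.pi * ‖ξ‖) ^ 2 * ‖(𝓕 η) ξ‖) :=
        mul_le_mul_of_nonneg_right this (by positivity)
    _ = _ := by ring

/-- `t ↦ e^{itH₀}η` is differentiable in `L²` with derivative `iH₀e^{itH₀}η`. -/
theorem norm_evol_taylor_le {n : ℕ} (η : 𝓢(E n, ℂ)) (t s : ℝ) :
    ‖(evol t η - evol s η - ((t - s : ℝ) * Complex.I : ℂ) • (-(Δ (evol s η)))).toLp 2 volume‖ ≤
      (t - s) ^ 2 * ‖(Δ (Δ η)).toLp 2 volume‖ := by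
  refine norm_toLp_le_of_fourier_le fun ξ => ?_
  have hneg : ∀ u : 𝓢(E n, ℂ), 𝓕 (-u) = -𝓕 u :=
    fun u => map_neg (FourierTransform.fourierCLM ℂ 𝓢(E n, ℂ)) u
  rw [fourier_sub', fourier_sub', FourierTransform.fourier_smul, hneg, sub_apply, sub_apply,
    smul_apply, neg_apply, fourier_laplacian, fourier_laplacian, fourier_laplacian, fourier_evol,
    fourier_evol]
  set θ : ℝ := (t - s) * (2 * Real.pi * ‖ξ‖) ^ 2 with hθ
  have : freeSymbol n (-t) ξ * (𝓕 η) ξ - freeSymbol n (-s) ξ * (𝓕 η) ξ -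
      ((t - s : ℝ) * Complex.I : ℂ) •
        (-(((-(2 * Real.pi * ‖ξ‖) ^ 2 : ℝ) : ℂ) * (freeSymbol n (-s) ξ * (𝓕 η) ξ))) =
      (Complex.exp ((θ : ℂ) * Complex.I) - 1 - (θ : ℂ) * Complex.I) *
        (freeSymbol n (-s) ξ * (𝓕 η) ξ) := by
    rw [freeSymbol_eq_mul t s, ← hθ, smul_eq_mul]
    rw [hθ]
    push_cast
    ring
  rw [this, norm_mul, norm_mul, norm_mul, norm_mul, norm_freeSymbol, Complex.norm_real, norm_neg,
    Real.norm_of_nonneg (by positivity)]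
  calc _ ≤ θ ^ 2 * (1 * ‖(𝓕 η) ξ‖) :=
        mul_le_mul_of_nonneg_right (norm_exp_sub_one_sub_le θ) (by positivity)
    _ = _ := by rw [hθ]; ring

theorem evol_eq_fourier {n : ℕ} (t : ℝ) (η : 𝓢(E n, ℂ)) :
    evol t η = 𝓕 (SchwartzMap.smulLeftCLM ℂ (freeSymbol n (-t)) (𝓕⁻ η)) := by
  ext x
  rw [evol, SchwartzMap.fourierMultiplierCLM_apply, SchwartzMap.fourierInv_coe,
    SchwartzMap.fourier_coe, Real.fourierInv_eq_fourier_comp_neg]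
  refine congrArg (fun g : E n → ℂ => 𝓕 g x) (funext fun ξ => ?_)
  rw [SchwartzMap.smulLeftCLM_apply_apply (freeSymbol_hasTemperateGrowth n _),
    SchwartzMap.smulLeftCLM_apply_apply (freeSymbol_hasTemperateGrowth n _),
    SchwartzMap.fourierInv_coe, SchwartzMap.fourier_coe, Real.fourierInv_eq_fourier_neg]
  simp [freeSymbol_apply]

theorem integral_mul_fourier {n : ℕ} (η : 𝓢(E n, ℂ)) (f : L2 n) :
    ∫ x, η x * (𝓕 f : L2 n) x = ∫ x, (𝓕 η) x * f x := by
  have h := congrArg (fun T : 𝓢'(E n, ℂ) => T η) (Lp.fourier_toTemperedDistribution_eq f)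
  simp only [TemperedDistribution.fourier_apply, Lp.toTemperedDistribution_apply,
    smul_eq_mul] at h
  exact h.symm

theorem integral_mul_fourierInv {n : ℕ} (η : 𝓢(E n, ℂ)) (f : L2 n) :
    ∫ x, η x * (𝓕⁻ f : L2 n) x = ∫ x, (𝓕⁻ η) x * f x := by
  have h := integral_mul_fourier (𝓕⁻ η) (𝓕⁻ f : L2 n)
  rw [fourier_fourierInv_eq, fourier_fourierInv_eq] at h
  exact h.symm

/-- `e^{itH₀}` is symmetric for the bilinear pairing `∫ηf`. -/
theorem integral_mul_freeGroup {n : ℕ} (t : ℝ) (η : 𝓢(E n, ℂ)) (f : L2 n) :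
    ∫ x, η x * freeGroup (-t) f x = ∫ x, evol t η x * f x := by
  rw [freeGroup, integral_mul_fourierInv, evol_eq_fourier, ← integral_mul_fourier]
  refine integral_congr_ae ?_
  filter_upwards [mulOp_coeFn (freeSymbol n (-t)) (𝓕 f : L2 n)] with x hx
  rw [hx, SchwartzMap.smulLeftCLM_apply_apply (freeSymbol_hasTemperateGrowth n _), smul_eq_mul]
  ring

/-! ### Pairings of `L²` functions -/

/-- A weakly continuous curve in a separable Hilbert space is strongly measurable: preimages of
closed balls are closed, and every open set is a countable union of closed balls. -/
theorem stronglyMeasurable_of_weakly_continuous {H : Type*} [NormedAddCommGroup H]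
    [InnerProductSpace ℂ H] [SecondCountableTopology H] {u : ℝ → H}
    (hu : ∀ g : H, Continuous fun t : ℝ => inner ℂ g (u t)) : StronglyMeasurable u := by
  borelize H
  refine Measurable.stronglyMeasurable (measurable_of_isOpen fun U hU => ?_)
  have hball : ∀ (c : H) (r : ℝ), IsClosed (u ⁻¹' Metric.closedBall c r) := by
    intro c r
    by_cases hr : 0 ≤ r
    · have : u ⁻¹' Metric.closedBall c r =
          ⋂ g : H, {t : ℝ | ‖inner ℂ g (u t) - inner ℂ g c‖ ≤ ‖g‖ * r} := by
        ext t
        simp only [Set.mem_preimage, Metric.mem_closedBall, Set.mem_iInter, Set.mem_ofPred_eq,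
          dist_eq_norm, ← inner_sub_right]
        constructor
        · intro h g
          exact (norm_inner_le_norm _ _).trans (mul_le_mul_of_nonneg_left h (norm_nonneg _))
        · intro h
          have h1 := h (u t - c)
          rw [inner_self_eq_norm_sq_to_K, norm_pow] at h1
          simp only [Complex.coe_algebraMap, Complex.norm_real, norm_norm] at h1
          by_contra! h2
          nlinarith [norm_nonneg (u t - c)]
      rw [this]
      exact isClosed_iInter fun g => isClosed_le (((hu g).sub continuous_const).norm)
        continuous_const
    · rw [Metric.closedBall_eq_empty.2 (not_le.1 hr), Set.preimage_empty]
      exact isClosed_empty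
  have hε : ∀ x : U, ∃ ε > 0, Metric.closedBall (x : H) ε ⊆ U := fun x =>
    Metric.nhds_basis_closedBall.mem_iff.1 (hU.mem_nhds x.2)
  choose ε hε0 hεU using hε
  obtain ⟨T, hT, hTU⟩ := TopologicalSpace.isOpen_iUnion_countable
    (fun x : U => Metric.ball (x : H) (ε x)) (fun x => Metric.isOpen_ball)
  have : U = ⋃ x ∈ T, Metric.closedBall (x : H) (ε x) := by
    apply Set.Subset.antisymm
    · intro y hy
      have : y ∈ ⋃ x : U, Metric.ball (x : H) (ε x) :=
        Set.mem_iUnion.2 ⟨⟨y, hy⟩, Metric.mem_ball_self (hε0 _)⟩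
      rw [← hTU] at this
      simp only [Set.mem_iUnion] at this ⊢
      obtain ⟨x, hx, hxy⟩ := this
      exact ⟨x, hx, Metric.ball_subset_closedBall hxy⟩
    · exact Set.iUnion₂_subset fun x _ => hεU x
  rw [this, Set.preimage_iUnion₂]
  exact MeasurableSet.biUnion hT fun x _ => (hball _ _).measurableSet

/-- The bilinear pairing `∫ fg` of `L²`. -/
def bilin {n : ℕ} : L2 n →L[ℂ] L2 n →L[ℂ] ℂ :=
  (ContinuousLinearMap.mul ℂ ℂ).lpPairing volume 2 2

theorem bilin_apply {n : ℕ} (f g : L2 n) : bilin f g = ∫ x, f x * g x := by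
  rw [bilin, ContinuousLinearMap.lpPairing_eq_integral]
  rfl

theorem bilin_toLp {n : ℕ} (η : 𝓢(E n, ℂ)) (f : L2 n) :
    bilin (η.toLp 2) f = ∫ x, η x * f x := by
  rw [bilin_apply]
  refine integral_congr_ae ?_
  filter_upwards [η.coeFn_toLp 2 volume] with x hx
  rw [hx]

theorem integrable_mul {n : ℕ} (f g : L2 n) : Integrable (fun x => f x * g x) :=
  (Lp.memLp f).integrable_mul (Lp.memLp g)

theorem integral_norm_mul_le {n : ℕ} (f g : L2 n) : ∫ x, ‖f x‖ * ‖g x‖ ≤ ‖f‖ * ‖g‖ := by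
  have h := integral_mul_le_Lp_mul_Lq_of_nonneg (μ := (volume : Measure (E n)))
    Real.HolderConjugate.two_two (f := fun x => ‖f x‖) (g := fun x => ‖g x‖)
    (Eventually.of_forall fun _ => norm_nonneg _) (Eventually.of_forall fun _ => norm_nonneg _)
    (by simpa using (Lp.memLp f).norm) (by simpa using (Lp.memLp g).norm)
  have hn : ∀ u : L2 n, (∫ x, ‖u x‖ ^ (2 : ℝ)) ^ (1 / (2 : ℝ)) = ‖u‖ := by
    intro u
    rw [Lp.norm_def, eLpNorm_eq_lintegral_rpow_enorm_toReal (by simp) (by simp),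
      integral_eq_lintegral_of_nonneg_ae (Eventually.of_forall fun _ => by positivity)
        ((Lp.aestronglyMeasurable u).norm.aemeasurable.pow_const _).aestronglyMeasurable,
      ENNReal.toReal_rpow]
    simp only [ENNReal.toReal_ofNat]
    congr 2
    refine lintegral_congr fun x => ?_
    rw [← ENNReal.ofReal_rpow_of_nonneg (norm_nonneg _) (by norm_num), ofReal_norm]
  rw [hn, hn] at h
  exact h

theorem norm_integral_mul_mul_le {n : ℕ} {m : E n → ℂ} {M : ℝ} (hm : ∀ x, ‖m x‖ ≤ M) (f g : L2 n) :
    ‖∫ x, m x * (f x * g x)‖ ≤ M * (‖f‖ * ‖g‖) := by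
  have hM : 0 ≤ M := (norm_nonneg _).trans (hm 0)
  calc _ ≤ ∫ x, M * (‖f x‖ * ‖g x‖) := by
        refine norm_integral_le_of_norm_le ?_ (Eventually.of_forall fun x => ?_)
        · simpa using (integrable_mul f g).norm.const_mul M
        · rw [norm_mul, norm_mul]
          exact mul_le_mul_of_nonneg_right (hm x) (by positivity)
    _ ≤ _ := by
        rw [integral_const_mul]
        exact mul_le_mul_of_nonneg_left (integral_norm_mul_le f g) hM

theorem integrable_schwartz_mul_mul {n : ℕ} (η : 𝓢(E n, ℂ)) (f g : L2 n) :
    Integrable (fun x => η x * (f x * g x)) := by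
  refine (integrable_mul f g).bdd_mul η.continuous.aestronglyMeasurable
    (c := SchwartzMap.seminorm ℝ 0 0 η) (Eventually.of_forall fun x => η.norm_le_seminorm ℝ x)

theorem integrable_schwartz_mul {n : ℕ} (η : 𝓢(E n, ℂ)) (f : L2 n) :
    Integrable (fun x => η x * f x) :=
  (η.memLp 2 volume).integrable_mul (Lp.memLp f)

theorem norm_integral_schwartz_mul_le {n : ℕ} (η : 𝓢(E n, ℂ)) (f : L2 n) :
    ‖∫ x, η x * f x‖ ≤ ‖η.toLp 2 volume‖ * ‖f‖ := by
  have h := integral_norm_mul_le (η.toLp 2 volume) f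
  rw [← bilin_toLp, bilin_apply]
  refine (norm_integral_le_integral_norm _).trans ?_
  simpa using h

/-- The trilinear pairing `∫ mfg`, with `m` bounded. -/
def trilin {n : ℕ} : Lp (α := E n) ℂ ∞ volume →L[ℂ] L2 n →L[ℂ] L2 n →L[ℂ] ℂ :=
  (ContinuousLinearMap.postcomp (L2 n) bilin) ∘L
    ((ContinuousLinearMap.mul ℂ ℂ).holderL volume ∞ 2 2)

theorem trilin_toLp {n : ℕ} (η : 𝓢(E n, ℂ)) (f g : L2 n) :
    trilin (η.toLp ∞) f g = ∫ x, η x * (f x * g x) := by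
  have : trilin (η.toLp ∞) f g =
      bilin ((ContinuousLinearMap.mul ℂ ℂ).holder 2 (η.toLp ∞) f) g := rfl
  rw [this, bilin_apply]
  refine integral_congr_ae ?_
  filter_upwards [(ContinuousLinearMap.mul ℂ ℂ).coeFn_holder (r := 2) (η.toLp ∞) f,
    η.coeFn_toLp ∞ volume] with x h1 h2
  rw [h1, h2]
  simp [mul_assoc]

theorem continuous_evol_toLp_top {n : ℕ} (η : 𝓢(E n, ℂ)) :
    Continuous fun t => (evol t η).toLp ∞ (volume : Measure (E n)) := by
  refine (LipschitzWith.of_dist_le_mul (K := (∫ ξ, ‖(𝓕 (Δ η)) ξ‖).toNNReal) fun t s => ?_).continuous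
  have h0 : 0 ≤ ∫ ξ, ‖(𝓕 (Δ η)) ξ‖ := integral_nonneg fun _ => norm_nonneg _
  rw [dist_eq_norm, Real.dist_eq, Real.coe_toNNReal _ h0]
  rw [show (evol t η).toLp ∞ volume - (evol s η).toLp ∞ volume =
    (evol t η - evol s η).toLp ∞ (volume : Measure (E n)) from
    (map_sub (SchwartzMap.toLpCLM ℂ ℂ ∞ (volume : Measure (E n))) _ _).symm]
  refine SchwartzMap.norm_toLp_top_le.trans
    (SchwartzMap.seminorm_le_bound ℝ 0 0 _ (by positivity) fun x => ?_)
  rw [pow_zero, one_mul, norm_iteratedFDeriv_zero, mul_comm]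
  exact norm_evol_sub_evol_le η t s x

/-! ### The Duhamel formula -/

section Duhamel

variable {n : ℕ} {V ψ : ℝ → L2 n}

theorem IsGlobalSolution.stronglyMeasurable (hψ : IsGlobalSolution V ψ) : StronglyMeasurable ψ :=
  haveI : Fact ((2 : ℝ≥0∞) ≠ ⊤) := ⟨by simp⟩
  stronglyMeasurable_of_weakly_continuous hψ.weakly_continuous

theorem aestronglyMeasurable_schwartz_mul_mul {η : ℝ → 𝓢(E n, ℂ)}
    (hη : Continuous fun r => (η r).toLp ∞ (volume : Measure (E n)))
    (hVm : AEStronglyMeasurable V volume) (hψm : StronglyMeasurable ψ) :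
    AEStronglyMeasurable (fun r => ∫ x, η r x * (V r x * ψ r x)) volume := by
  have h1 : AEStronglyMeasurable (fun r => trilin ((η r).toLp ∞) (V r)) volume :=
    trilin.aestronglyMeasurable_comp₂ hη.aestronglyMeasurable hVm
  have h2 : AEStronglyMeasurable (fun r => (trilin ((η r).toLp ∞) (V r), ψ r)) volume :=
    h1.prodMk hψm.aestronglyMeasurable
  have hc : Continuous fun p : (L2 n →L[ℂ] ℂ) × L2 n => p.1 p.2 :=
    isBoundedBilinearMap_apply.continuous
  refine (hc.comp_aestronglyMeasurable h2).congr (Eventually.of_forall fun r => ?_)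
  exact trilin_toLp _ _ _

theorem intervalIntegrable_of_bound {f : ℝ → ℂ} (hf : AEStronglyMeasurable f volume) {C : ℝ}
    (h : ∀ᵐ r, ‖f r‖ ≤ C) (s t : ℝ) : IntervalIntegrable f volume s t := by
  refine (intervalIntegrable_const (c := C)).mono_fun hf.restrict ?_
  refine ae_restrict_of_ae ?_
  filter_upwards [h] with r hr
  exact hr.trans (le_abs_self C)

/-- The Duhamel formula in the interaction picture, tested against a Schwartz function: the pairing
of `e^{isH₀}η` with `ψ(s)`, corrected by the interaction term, has zero derivative in `s`. -/
theorem duhamel (hVm : AEStronglyMeasurable V volume) {CV K : ℝ}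
    (hV : ∀ᵐ r, ‖V r‖ ≤ CV) (hψ : IsGlobalSolution V ψ) (hK : ∀ r, ‖ψ r‖ ≤ K) (η : 𝓢(E n, ℂ))
    (s t : ℝ) :
    (∫ x, evol t η x * ψ t x) - ∫ x, evol s η x * ψ s x =
      -Complex.I * ∫ r in s..t, ∫ x, evol r η x * (V r x * ψ r x) := by
  have hψm := hψ.stronglyMeasurable
  have hK0 : 0 ≤ K := (norm_nonneg _).trans (hK 0)
  have hCV : 0 ≤ CV := by
    obtain ⟨r, hr⟩ := hV.exists
    exact (norm_nonneg _).trans hr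
  -- weak continuity, for the bilinear pairing
  have hcont : ∀ g : 𝓢(E n, ℂ), Continuous fun r => ∫ x, g x * ψ r x := by
    intro g
    have := hψ.weakly_continuous (star (g.toLp 2 (volume : Measure (E n))))
    refine this.congr fun r => ?_
    rw [L2.inner_def]
    refine integral_congr_ae ?_
    filter_upwards [Lp.coeFn_star (g.toLp 2 (volume : Measure (E n))),
      g.coeFn_toLp 2 volume] with x h1 h2
    rw [h1, Pi.star_apply, h2]
    simp [mul_comm]
  have hqb : ∀ (m : E n → ℂ) (M : ℝ), (∀ x, ‖m x‖ ≤ M) →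
      ∀ᵐ r, ‖∫ x, m x * (V r x * ψ r x)‖ ≤ M * (CV * K) := by
    intro m M hm
    filter_upwards [hV] with r hr
    refine (norm_integral_mul_mul_le hm _ _).trans ?_
    exact mul_le_mul_of_nonneg_left (mul_le_mul hr (hK r) (norm_nonneg _) hCV)
      ((norm_nonneg _).trans (hm 0))
  have hsup : ∀ g : 𝓢(E n, ℂ), ∃ M : ℝ, ∀ x, ‖g x‖ ≤ M := fun g => ⟨_, g.norm_le_seminorm ℝ⟩
  have hqi : ∀ (g : 𝓢(E n, ℂ)) (s t : ℝ),
      IntervalIntegrable (fun r => ∫ x, g x * (V r x * ψ r x)) volume s t := by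
    intro g s t
    obtain ⟨M, hM⟩ := hsup g
    exact intervalIntegrable_of_bound (aestronglyMeasurable_schwartz_mul_mul (η := fun _ => g)
      continuous_const hVm hψm) (hqb _ M hM) s t
  have hbb : ∀ᵐ r, ‖∫ x, evol r η x * (V r x * ψ r x)‖ ≤
      (∫ ξ, ‖(𝓕 η) ξ‖) * (CV * K) := by
    filter_upwards [hV] with r hr
    have hev : ∀ x, ‖evol r η x‖ ≤ ∫ ξ, ‖(𝓕 η) ξ‖ := by
      intro x
      rw [schwartz_eq_integral_fourier]
      refine (norm_integral_le_integral_norm _).trans_eq (integral_congr_ae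
        (Eventually.of_forall fun ξ => ?_))
      simp only
      rw [norm_mul, fourier_evol, norm_mul, norm_freeSymbol, one_mul,
        show (2 * Real.pi * Complex.I * (inner ℝ x ξ : ℝ) : ℂ) =
        ((2 * Real.pi * inner ℝ x ξ : ℝ) : ℂ) * Complex.I by push_cast; ring,
        Complex.norm_exp_ofReal_mul_I, one_mul]
    refine (norm_integral_mul_mul_le hev _ _).trans ?_
    exact mul_le_mul_of_nonneg_left (mul_le_mul hr (hK r) (norm_nonneg _) hCV)
      (integral_nonneg fun _ => norm_nonneg _)
  have hbi : ∀ s t, IntervalIntegrable (fun r => ∫ x, evol r η x * (V r x * ψ r x)) volume s t :=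
    intervalIntegrable_of_bound
      (aestronglyMeasurable_schwartz_mul_mul (continuous_evol_toLp_top η) hVm hψm) hbb
  -- the equation between two arbitrary times
  have heq : ∀ (g : 𝓢(E n, ℂ)) (s t : ℝ), (∫ x, g x * ψ t x) - ∫ x, g x * ψ s x =
      -Complex.I * ∫ r in s..t, ((∫ x, (-(Δ g)) x * ψ r x) + ∫ x, g x * (V r x * ψ r x)) := by
    intro g s t
    have hi : ∀ s t, IntervalIntegrable
        (fun r => (∫ x, (-(Δ g)) x * ψ r x) + ∫ x, g x * (V r x * ψ r x)) volume s t :=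
      fun s t => ((hcont (-(Δ g))).intervalIntegrable s t).add (hqi g s t)
    rw [← intervalIntegral.integral_interval_sub_left (hi 0 t) (hi 0 s), ← hψ.equation g t,
      ← hψ.equation g s]
    linear_combination ((∫ x, g x * ψ t x) - ∫ x, g x * ψ s x) * Complex.I_sq
  set D : ℝ → ℂ := fun t => (∫ x, evol t η x * ψ t x) +
    Complex.I * ∫ r in (0 : ℝ)..t, ∫ x, evol r η x * (V r x * ψ r x) with hD
  set A : ℝ := ‖(Δ (Δ η)).toLp 2 (volume : Measure (E n))‖ with hA
  set A' : ℝ := ∫ ξ, ‖(𝓕 (Δ η)) ξ‖ with hA'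
  have hA0 : 0 ≤ A := norm_nonneg _
  have hA'0 : 0 ≤ A' := integral_nonneg fun _ => norm_nonneg _
  have hDdiff : ∀ s t : ℝ, D t - D s =
      (∫ x, (evol t η - evol s η - ((t - s : ℝ) * Complex.I : ℂ) • (-(Δ (evol s η)))) x * ψ s x) +
      Complex.I * ∫ r in s..t, ((∫ x, (-(Δ (evol s η))) x * ψ s x) -
        (∫ x, (-(Δ (evol t η))) x * ψ r x) - (∫ x, evol t η x * (V r x * ψ r x)) +
        ∫ x, evol r η x * (V r x * ψ r x)) := by
    intro s t
    have h1 := heq (evol t η) s t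
    have h2 : (∫ x, (evol t η - evol s η -
        ((t - s : ℝ) * Complex.I : ℂ) • (-(Δ (evol s η)))) x * ψ s x) =
        (∫ x, evol t η x * ψ s x) - (∫ x, evol s η x * ψ s x) -
          ((t - s : ℝ) * Complex.I : ℂ) * ∫ x, (-(Δ (evol s η))) x * ψ s x := by
      have ia := integrable_schwartz_mul (evol t η) (ψ s)
      have ib := integrable_schwartz_mul (evol s η) (ψ s)
      have ic := (integrable_schwartz_mul (-(Δ (evol s η))) (ψ s)).const_mul
        ((t - s : ℝ) * Complex.I : ℂ)
      have iab : Integrable (fun x => evol t η x * ψ s x - evol s η x * ψ s x) := ia.sub ib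
      rw [← integral_const_mul, ← integral_sub ia ib, ← integral_sub iab ic]
      refine integral_congr_ae (Eventually.of_forall fun x => ?_)
      simp only [sub_apply, smul_apply, smul_eq_mul]
      ring
    have h3 : ∫ r in s..t, ((∫ x, (-(Δ (evol s η))) x * ψ s x) -
        (∫ x, (-(Δ (evol t η))) x * ψ r x) - (∫ x, evol t η x * (V r x * ψ r x)) +
        ∫ x, evol r η x * (V r x * ψ r x)) =
        (t - s : ℝ) * (∫ x, (-(Δ (evol s η))) x * ψ s x) -
        (∫ r in s..t, ((∫ x, (-(Δ (evol t η))) x * ψ r x) +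
          ∫ x, evol t η x * (V r x * ψ r x))) +
        ∫ r in s..t, ∫ x, evol r η x * (V r x * ψ r x) := by
      have ia := (hcont (-(Δ (evol t η)))).intervalIntegrable (μ := volume) s t
      have ib := hqi (evol t η) s t
      have ic : IntervalIntegrable (fun _ : ℝ => ∫ x, (-(Δ (evol s η))) x * ψ s x) volume s t :=
        intervalIntegrable_const
      rw [intervalIntegral.integral_add ((ic.sub ia).sub ib) (hbi s t),
        intervalIntegral.integral_sub (ic.sub ia) ib, intervalIntegral.integral_sub ic ia,
        intervalIntegral.integral_add ia ib, intervalIntegral.integral_const, Complex.real_smul]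
      ring
    have h4 := intervalIntegral.integral_interval_sub_left (hbi 0 t) (hbi 0 s)
    rw [h2, h3]
    simp only [hD]
    linear_combination h1 + Complex.I * h4
  have hDbound : ∀ s t ε : ℝ, (∀ r ∈ Set.uIoc s t, ‖(∫ x, (-(Δ (evol s η))) x * ψ s x) -
      ∫ x, (-(Δ (evol s η))) x * ψ r x‖ ≤ ε) →
      ‖D t - D s‖ ≤ (t - s) ^ 2 * A * K +
        (ε + |t - s| * A * K + |t - s| * A' * (CV * K)) * |t - s| := by
    intro s t ε hε
    rw [hDdiff s t]
    refine (norm_add_le _ _).trans (add_le_add ?_ ?_)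
    · refine (norm_integral_schwartz_mul_le _ _).trans ?_
      exact mul_le_mul (norm_evol_taylor_le η t s) (hK s) (norm_nonneg _) (by positivity)
    · rw [norm_mul, Complex.norm_I, one_mul]
      refine intervalIntegral.norm_integral_le_of_norm_le_const_ae ?_
      filter_upwards [hqb (fun x => 1) 1 (fun _ => by simp), hV] with r _ hr hrs
      have e1 : (∫ x, (-(Δ (evol s η))) x * ψ s x) -
          (∫ x, (-(Δ (evol t η))) x * ψ r x) - (∫ x, evol t η x * (V r x * ψ r x)) +
          ∫ x, evol r η x * (V r x * ψ r x) =
          ((∫ x, (-(Δ (evol s η))) x * ψ s x) - ∫ x, (-(Δ (evol s η))) x * ψ r x) +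
          (∫ x, (Δ (evol t η) - Δ (evol s η)) x * ψ r x) +
          ∫ x, (evol r η x - evol t η x) * (V r x * ψ r x) := by
        have e2 : ∫ x, (Δ (evol t η) - Δ (evol s η)) x * ψ r x =
            (∫ x, (-(Δ (evol s η))) x * ψ r x) - ∫ x, (-(Δ (evol t η))) x * ψ r x := by
          rw [← integral_sub (integrable_schwartz_mul _ _) (integrable_schwartz_mul _ _)]
          refine integral_congr_ae (Eventually.of_forall fun x => ?_)
          simp only [sub_apply, neg_apply]
          ring
        have e3 : ∫ x, (evol r η x - evol t η x) * (V r x * ψ r x) =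
            (∫ x, evol r η x * (V r x * ψ r x)) - ∫ x, evol t η x * (V r x * ψ r x) := by
          rw [← integral_sub (integrable_schwartz_mul_mul _ _ _)
            (integrable_schwartz_mul_mul _ _ _)]
          refine integral_congr_ae (Eventually.of_forall fun x => ?_)
          simp only
          ring
        rw [e2, e3]
        ring
      have hrt : |r - t| ≤ |t - s| := by
        have h := Set.abs_sub_right_of_mem_uIcc (Set.uIoc_subset_uIcc hrs)
        rwa [abs_sub_comm t r] at h
      rw [e1]
      refine norm_add₃_le.trans (add_le_add (add_le_add (hε r hrs) ?_) ?_)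
      · refine (norm_integral_schwartz_mul_le _ _).trans ?_
        exact mul_le_mul (norm_laplacian_evol_sub_le η t s) (hK r) (norm_nonneg _) (by positivity)
      · refine (norm_integral_mul_mul_le (fun x => norm_evol_sub_evol_le η r t x) _ _).trans ?_
        exact mul_le_mul (mul_le_mul_of_nonneg_right hrt hA'0)
          (mul_le_mul hr (hK r) (norm_nonneg _) hCV) (by positivity) (by positivity)
  have hderiv : ∀ s, HasDerivAt D 0 s := by
    intro s
    rw [hasDerivAt_iff_isLittleO, Asymptotics.isLittleO_iff]
    intro c hc
    obtain ⟨δ, hδ, hδs⟩ := Metric.continuous_iff.1 (hcont (-(Δ (evol s η)))) s (c / 2) (half_pos hc)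
    set B : ℝ := A * K + A * K + A' * (CV * K) + 1 with hB
    have hB0 : 0 < B := by positivity
    filter_upwards [Metric.ball_mem_nhds s (lt_min hδ (div_pos hc (mul_pos two_pos hB0)))] with t ht
    rw [Metric.mem_ball, Real.dist_eq, lt_min_iff] at ht
    have h := hDbound s t (c / 2) (fun r hr => by
      have h1 := Set.abs_sub_left_of_mem_uIcc (Set.uIoc_subset_uIcc hr)
      have h2 := hδs r (by rw [Real.dist_eq]; exact h1.trans_lt ht.1)
      rw [dist_comm, dist_eq_norm] at h2
      exact h2.le)
    rw [smul_zero, sub_zero, Real.norm_eq_abs]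
    refine h.trans ?_
    have h5 : |t - s| * B ≤ c / 2 := by
      have := ht.2.le
      rw [le_div_iff₀ (by positivity)] at this
      linarith
    rw [← sq_abs (t - s)]
    have h6 : 0 ≤ |t - s| := abs_nonneg _
    calc _ = (c / 2 + |t - s| * (A * K + A * K + A' * (CV * K))) * |t - s| := by ring
      _ ≤ (c / 2 + |t - s| * B) * |t - s| := by
          gcongr
          rw [hB]; linarith
      _ ≤ c * |t - s| := by
          gcongr
          linarith
  have hconst : D t = D s := by
    refine is_const_of_deriv_eq_zero (fun s => (hderiv s).differentiableAt)
      (fun s => (hderiv s).deriv) t s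
  have h4 := intervalIntegral.integral_interval_sub_left (hbi 0 t) (hbi 0 s)
  simp only [hD] at hconst
  linear_combination hconst - Complex.I * h4

end Duhamel

variable {n : ℕ}

/-! ### Multipliers, the free group and the Sobolev norm -/

theorem enorm_sq_eq_lintegral (f : L2 n) : ‖f‖ₑ ^ 2 = ∫⁻ x, ‖f x‖ₑ ^ 2 := by
  rw [Lp.enorm_def]
  have := eLpNorm_nnreal_pow_eq_lintegral (f := f) (μ := (volume : Measure (E n))) (p := 2)
    (by norm_num)
  simpa using this

theorem mulOp_add (m : E n →ᵇ ℂ) (f g : L2 n) : mulOp m (f + g) = mulOp m f + mulOp m g := by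
  apply Lp.ext
  filter_upwards [mulOp_coeFn m (f + g), mulOp_coeFn m f, mulOp_coeFn m g, Lp.coeFn_add f g,
    Lp.coeFn_add (mulOp m f) (mulOp m g)] with x h1 h2 h3 h4 h5
  rw [h1, h5, Pi.add_apply, h2, h3, h4, Pi.add_apply, mul_add]

theorem mulOp_sub (m : E n →ᵇ ℂ) (f g : L2 n) : mulOp m (f - g) = mulOp m f - mulOp m g := by
  rw [eq_sub_iff_add_eq, ← mulOp_add, sub_add_cancel]

theorem mulOp_one_sub (m : E n →ᵇ ℂ) (f : L2 n) : mulOp (1 - m) f = f - mulOp m f := by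
  apply Lp.ext
  filter_upwards [mulOp_coeFn (1 - m) f, mulOp_coeFn m f, Lp.coeFn_sub f (mulOp m f)]
    with x h1 h2 h3
  rw [h1, h3, Pi.sub_apply, h2]
  simp [sub_mul]

theorem enorm_mulOp_sq (m : E n →ᵇ ℂ) (f : L2 n) :
    ‖mulOp m f‖ₑ ^ 2 = ∫⁻ x, ‖m x‖ₑ ^ 2 * ‖f x‖ₑ ^ 2 := by
  rw [enorm_sq_eq_lintegral]
  refine lintegral_congr_ae ?_
  filter_upwards [mulOp_coeFn m f] with x hx
  rw [hx, enorm_mul, mul_pow]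

theorem norm_mulOp_le (m : E n →ᵇ ℂ) (f : L2 n) : ‖mulOp m f‖ ≤ ‖m‖ * ‖f‖ := by
  refine Lp.norm_le_mul_norm_of_ae_le_mul ?_
  filter_upwards [mulOp_coeFn m f] with x hx
  rw [hx, norm_mul]
  exact mul_le_mul_of_nonneg_right (m.norm_coe_le_norm x) (norm_nonneg _)

theorem fourier_freeGroup (t : ℝ) (f : L2 n) :
    (𝓕 (freeGroup t f) : L2 n) = mulOp (freeSymbol n t) (𝓕 f) := by
  rw [freeGroup, fourier_fourierInv_eq]

theorem fourier_sub_L2 (f g : L2 n) : (𝓕 (f - g) : L2 n) = 𝓕 f - 𝓕 g :=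
  map_sub (FourierTransform.fourierCLM ℂ (L2 n)) f g

theorem freeGroup_sub (t : ℝ) (f g : L2 n) :
    freeGroup t (f - g) = freeGroup t f - freeGroup t g := by
  rw [freeGroup, fourier_sub_L2, mulOp_sub]
  exact map_sub (FourierTransform.fourierInvCLM ℂ (L2 n)) _ _

theorem freeGroup_freeGroup_neg (t : ℝ) (f : L2 n) : freeGroup t (freeGroup (-t) f) = f := by
  rw [freeGroup, fourier_freeGroup]
  have : mulOp (freeSymbol n t) (mulOp (freeSymbol n (-t)) (𝓕 f : L2 n)) = 𝓕 f := by
    apply Lp.ext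
    filter_upwards [mulOp_coeFn (freeSymbol n t) (mulOp (freeSymbol n (-t)) (𝓕 f : L2 n)),
      mulOp_coeFn (freeSymbol n (-t)) (𝓕 f : L2 n)] with x h1 h2
    rw [h1, h2, ← mul_assoc, freeSymbol_apply, freeSymbol_apply, ← Complex.exp_add]
    simp
  rw [this, fourierInv_fourier_eq]

theorem freeGroup_neg_freeGroup (t : ℝ) (f : L2 n) : freeGroup (-t) (freeGroup t f) = f := by
  simpa using freeGroup_freeGroup_neg (-t) f

/-- The weight `(1 + |ξ|²)^a`. -/
def weight (a : ℝ) (ξ : E n) : ℝ≥0∞ := ENNReal.ofReal ((1 + ‖ξ‖ ^ 2) ^ a)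

theorem measurable_weight (a : ℝ) : Measurable (weight a : E n → ℝ≥0∞) := by
  unfold weight
  fun_prop

theorem sobolevENorm_sq (a : ℝ) (f : L2 n) :
    sobolevENorm a f ^ 2 = ∫⁻ ξ, weight a ξ * ‖(𝓕 f : L2 n) ξ‖ₑ ^ 2 := by
  have := eLpNorm_nnreal_pow_eq_lintegral (f := fun ξ : E n =>
    ((((1 + ‖ξ‖ ^ 2) ^ (a / 2) : ℝ) : ℂ)) * (𝓕 f : L2 n) ξ) (μ := (volume : Measure (E n)))
    (p := 2) (by norm_num)
  simp only [NNReal.coe_ofNat, ENNReal.rpow_ofNat, ENNReal.coe_ofNat] at this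
  rw [sobolevENorm, this]
  refine lintegral_congr fun ξ => ?_
  rw [enorm_mul, mul_pow, weight]
  congr 1
  rw [← ofReal_norm, Complex.norm_real, Real.norm_of_nonneg (by positivity),
    ← ENNReal.ofReal_pow (by positivity), ← Real.rpow_natCast, ← Real.rpow_mul (by positivity)]
  norm_num

theorem sobolevENorm_freeGroup (a t : ℝ) (f : L2 n) :
    sobolevENorm a (freeGroup t f) = sobolevENorm a f := by
  have : sobolevENorm a (freeGroup t f) ^ 2 = sobolevENorm a f ^ 2 := by
    rw [sobolevENorm_sq, sobolevENorm_sq, fourier_freeGroup]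
    refine lintegral_congr_ae ?_
    filter_upwards [mulOp_coeFn (freeSymbol n t) (𝓕 f : L2 n)] with x hx
    rw [hx, enorm_mul, ← ofReal_norm (freeSymbol n t x), norm_freeSymbol]
    simp
  exact le_antisymm ((ENNReal.pow_le_pow_left_iff two_ne_zero).1 this.le)
    ((ENNReal.pow_le_pow_left_iff two_ne_zero).1 this.ge)

theorem enorm_fourier (f : L2 n) : ‖(𝓕 f : L2 n)‖ₑ = ‖f‖ₑ := by
  rw [← ofReal_norm, Lp.norm_fourier_eq, ofReal_norm]

theorem one_le_weight {a : ℝ} (ha : 0 ≤ a) (ξ : E n) : 1 ≤ weight a ξ := by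
  rw [weight, ENNReal.one_le_ofReal]
  exact Real.one_le_rpow (by simp) ha

theorem enorm_le_sobolevENorm {a : ℝ} (ha : 0 ≤ a) (f : L2 n) : ‖f‖ₑ ≤ sobolevENorm a f := by
  rw [← ENNReal.pow_le_pow_left_iff two_ne_zero, sobolevENorm_sq, ← enorm_fourier,
    enorm_sq_eq_lintegral]
  exact lintegral_mono fun ξ => le_mul_of_one_le_left zero_le (one_le_weight ha ξ)

theorem aestronglyMeasurable_sobolev (a : ℝ) (f : L2 n) : AEStronglyMeasurable
    (fun ξ : E n => ((((1 + ‖ξ‖ ^ 2) ^ (a / 2) : ℝ) : ℂ)) * (𝓕 f : L2 n) ξ) volume := by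
  refine AEStronglyMeasurable.mul ?_ (Lp.aestronglyMeasurable _)
  have hw : (fun x : E n => (((1 + ‖x‖ ^ 2) ^ (a / 2) : ℝ) : ℂ)).HasTemperateGrowth := by fun_prop
  exact hw.1.continuous.aestronglyMeasurable

theorem sobolevENorm_sub_le (a : ℝ) (f g : L2 n) :
    sobolevENorm a (f - g) ≤ sobolevENorm a f + sobolevENorm a g := by
  unfold sobolevENorm
  rw [fourier_sub_L2]
  refine le_trans (le_of_eq ?_) (eLpNorm_sub_le (aestronglyMeasurable_sobolev a f)
    (aestronglyMeasurable_sobolev a g) (by norm_num))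
  refine eLpNorm_congr_ae ?_
  filter_upwards [Lp.coeFn_sub (𝓕 f : L2 n) (𝓕 g)] with x hx
  simp only [Pi.sub_apply, hx, mul_sub]

theorem sobolevENorm_neg (a : ℝ) (f : L2 n) : sobolevENorm a (-f) = sobolevENorm a f := by
  unfold sobolevENorm
  have : (𝓕 (-f) : L2 n) = -𝓕 f := map_neg (FourierTransform.fourierCLM ℂ (L2 n)) f
  rw [this, ← eLpNorm_neg]
  refine eLpNorm_congr_ae ?_
  filter_upwards [Lp.coeFn_neg (𝓕 f : L2 n)] with x hx
  rw [Pi.neg_apply, hx, Pi.neg_apply]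
  ring

theorem sobolevENorm_add_le (a : ℝ) (f g : L2 n) :
    sobolevENorm a (f + g) ≤ sobolevENorm a f + sobolevENorm a g := by
  have := sobolevENorm_sub_le a f (-g)
  rwa [sub_neg_eq_add, sobolevENorm_neg] at this

theorem sobolevENorm_zero (a : ℝ) : sobolevENorm a (0 : L2 n) = 0 := by
  have h : sobolevENorm a (0 : L2 n) ^ 2 = 0 := by
    rw [sobolevENorm_sq]
    have : (𝓕 (0 : L2 n) : L2 n) = 0 := map_zero (FourierTransform.fourierCLM ℂ (L2 n))
    rw [this, lintegral_eq_zero_of_ae_eq_zero]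
    filter_upwards [Lp.coeFn_zero ℂ 2 (volume : Measure (E n))] with x hx
    rw [hx]
    simp
  simpa using h

/-! ### Translations and differences -/

/-- The translation `f ↦ f(· + h)` of `L²`. -/
def shift (h : E n) : L2 n →ₗᵢ[ℂ] L2 n :=
  Lp.compMeasurePreservingₗᵢ ℂ (fun x => x + h) (measurePreserving_add_right volume h)

theorem shift_coeFn (h : E n) (f : L2 n) : shift h f =ᵐ[volume] fun x => f (x + h) :=
  Lp.coeFn_compMeasurePreserving f (measurePreserving_add_right volume h)

/-- The difference `f(· + h) - f`. -/
def diff (h : E n) (f : L2 n) : L2 n := shift h f - f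

theorem diff_coeFn (h : E n) (f : L2 n) : diff h f =ᵐ[volume] fun x => f (x + h) - f x := by
  filter_upwards [shift_coeFn h f, Lp.coeFn_sub (shift h f) f] with x h1 h2
  rw [diff, h2, Pi.sub_apply, h1]

theorem diff_sub (h : E n) (f g : L2 n) : diff h (f - g) = diff h f - diff h g := by
  simp only [diff, map_sub]
  abel

theorem continuous_diff (h : E n) : Continuous (diff h : L2 n → L2 n) :=
  (shift h).continuous.sub continuous_id

/-- The function `ξ ↦ e^{2πi⟨h,ξ⟩}`. -/
def character (h : E n) : E n →ᵇ ℂ :=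
  BoundedContinuousFunction.ofNormedAddCommGroup
    (fun ξ : E n => Complex.exp (((2 * Real.pi * inner ℝ h ξ : ℝ) : ℂ) * Complex.I))
    (by fun_prop) 1 (fun ξ => (Complex.norm_exp_ofReal_mul_I _).le)

theorem character_apply (h ξ : E n) :
    character h ξ = Complex.exp (((2 * Real.pi * inner ℝ h ξ : ℝ) : ℂ) * Complex.I) := rfl

theorem continuous_mulOp (m : E n →ᵇ ℂ) : Continuous (mulOp m : L2 n → L2 n) := by
  refine (LipschitzWith.of_dist_le_mul (K := ⟨‖m‖, norm_nonneg _⟩) fun f g => ?_).continuous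
  rw [dist_eq_norm, dist_eq_norm, ← mulOp_sub]
  exact norm_mulOp_le m _

theorem fourier_compSubConstCLM (η : 𝓢(E n, ℂ)) (h ξ : E n) :
    (𝓕 (η.compSubConstCLM ℂ (-h))) ξ = character h ξ * (𝓕 η) ξ := by
  rw [SchwartzMap.fourier_coe, SchwartzMap.fourier_coe, Real.fourier_eq',
    Real.fourier_eq', ← integral_const_mul, ← integral_sub_right_eq_self _ h]
  refine integral_congr_ae (Eventually.of_forall fun x => ?_)
  simp only [SchwartzMap.compSubConstCLM_apply, smul_eq_mul, sub_neg_eq_add, sub_add_cancel]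
  rw [character_apply, ← mul_assoc, ← Complex.exp_add, inner_sub_left]
  congr 2
  push_cast
  ring

theorem fourier_shift (h : E n) (f : L2 n) :
    (𝓕 (shift h f) : L2 n) = mulOp (character h) (𝓕 f) := by
  refine DenseRange.induction_on (p := fun f : L2 n =>
      (𝓕 (shift h f) : L2 n) = mulOp (character h) (𝓕 f))
    (SchwartzMap.denseRange_toLpCLM (E := E n) (F := ℂ) (μ := volume) (p := 2)
      ENNReal.ofNat_ne_top) f ?_ ?_
  · refine isClosed_eq ?_ ?_
    · exact (FourierTransform.fourierCLM ℂ (L2 n)).continuous.comp (shift h).continuous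
    · exact (continuous_mulOp _).comp (FourierTransform.fourierCLM ℂ (L2 n)).continuous
  · intro η
    have h1 : shift h (η.toLp 2) = (η.compSubConstCLM ℂ (-h)).toLp 2 := by
      apply Lp.ext
      have hq := (measurePreserving_add_right (volume : Measure (E n)) h).quasiMeasurePreserving
      filter_upwards [shift_coeFn h (η.toLp 2), hq.ae (η.coeFn_toLp 2 volume),
        (η.compSubConstCLM ℂ (-h)).coeFn_toLp 2 volume] with x a b c
      rw [a, b, c, SchwartzMap.compSubConstCLM_apply, sub_neg_eq_add]
    rw [SchwartzMap.toLpCLM_apply, h1, SchwartzMap.toLp_fourier_eq, SchwartzMap.toLp_fourier_eq]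
    apply Lp.ext
    filter_upwards [mulOp_coeFn (character h) ((𝓕 η).toLp 2), (𝓕 η).coeFn_toLp 2 volume,
      (𝓕 (η.compSubConstCLM ℂ (-h))).coeFn_toLp 2 volume] with ξ a b c
    rw [a, b, c, fourier_compSubConstCLM]

/-- Plancherel's theorem for differences. -/
theorem enorm_diff_sq (h : E n) (f : L2 n) :
    ‖diff h f‖ₑ ^ 2 = ∫⁻ ξ, ‖character h ξ - 1‖ₑ ^ 2 * ‖(𝓕 f : L2 n) ξ‖ₑ ^ 2 := by
  rw [← enorm_fourier, enorm_sq_eq_lintegral, diff, fourier_sub_L2, fourier_shift]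
  refine lintegral_congr_ae ?_
  filter_upwards [Lp.coeFn_sub (mulOp (character h) (𝓕 f : L2 n)) (𝓕 f),
    mulOp_coeFn (character h) (𝓕 f : L2 n)] with ξ h1 h2
  rw [h1, Pi.sub_apply, h2, ← sub_one_mul, enorm_mul, mul_pow]

/-! ### Sobolev norms through finite families of differences -/

/-- A sequence of finite weighted families of translation vectors whose difference energies
`∑ₖ wₖ ‖f(· + hₖ) - f‖²` are bounded by the square of the `H^a` norm and, together with the `L²`
norm, recover it in the limit. The bound on `∑ₖ wₖ |hₖ|²` makes the energies compatible with
multiplication by Lipschitz functions. -/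
structure DiffScheme (n : ℕ) (a : ℝ) where
  idx : ℕ → Finset (ℕ × Fin n)
  wt : ℕ → ℕ × Fin n → ℝ
  vec : ℕ × Fin n → E n
  bd : ℝ
  wt_nonneg : ∀ N k, 0 ≤ wt N k
  one_le_bd : 1 ≤ bd
  sum_norm_le : ∀ N, ∑ k ∈ idx N, wt N k * ‖vec k‖ ^ 2 ≤ bd
  sum_symbol_le : ∀ N ξ, ∑ k ∈ idx N, wt N k * ‖character (vec k) ξ - 1‖ ^ 2 ≤
    bd * (1 + ‖ξ‖ ^ 2) ^ a
  weight_le : ∀ ξ, ∀ᶠ N in atTop, (1 + ‖ξ‖ ^ 2) ^ a ≤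
    bd * (1 + ∑ k ∈ idx N, wt N k * ‖character (vec k) ξ - 1‖ ^ 2)

theorem norm_exp_sub_one_sq_le_four (θ : ℝ) : ‖Complex.exp ((θ : ℂ) * Complex.I) - 1‖ ^ 2 ≤ 4 := by
  have : ‖Complex.exp ((θ : ℂ) * Complex.I) - 1‖ ≤ 2 := by
    refine (norm_sub_le _ _).trans_eq ?_
    rw [Complex.norm_exp_ofReal_mul_I]; norm_num
  nlinarith [norm_nonneg (Complex.exp ((θ : ℂ) * Complex.I) - 1)]

theorem norm_exp_sub_one_sq_le (θ : ℝ) :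
    ‖Complex.exp ((θ : ℂ) * Complex.I) - 1‖ ^ 2 ≤ θ ^ 2 := by
  rw [← sq_abs θ]
  exact pow_le_pow_left₀ (norm_nonneg _) (norm_sub_one_exp_le θ) 2

theorem le_norm_exp_sub_one_sq {y : ℝ} (hy : |y| ≤ 1 / 2) :
    16 * y ^ 2 ≤ ‖Complex.exp (((2 * Real.pi * y : ℝ) : ℂ) * Complex.I) - 1‖ ^ 2 := by
  rw [mul_comm _ Complex.I, Complex.norm_exp_I_mul_ofReal_sub_one]
  have h1 : 2 * Real.pi * y / 2 = Real.pi * y := by ring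
  rw [h1, Real.norm_eq_abs, sq_abs, mul_pow]
  have hpi := Real.pi_pos
  have h2 : 2 * |y| ≤ |Real.sin (Real.pi * y)| := by
    have h3 := Real.mul_le_sin (x := Real.pi * |y|) (by positivity) (by nlinarith)
    have h4 : 2 / Real.pi * (Real.pi * |y|) = 2 * |y| := by field_simp
    rw [h4] at h3
    rcases abs_cases y with ⟨h, _⟩ | ⟨h, _⟩
    · rw [h] at h3 ⊢
      exact h3.trans (le_abs_self _)
    · rw [h] at h3 ⊢
      rw [show Real.pi * -y = -(Real.pi * y) by ring, Real.sin_neg] at h3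
      exact h3.trans (neg_le_abs _)
  have h5 : (2 * |y|) ^ 2 ≤ |Real.sin (Real.pi * y)| ^ 2 := pow_le_pow_left₀ (by positivity) h2 2
  rw [sq_abs, mul_pow, sq_abs] at h5
  linarith

/-- The symbol of the dyadic differences in one variable. -/
def dyadicSymbol (r : ℝ) (N : ℕ) (y : ℝ) : ℝ :=
  ∑ j ∈ Finset.range N,
    r ^ j * ‖Complex.exp (((2 * Real.pi * ((2⁻¹ : ℝ) ^ j * y) : ℝ) : ℂ) * Complex.I) - 1‖ ^ 2

theorem dyadicSymbol_mono {r : ℝ} (hr : 0 ≤ r) (y : ℝ) : Monotone (dyadicSymbol r · y) := by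
  intro N M h
  exact Finset.sum_le_sum_of_subset_of_nonneg (Finset.range_mono h)
    fun j _ _ => by positivity

theorem dyadicSymbol_succ (r : ℝ) (N : ℕ) (y : ℝ) : dyadicSymbol r (N + 1) y =
    r * dyadicSymbol r N (y / 2) +
      ‖Complex.exp (((2 * Real.pi * y : ℝ) : ℂ) * Complex.I) - 1‖ ^ 2 := by
  rw [dyadicSymbol, Finset.sum_range_succ', dyadicSymbol, Finset.mul_sum, pow_zero, pow_zero,
    one_mul, one_mul]
  congr 1
  refine Finset.sum_congr rfl fun j _ => ?_
  rw [pow_succ r, pow_succ (2⁻¹ : ℝ), show (2⁻¹ : ℝ) ^ j * 2⁻¹ * y = (2⁻¹ : ℝ) ^ j * (y / 2) by ring]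
  ring

/-- For `|y| ≤ 1` the series is geometric; doubling `y` shifts the series by one step. -/
theorem dyadicSymbol_le {r : ℝ} (h1 : 1 < r) (h4 : r < 4) (m : ℕ) :
    ∀ (N : ℕ) (y : ℝ), |y| ≤ 2 ^ m → dyadicSymbol r N y ≤
      (4 * Real.pi ^ 2 * (1 - r / 4)⁻¹ + 4 / (r - 1)) * r ^ m - 4 / (r - 1) := by
  have hr1 : 0 < r - 1 := by linarith
  have hB : 0 ≤ 4 * Real.pi ^ 2 * (1 - r / 4)⁻¹ :=
    mul_nonneg (by positivity) (inv_nonneg.2 (by linarith))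
  induction m with
  | zero =>
    intro N y hy
    rw [pow_zero] at hy
    rw [pow_zero, mul_one, add_sub_cancel_right]
    calc dyadicSymbol r N y ≤ ∑ j ∈ Finset.range N, 4 * Real.pi ^ 2 * (r / 4) ^ j := by
          refine Finset.sum_le_sum fun j _ => ?_
          calc _ ≤ r ^ j * (2 * Real.pi * ((2⁻¹ : ℝ) ^ j * y)) ^ 2 :=
                mul_le_mul_of_nonneg_left (norm_exp_sub_one_sq_le _) (by positivity)
            _ = 4 * Real.pi ^ 2 * (r / 4) ^ j * y ^ 2 := by
                rw [div_eq_mul_inv, mul_pow r, show (4 : ℝ)⁻¹ = (2⁻¹) ^ 2 by norm_num,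
                  ← pow_mul, mul_comm 2 j, pow_mul]
                ring
            _ ≤ _ := mul_le_of_le_one_right (by positivity) (by
                rw [← sq_abs]; exact pow_le_one₀ (abs_nonneg _) hy)
      _ = 4 * Real.pi ^ 2 * ∑ j ∈ Finset.range N, (r / 4) ^ j := by rw [Finset.mul_sum]
      _ ≤ _ := by
          refine mul_le_mul_of_nonneg_left ?_ (by positivity)
          rw [← tsum_geometric_of_lt_one (by positivity) (by linarith)]
          exact (summable_geometric_of_lt_one (by positivity) (by linarith)).sum_le_tsum _
            fun j _ => by positivity
  | succ m ih =>
    intro N y hy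
    have hstep : dyadicSymbol r N y ≤ r * dyadicSymbol r N (y / 2) + 4 := by
      refine (dyadicSymbol_mono (by linarith) y (Nat.le_succ N)).trans ?_
      rw [Nat.succ_eq_add_one]
      simp only [dyadicSymbol_succ]
      exact add_le_add le_rfl (norm_exp_sub_one_sq_le_four _)
    have h2 := ih N (y / 2) (by
      rw [abs_div, abs_two, div_le_iff₀ two_pos, ← pow_succ]; exact hy)
    calc _ ≤ r * ((4 * Real.pi ^ 2 * (1 - r / 4)⁻¹ + 4 / (r - 1)) * r ^ m - 4 / (r - 1)) + 4 :=
          hstep.trans (add_le_add (mul_le_mul_of_nonneg_left h2 (by linarith)) le_rfl)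
      _ = _ := by
          have hne : r - 1 ≠ 0 := hr1.ne'
          rw [pow_succ]
          field_simp
          ring

/-- The vectors `2^{-j} eᵢ`. -/
def dyadicVec (k : ℕ × Fin n) : E n := (2⁻¹ : ℝ) ^ k.1 • EuclideanSpace.single k.2 (1 : ℝ)

theorem norm_dyadicVec (k : ℕ × Fin n) : ‖dyadicVec k‖ = (2⁻¹ : ℝ) ^ k.1 := by
  rw [dyadicVec, norm_smul, PiLp.norm_single, norm_one, mul_one, norm_pow]
  norm_num

theorem character_dyadicVec (k : ℕ × Fin n) (ξ : E n) : character (dyadicVec k) ξ =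
    Complex.exp (((2 * Real.pi * ((2⁻¹ : ℝ) ^ k.1 * ξ k.2) : ℝ) : ℂ) * Complex.I) := by
  rw [character_apply, dyadicVec, real_inner_smul_left, EuclideanSpace.inner_single_left]
  simp

/-- For `a = 0` no differences are needed. -/
theorem nonempty_diffScheme_zero : Nonempty (DiffScheme n 0) :=
  ⟨{ idx := fun _ => ∅
     wt := fun _ _ => 0
     vec := dyadicVec
     bd := 1
     wt_nonneg := fun _ _ => le_rfl
     one_le_bd := le_rfl
     sum_norm_le := fun _ => by simp
     sum_symbol_le := fun _ _ => by simp
     weight_le := fun _ => by simp }⟩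

/-- For `a = 1` difference quotients at the single scale `2^{-N}` recover the gradient as `N → ∞`.
-/
theorem nonempty_diffScheme_one : Nonempty (DiffScheme n 1) := by
  have hpi : (3 : ℝ) < Real.pi := Real.pi_gt_three
  have h4 : ∀ N : ℕ, (4 : ℝ) ^ N * ((2⁻¹ : ℝ) ^ N) ^ 2 = 1 := by
    intro N
    rw [← pow_mul, mul_comm N, pow_mul, ← mul_pow]
    norm_num
  refine ⟨{ idx := fun N => {N} ×ˢ Finset.univ
            wt := fun N _ => 4 ^ N
            vec := dyadicVec
            bd := max (n : ℝ) (4 * Real.pi ^ 2)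
            wt_nonneg := fun _ _ => by positivity
            one_le_bd := le_max_of_le_right (by nlinarith)
            sum_norm_le := fun N => ?_
            sum_symbol_le := fun N ξ => ?_
            weight_le := fun ξ => ?_ }⟩
  · rw [Finset.sum_product]
    simp only [norm_dyadicVec, Finset.sum_singleton, h4]
    simp
  · rw [Finset.sum_product, Finset.sum_singleton, Real.rpow_one]
    simp only [character_dyadicVec]
    calc _ ≤ ∑ i : Fin n, 4 * Real.pi ^ 2 * ξ i ^ 2 := by
          refine Finset.sum_le_sum fun i _ => ?_
          calc _ ≤ (4 : ℝ) ^ N * (2 * Real.pi * ((2⁻¹ : ℝ) ^ N * ξ i)) ^ 2 :=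
                mul_le_mul_of_nonneg_left (norm_exp_sub_one_sq_le _) (by positivity)
            _ = ((4 : ℝ) ^ N * ((2⁻¹ : ℝ) ^ N) ^ 2) * (4 * Real.pi ^ 2 * ξ i ^ 2) := by ring
            _ = _ := by rw [h4, one_mul]
      _ = 4 * Real.pi ^ 2 * ‖ξ‖ ^ 2 := by
          rw [EuclideanSpace.real_norm_sq_eq, Finset.mul_sum]
      _ ≤ _ := by
          refine mul_le_mul (le_max_right _ _) (by linarith) (by positivity) ?_
          exact le_max_of_le_right (by positivity)
  · have hev : ∀ᶠ N : ℕ in atTop, (2⁻¹ : ℝ) ^ N * ‖ξ‖ < 1 / 2 := by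
      have : Tendsto (fun N : ℕ => (2⁻¹ : ℝ) ^ N * ‖ξ‖) atTop (𝓝 (0 * ‖ξ‖)) :=
        (tendsto_pow_atTop_nhds_zero_of_lt_one (by norm_num) (by norm_num)).mul_const _
      rw [zero_mul] at this
      exact this.eventually_lt_const (by norm_num)
    filter_upwards [hev] with N hN
    rw [Finset.sum_product, Finset.sum_singleton, Real.rpow_one]
    simp only [character_dyadicVec]
    have hlow : ‖ξ‖ ^ 2 ≤ ∑ i : Fin n, (4 : ℝ) ^ N * ‖Complex.exp
        (((2 * Real.pi * ((2⁻¹ : ℝ) ^ N * ξ i) : ℝ) : ℂ) * Complex.I) - 1‖ ^ 2 := by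
      rw [EuclideanSpace.real_norm_sq_eq]
      refine Finset.sum_le_sum fun i _ => ?_
      have hi : |(2⁻¹ : ℝ) ^ N * ξ i| ≤ 1 / 2 := by
        rw [abs_mul, abs_of_nonneg (by positivity : (0 : ℝ) ≤ (2⁻¹ : ℝ) ^ N)]
        refine le_trans ?_ hN.le
        gcongr
        exact PiLp.norm_apply_le ξ i
      calc ξ i ^ 2 ≤ 16 * (((4 : ℝ) ^ N * ((2⁻¹ : ℝ) ^ N) ^ 2) * ξ i ^ 2) := by
            rw [h4]; nlinarith [sq_nonneg (ξ i)]
        _ = (4 : ℝ) ^ N * (16 * ((2⁻¹ : ℝ) ^ N * ξ i) ^ 2) := by ring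
        _ ≤ _ := mul_le_mul_of_nonneg_left (le_norm_exp_sub_one_sq hi) (by positivity)
    refine le_trans ?_ (le_mul_of_one_le_left (by positivity)
      (le_max_of_le_right (by nlinarith : (1 : ℝ) ≤ 4 * Real.pi ^ 2)))
    linarith

/-- For `0 < a < 1` the differences at the scales `2^{-j}`, `j ≤ N`, have weights `4^{ja}`: a
discrete form of the Gagliardo seminorm. Here `a < 1` makes `∑ⱼ 4^{ja} |2^{-j}|²` converge, and `0 < a` is
needed for the upper bound at high frequencies. -/
theorem nonempty_diffScheme_of_lt_one {a : ℝ} (h0 : 0 < a) (h1 : a < 1) :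
    Nonempty (DiffScheme n a) := by
  set r : ℝ := 4 ^ a with hr
  have hr1 : 1 < r := Real.one_lt_rpow (by norm_num) h0
  have hr4 : r < 4 := by
    calc r < (4 : ℝ) ^ (1 : ℝ) := Real.rpow_lt_rpow_of_exponent_lt (by norm_num) h1
      _ = 4 := Real.rpow_one 4
  have hrpow : ∀ m : ℕ, r ^ m = ((4 : ℝ) ^ m) ^ a := by
    intro m
    rw [hr, ← Real.rpow_natCast, ← Real.rpow_mul (by norm_num), mul_comm, Real.rpow_mul (by norm_num),
      Real.rpow_natCast]
  set B : ℝ := 4 * Real.pi ^ 2 * (1 - r / 4)⁻¹ + 4 / (r - 1) with hB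
  have hB0 : 0 ≤ B := add_nonneg
    (mul_nonneg (by positivity) (inv_nonneg.2 (by linarith))) (div_nonneg (by norm_num) (by linarith))
  have hupper : ∀ N y, dyadicSymbol r N y ≤ B * r * (1 + y ^ 2) ^ a := by
    intro N y
    have hbase : (1 : ℝ) ≤ (1 + y ^ 2) ^ a := Real.one_le_rpow (by nlinarith [sq_nonneg y]) h0.le
    have h41 : 0 ≤ 4 / (r - 1) := div_nonneg (by norm_num) (by linarith)
    by_cases hy : |y| ≤ 1
    · have := dyadicSymbol_le hr1 hr4 0 N y (by simpa using hy)
      rw [pow_zero, mul_one] at this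
      calc _ ≤ B := by linarith
        _ ≤ B * (r * (1 + y ^ 2) ^ a) := le_mul_of_one_le_right hB0 (one_le_mul_of_one_le_of_one_le
            hr1.le hbase)
        _ = _ := by ring
    · obtain ⟨m, hm1, hm2⟩ := exists_nat_pow_near (not_le.1 hy).le (one_lt_two : (1 : ℝ) < 2)
      have := dyadicSymbol_le hr1 hr4 (m + 1) N y hm2.le
      calc _ ≤ B * r ^ (m + 1) := by linarith
        _ = B * r * r ^ m := by ring
        _ ≤ _ := by
          refine mul_le_mul_of_nonneg_left ?_ (by positivity)
          rw [hrpow]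
          refine Real.rpow_le_rpow (by positivity) ?_ h0.le
          rw [show (4 : ℝ) = 2 ^ 2 by norm_num, ← pow_mul, mul_comm, pow_mul, ← sq_abs y]
          have := pow_le_pow_left₀ (by positivity) hm1 2
          linarith
  have hsum : ∀ N (ξ : E n), ∑ k ∈ Finset.range (N + 1) ×ˢ (Finset.univ : Finset (Fin n)),
      r ^ k.1 * ‖character (dyadicVec k) ξ - 1‖ ^ 2 =
      ∑ i : Fin n, dyadicSymbol r (N + 1) (ξ i) := by
    intro N ξ
    rw [Finset.sum_product_right]
    simp only [character_dyadicVec, dyadicSymbol]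
  have hcoord : ∀ (ξ : E n) i, ξ i ^ 2 ≤ ‖ξ‖ ^ 2 := by
    intro ξ i
    rw [← sq_abs]
    exact pow_le_pow_left₀ (abs_nonneg _) (PiLp.norm_apply_le ξ i) 2
  have hn0 : (0 : ℝ) ≤ n := Nat.cast_nonneg n
  set D : ℝ := n * (B * r) + n * (1 - r / 4)⁻¹ + (n + 4) with hD
  have hinv : 0 ≤ (1 - r / 4)⁻¹ := inv_nonneg.2 (by linarith)
  have hD1 : n * (B * r) ≤ D := by rw [hD]; nlinarith [mul_nonneg hn0 hinv]
  have hD2 : n * (1 - r / 4)⁻¹ ≤ D := by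
    have : 0 ≤ n * (B * r) := by positivity
    rw [hD]; linarith
  have hD3 : n + 4 ≤ D := by
    have : 0 ≤ n * (B * r) := by positivity
    rw [hD]; nlinarith [mul_nonneg hn0 hinv]
  refine ⟨{ idx := fun N => Finset.range (N + 1) ×ˢ Finset.univ
            wt := fun _ k => r ^ k.1
            vec := dyadicVec
            bd := D
            wt_nonneg := fun _ _ => by positivity
            one_le_bd := by linarith
            sum_norm_le := fun N => ?_
            sum_symbol_le := fun N ξ => ?_
            weight_le := fun ξ => ?_ }⟩
  · refine le_trans ?_ hD2
    rw [Finset.sum_product_right]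
    simp only [norm_dyadicVec]
    rw [Finset.sum_const, Finset.card_univ, Fintype.card_fin, nsmul_eq_mul]
    refine mul_le_mul_of_nonneg_left ?_ hn0
    rw [← tsum_geometric_of_lt_one (by positivity) (by linarith)]
    refine le_trans (le_of_eq (Finset.sum_congr rfl fun j _ => ?_))
      ((summable_geometric_of_lt_one (by positivity) (by linarith)).sum_le_tsum (Finset.range (N + 1))
        fun j _ => by positivity)
    rw [← pow_mul, mul_comm j, pow_mul, ← mul_pow]
    congr 1
    ring
  · rw [hsum]
    calc _ ≤ ∑ i : Fin n, B * r * (1 + ‖ξ‖ ^ 2) ^ a := by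
          refine Finset.sum_le_sum fun i _ => (hupper _ _).trans ?_
          refine mul_le_mul_of_nonneg_left (Real.rpow_le_rpow (by positivity) ?_ h0.le)
            (by positivity)
          linarith [hcoord ξ i]
      _ = n * (B * r) * (1 + ‖ξ‖ ^ 2) ^ a := by
          rw [Finset.sum_const, Finset.card_univ, Fintype.card_fin, nsmul_eq_mul]; ring
      _ ≤ _ := mul_le_mul_of_nonneg_right hD1 (by positivity)
  · simp only [hsum]
    have hDpos : 0 ≤ D := by linarith
    have hS0 : ∀ N, 0 ≤ ∑ i : Fin n, dyadicSymbol r (N + 1) (ξ i) := fun N =>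
      Finset.sum_nonneg fun i _ => Finset.sum_nonneg fun j _ => by positivity
    have hsmall : ∀ N, (∀ i, |ξ i| ≤ 1 / 2) → (1 + ‖ξ‖ ^ 2) ^ a ≤
        D * (1 + ∑ i : Fin n, dyadicSymbol r (N + 1) (ξ i)) := by
      intro N hi
      have hnorm : ‖ξ‖ ^ 2 ≤ n := by
        rw [EuclideanSpace.real_norm_sq_eq]
        calc _ ≤ ∑ i : Fin n, (1 : ℝ) := Finset.sum_le_sum fun i _ => by
              have := hi i
              rw [← sq_abs]
              exact pow_le_one₀ (abs_nonneg _) (by linarith)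
          _ = n := by simp
      calc (1 + ‖ξ‖ ^ 2) ^ a ≤ (1 + ‖ξ‖ ^ 2) ^ (1 : ℝ) :=
            Real.rpow_le_rpow_of_exponent_le (by nlinarith [sq_nonneg ‖ξ‖]) h1.le
        _ = 1 + ‖ξ‖ ^ 2 := Real.rpow_one _
        _ ≤ D * 1 := by linarith
        _ ≤ _ := mul_le_mul_of_nonneg_left (by linarith [hS0 N]) hDpos
    by_cases hall : ∀ i, |ξ i| ≤ 1 / 2
    · exact Eventually.of_forall fun N => hsmall N hall
    push Not at hall
    obtain ⟨i₀, hi₀⟩ := hall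
    -- the largest coordinate controls `|ξ|`
    obtain ⟨i, -, hi⟩ := Finset.exists_max_image Finset.univ (fun i => |ξ i|) ⟨i₀, Finset.mem_univ _⟩
    have hy : 1 / 2 < |ξ i| := hi₀.trans_le (hi i₀ (Finset.mem_univ _))
    obtain ⟨m, hm1, hm2⟩ := exists_nat_pow_near (x := 2 * |ξ i|) (by linarith)
      (one_lt_two : (1 : ℝ) < 2)
    filter_upwards [eventually_ge_atTop (m + 1)] with N hN
    have hpow : (2⁻¹ : ℝ) ^ (m + 1) * 2 ^ (m + 1) = 1 := by rw [← mul_pow]; norm_num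
    have hp0 : (0 : ℝ) < (2⁻¹ : ℝ) ^ (m + 1) := by positivity
    have hz : |(2⁻¹ : ℝ) ^ (m + 1) * ξ i| = (2⁻¹ : ℝ) ^ (m + 1) * |ξ i| := by
      rw [abs_mul, abs_of_pos hp0]
    have hz1 : |(2⁻¹ : ℝ) ^ (m + 1) * ξ i| ≤ 1 / 2 := by rw [hz]; nlinarith
    have hz2 : 1 / 4 ≤ |(2⁻¹ : ℝ) ^ (m + 1) * ξ i| := by
      rw [hz]
      have : (2 : ℝ) ^ (m + 1) ≤ 4 * |ξ i| := by rw [pow_succ]; linarith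
      nlinarith
    have hterm : r ^ (m + 1) ≤ dyadicSymbol r (N + 1) (ξ i) := by
      calc r ^ (m + 1) ≤ r ^ (m + 1) * (16 * ((2⁻¹ : ℝ) ^ (m + 1) * ξ i) ^ 2) := by
            refine le_mul_of_one_le_right (by positivity) ?_
            rw [← sq_abs]
            nlinarith
        _ ≤ r ^ (m + 1) * ‖Complex.exp
              (((2 * Real.pi * ((2⁻¹ : ℝ) ^ (m + 1) * ξ i) : ℝ) : ℂ) * Complex.I) - 1‖ ^ 2 :=
            mul_le_mul_of_nonneg_left (le_norm_exp_sub_one_sq hz1) (by positivity)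
        _ ≤ _ := Finset.single_le_sum (f := fun j => r ^ j * ‖Complex.exp
              (((2 * Real.pi * ((2⁻¹ : ℝ) ^ j * ξ i) : ℝ) : ℂ) * Complex.I) - 1‖ ^ 2)
              (fun j _ => by positivity) (Finset.mem_range.2 (by omega))
    have hnorm : 1 + ‖ξ‖ ^ 2 ≤ (n + 4) * (4 : ℝ) ^ (m + 1) := by
      have h5 : ‖ξ‖ ^ 2 ≤ n * |ξ i| ^ 2 := by
        rw [EuclideanSpace.real_norm_sq_eq]
        calc _ ≤ ∑ j : Fin n, |ξ i| ^ 2 := Finset.sum_le_sum fun j _ => by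
              rw [← sq_abs (ξ j)]
              exact pow_le_pow_left₀ (abs_nonneg _) (hi j (Finset.mem_univ _)) 2
          _ = n * |ξ i| ^ 2 := by simp
      have h6 : |ξ i| ^ 2 ≤ (4 : ℝ) ^ (m + 1) := by
        rw [show (4 : ℝ) = 2 ^ 2 by norm_num, ← pow_mul, mul_comm, pow_mul]
        exact pow_le_pow_left₀ (abs_nonneg _) (by linarith) 2
      have h7 : (1 : ℝ) ≤ 4 ^ (m + 1) := one_le_pow₀ (by norm_num)
      nlinarith
    have hle : r ^ (m + 1) ≤ ∑ i : Fin n, dyadicSymbol r (N + 1) (ξ i) :=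
      hterm.trans (Finset.single_le_sum (f := fun i => dyadicSymbol r (N + 1) (ξ i))
        (fun i _ => Finset.sum_nonneg fun j _ => by positivity) (Finset.mem_univ i))
    calc (1 + ‖ξ‖ ^ 2) ^ a ≤ ((n + 4) * (4 : ℝ) ^ (m + 1)) ^ a :=
          Real.rpow_le_rpow (by positivity) hnorm h0.le
      _ = ((n : ℝ) + 4) ^ a * r ^ (m + 1) := by
          rw [Real.mul_rpow (by positivity) (by positivity), hrpow]
      _ ≤ (n + 4) * r ^ (m + 1) := by
          gcongr
          calc ((n : ℝ) + 4) ^ a ≤ (n + 4) ^ (1 : ℝ) :=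
                Real.rpow_le_rpow_of_exponent_le (by linarith) h1.le
            _ = _ := Real.rpow_one _
      _ ≤ _ := by
          refine mul_le_mul hD3 ?_ (by positivity) hDpos
          linarith

theorem nonempty_diffScheme {a : ℝ} (h0 : 0 ≤ a) (h1 : a ≤ 1) : Nonempty (DiffScheme n a) := by
  rcases h0.eq_or_lt with rfl | h0
  · exact nonempty_diffScheme_zero
  rcases h1.eq_or_lt with rfl | h1
  · exact nonempty_diffScheme_one
  · exact nonempty_diffScheme_of_lt_one h0 h1

variable {a : ℝ}

/-! ### Difference energies -/

theorem enorm_sq_eq_ofReal {F : Type*} [NormedAddCommGroup F] (z : F) :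
    ‖z‖ₑ ^ 2 = ENNReal.ofReal (‖z‖ ^ 2) := by
  rw [← ofReal_norm, ENNReal.ofReal_pow (norm_nonneg _)]

theorem enorm_add_sq_le {F : Type*} [NormedAddCommGroup F] (z w : F) :
    ‖z + w‖ₑ ^ 2 ≤ 2 * ‖z‖ₑ ^ 2 + 2 * ‖w‖ₑ ^ 2 := by
  rw [enorm_sq_eq_ofReal, enorm_sq_eq_ofReal, enorm_sq_eq_ofReal,
    show (2 : ℝ≥0∞) = ENNReal.ofReal 2 by simp, ← ENNReal.ofReal_mul two_pos.le,
    ← ENNReal.ofReal_mul two_pos.le, ← ENNReal.ofReal_add (by positivity) (by positivity)]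
  refine ENNReal.ofReal_le_ofReal ?_
  have := norm_add_le z w
  nlinarith [norm_nonneg (z + w), norm_nonneg z, norm_nonneg w, sq_nonneg (‖z‖ - ‖w‖)]

/-- The difference energy `∑ₖ wₖ ‖f(· + hₖ) - f‖²` of the `N`-th family of a scheme. -/
def DiffScheme.energy (S : DiffScheme n a) (N : ℕ) (f : L2 n) : ℝ≥0∞ :=
  ∑ k ∈ S.idx N, ENNReal.ofReal (S.wt N k) * ‖diff (S.vec k) f‖ₑ ^ 2

/-- The Fourier symbol of the difference energy. -/
def DiffScheme.symbol (S : DiffScheme n a) (N : ℕ) (ξ : E n) : ℝ :=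
  ∑ k ∈ S.idx N, S.wt N k * ‖character (S.vec k) ξ - 1‖ ^ 2

theorem DiffScheme.continuous_symbol (S : DiffScheme n a) (N : ℕ) : Continuous (S.symbol N) :=
  continuous_finsetSum _ fun k _ =>
    continuous_const.mul ((((character (S.vec k)).continuous.sub continuous_const).norm).pow 2)

theorem DiffScheme.symbol_nonneg (S : DiffScheme n a) (N : ℕ) (ξ : E n) : 0 ≤ S.symbol N ξ :=
  Finset.sum_nonneg fun k _ => mul_nonneg (S.wt_nonneg N k) (sq_nonneg _)

theorem DiffScheme.bd_nonneg (S : DiffScheme n a) : 0 ≤ S.bd := zero_le_one.trans S.one_le_bd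

theorem measurable_enorm_sq (f : L2 n) : Measurable fun x : E n => ‖f x‖ₑ ^ 2 :=
  (Lp.stronglyMeasurable f).measurable.enorm.pow_const 2

theorem DiffScheme.energy_eq (S : DiffScheme n a) (N : ℕ) (f : L2 n) :
    S.energy N f = ∫⁻ ξ, ENNReal.ofReal (S.symbol N ξ) * ‖(𝓕 f : L2 n) ξ‖ₑ ^ 2 := by
  have hm : ∀ k, Measurable fun ξ : E n =>
      ‖character (S.vec k) ξ - 1‖ₑ ^ 2 * ‖(𝓕 f : L2 n) ξ‖ₑ ^ 2 := fun k =>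
    (((character (S.vec k)).continuous.sub continuous_const).enorm.measurable.pow_const 2).mul
      (measurable_enorm_sq _)
  unfold DiffScheme.energy
  simp_rw [enorm_diff_sq]
  rw [← Finset.sum_congr rfl fun k _ => lintegral_const_mul (ENNReal.ofReal (S.wt N k)) (hm k),
    ← lintegral_finsetSum _ fun k _ => (hm k).const_mul _]
  refine lintegral_congr fun ξ => ?_
  rw [DiffScheme.symbol, ENNReal.ofReal_sum_of_nonneg
    fun k _ => mul_nonneg (S.wt_nonneg N k) (sq_nonneg _), Finset.sum_mul]
  refine Finset.sum_congr rfl fun k _ => ?_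
  rw [ENNReal.ofReal_mul (S.wt_nonneg N k), enorm_sq_eq_ofReal (character (S.vec k) ξ - 1), mul_assoc]

theorem DiffScheme.energy_le (S : DiffScheme n a) (N : ℕ) (f : L2 n) :
    S.energy N f ≤ ENNReal.ofReal S.bd * sobolevENorm a f ^ 2 := by
  have hm : Measurable fun ξ : E n => weight a ξ * ‖(𝓕 f : L2 n) ξ‖ₑ ^ 2 :=
    (measurable_weight a).mul (measurable_enorm_sq _)
  rw [S.energy_eq, sobolevENorm_sq, ← lintegral_const_mul _ hm]
  refine lintegral_mono fun ξ => ?_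
  rw [← mul_assoc, weight, ← ENNReal.ofReal_mul S.bd_nonneg]
  gcongr
  exact S.sum_symbol_le N ξ

/-- A bound on all difference energies bounds the `H^a` norm, by Fatou's lemma. -/
theorem DiffScheme.sobolevENorm_sq_le (S : DiffScheme n a) {f : L2 n} {Q : ℝ≥0∞}
    (hQ : ∀ N, S.energy N f ≤ Q) :
    sobolevENorm a f ^ 2 ≤ ENNReal.ofReal S.bd * (‖f‖ₑ ^ 2 + Q) := by
  have hmeas : ∀ N, Measurable fun ξ : E n =>
      ENNReal.ofReal (S.symbol N ξ) * ‖(𝓕 f : L2 n) ξ‖ₑ ^ 2 := fun N =>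
    (S.continuous_symbol N).measurable.ennreal_ofReal.mul (measurable_enorm_sq _)
  have hmeas' : ∀ N, Measurable fun ξ : E n => ‖(𝓕 f : L2 n) ξ‖ₑ ^ 2 +
      ENNReal.ofReal (S.symbol N ξ) * ‖(𝓕 f : L2 n) ξ‖ₑ ^ 2 := fun N =>
    (measurable_enorm_sq _).add (hmeas N)
  rw [sobolevENorm_sq]
  calc _ ≤ ∫⁻ ξ, liminf (fun N => ENNReal.ofReal S.bd * (‖(𝓕 f : L2 n) ξ‖ₑ ^ 2 +
          ENNReal.ofReal (S.symbol N ξ) * ‖(𝓕 f : L2 n) ξ‖ₑ ^ 2)) atTop := by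
        refine lintegral_mono fun ξ => ?_
        refine le_liminf_of_le (by isBoundedDefault) ?_
        filter_upwards [S.weight_le ξ] with N hN
        rw [← one_add_mul, ← mul_assoc]
        gcongr
        rw [weight, ← ENNReal.ofReal_one, ← ENNReal.ofReal_add zero_le_one (S.symbol_nonneg N ξ),
          ← ENNReal.ofReal_mul S.bd_nonneg]
        exact ENNReal.ofReal_le_ofReal hN
    _ ≤ liminf (fun N => ∫⁻ ξ, ENNReal.ofReal S.bd * (‖(𝓕 f : L2 n) ξ‖ₑ ^ 2 +
          ENNReal.ofReal (S.symbol N ξ) * ‖(𝓕 f : L2 n) ξ‖ₑ ^ 2)) atTop :=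
        lintegral_liminf_le fun N => (hmeas' N).const_mul _
    _ ≤ _ := by
        refine liminf_le_of_le (by isBoundedDefault) fun b hb => ?_
        obtain ⟨N, hN⟩ := hb.exists
        refine hN.trans ?_
        rw [lintegral_const_mul _ (hmeas' N),
          lintegral_add_left (measurable_enorm_sq _), ← S.energy_eq, ← enorm_sq_eq_lintegral,
          enorm_fourier]
        gcongr
        exact hQ N

/-! ### Multiplication by Lipschitz functions -/

theorem enorm_diff_mulOp_sq_le (h : E n) {m : E n →ᵇ ℂ} {L : ℝ}
    (hL : ∀ x y, ‖m x - m y‖ ≤ L * ‖x - y‖) (f : L2 n) :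
    ‖diff h (mulOp m f)‖ₑ ^ 2 ≤
      2 * ‖mulOp m (diff h f)‖ₑ ^ 2 + 2 * (ENNReal.ofReal (L ^ 2 * ‖h‖ ^ 2) * ‖f‖ₑ ^ 2) := by
  have hshift : ‖f‖ₑ = ‖shift h f‖ₑ := by
    rw [← ofReal_norm, ← ofReal_norm, (shift h).norm_map]
  have hq := (measurePreserving_add_right (volume : Measure (E n)) h).quasiMeasurePreserving
  rw [hshift, enorm_sq_eq_lintegral, enorm_sq_eq_lintegral, enorm_sq_eq_lintegral,
    ← lintegral_const_mul _ (measurable_enorm_sq _),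
    ← lintegral_const_mul _ (measurable_enorm_sq _),
    ← lintegral_const_mul _ ((measurable_enorm_sq _).const_mul _),
    ← lintegral_add_left ((measurable_enorm_sq _).const_mul _)]
  refine lintegral_mono_ae ?_
  filter_upwards [diff_coeFn h (mulOp m f), mulOp_coeFn m f, hq.ae (mulOp_coeFn m f),
    mulOp_coeFn m (diff h f), diff_coeFn h f, shift_coeFn h f] with x h1 h2 h3 h4 h5 h6
  have heq : diff h (mulOp m f) x = mulOp m (diff h f) x + (m (x + h) - m x) * shift h f x := by
    rw [h1, h2, h3, h4, h5, h6]; ring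
  rw [heq]
  refine (enorm_add_sq_le _ _).trans ?_
  gcongr
  rw [enorm_mul, mul_pow]
  gcongr
  rw [enorm_sq_eq_ofReal]
  refine ENNReal.ofReal_le_ofReal ?_
  have h7 := hL (x + h) x
  rw [add_sub_cancel_left] at h7
  rw [← mul_pow]
  exact pow_le_pow_left₀ (norm_nonneg _) h7 2

theorem DiffScheme.energy_mulOp_le (S : DiffScheme n a) (N : ℕ) {m : E n →ᵇ ℂ} {L : ℝ}
    (hL : ∀ x y, ‖m x - m y‖ ≤ L * ‖x - y‖) (f : L2 n) :
    S.energy N (mulOp m f) ≤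
      2 * ∑ k ∈ S.idx N, ENNReal.ofReal (S.wt N k) * ‖mulOp m (diff (S.vec k) f)‖ₑ ^ 2 +
      2 * (ENNReal.ofReal (L ^ 2 * S.bd) * ‖f‖ₑ ^ 2) := by
  calc _ ≤ ∑ k ∈ S.idx N, (2 * (ENNReal.ofReal (S.wt N k) * ‖mulOp m (diff (S.vec k) f)‖ₑ ^ 2) +
        2 * (ENNReal.ofReal (L ^ 2 * (S.wt N k * ‖S.vec k‖ ^ 2)) * ‖f‖ₑ ^ 2)) := by
        refine Finset.sum_le_sum fun k _ => ?_
        refine (mul_le_mul_right (enorm_diff_mulOp_sq_le (S.vec k) hL f) _).trans_eq ?_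
        rw [show L ^ 2 * (S.wt N k * ‖S.vec k‖ ^ 2) = S.wt N k * (L ^ 2 * ‖S.vec k‖ ^ 2) by ring,
          ENNReal.ofReal_mul (S.wt_nonneg N k)]
        ring
    _ ≤ _ := by
        rw [Finset.sum_add_distrib, ← Finset.mul_sum, ← Finset.mul_sum, ← Finset.sum_mul,
          ← ENNReal.ofReal_sum_of_nonneg fun k _ => mul_nonneg (sq_nonneg _)
            (mul_nonneg (S.wt_nonneg N k) (sq_nonneg _)), ← Finset.mul_sum]
        gcongr
        exact S.sum_norm_le N

theorem enorm_mulOp_sq_le {m : E n →ᵇ ℂ} {B : ℝ} (hB : ∀ x, ‖m x‖ ≤ B) (f : L2 n) :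
    ‖mulOp m f‖ₑ ^ 2 ≤ ENNReal.ofReal (B ^ 2) * ‖f‖ₑ ^ 2 := by
  rw [enorm_mulOp_sq, enorm_sq_eq_lintegral, ← lintegral_const_mul _ (measurable_enorm_sq _)]
  refine lintegral_mono fun x => ?_
  gcongr
  rw [enorm_sq_eq_ofReal]
  exact ENNReal.ofReal_le_ofReal (pow_le_pow_left₀ (norm_nonneg _) (hB x) 2)

/-- A bounded Lipschitz function is a multiplier of `H^a`, `0 ≤ a ≤ 1`, with norm controlled by its
supremum and its Lipschitz constant. -/
theorem DiffScheme.sobolevENorm_mulOp_sq_le (S : DiffScheme n a) (ha : 0 ≤ a) {m : E n →ᵇ ℂ}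
    {B L : ℝ} (hB : ∀ x, ‖m x‖ ≤ B) (hL : ∀ x y, ‖m x - m y‖ ≤ L * ‖x - y‖) (f : L2 n) :
    sobolevENorm a (mulOp m f) ^ 2 ≤
      ENNReal.ofReal (3 * S.bd ^ 2 * (B ^ 2 + L ^ 2)) * sobolevENorm a f ^ 2 := by
  have hbd := S.one_le_bd
  have hfs : ‖f‖ₑ ^ 2 ≤ sobolevENorm a f ^ 2 := by
    gcongr
    exact enorm_le_sobolevENorm ha f
  have hen : ∀ N, S.energy N (mulOp m f) ≤
      ENNReal.ofReal (2 * S.bd * (B ^ 2 + L ^ 2)) * sobolevENorm a f ^ 2 := by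
    intro N
    calc _ ≤ 2 * (ENNReal.ofReal (B ^ 2) * (ENNReal.ofReal S.bd * sobolevENorm a f ^ 2)) +
          2 * (ENNReal.ofReal (L ^ 2 * S.bd) * sobolevENorm a f ^ 2) := by
          refine (S.energy_mulOp_le N hL f).trans ?_
          gcongr
          refine le_trans ?_ (mul_le_mul_right (S.energy_le N f) _)
          rw [DiffScheme.energy, Finset.mul_sum]
          refine Finset.sum_le_sum fun k _ => ?_
          rw [mul_left_comm]
          gcongr
          exact enorm_mulOp_sq_le hB _
      _ = _ := by
          rw [show 2 * S.bd * (B ^ 2 + L ^ 2) = 2 * (B ^ 2 * S.bd) + 2 * (L ^ 2 * S.bd) by ring,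
            ENNReal.ofReal_add (by positivity) (by positivity), ENNReal.ofReal_mul two_pos.le,
            ENNReal.ofReal_mul two_pos.le, ENNReal.ofReal_mul (sq_nonneg B)]
          simp only [ENNReal.ofReal_ofNat]
          ring
  refine (S.sobolevENorm_sq_le hen).trans ?_
  calc _ ≤ ENNReal.ofReal S.bd * (ENNReal.ofReal (B ^ 2) * sobolevENorm a f ^ 2 +
        ENNReal.ofReal (2 * S.bd * (B ^ 2 + L ^ 2)) * sobolevENorm a f ^ 2) := by
        refine mul_le_mul_right (add_le_add ?_ le_rfl) _
        exact (enorm_mulOp_sq_le hB f).trans (mul_le_mul_right hfs _)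
    _ = ENNReal.ofReal (S.bd * (B ^ 2 + 2 * S.bd * (B ^ 2 + L ^ 2))) * sobolevENorm a f ^ 2 := by
        rw [ENNReal.ofReal_mul S.bd_nonneg, ENNReal.ofReal_add (by positivity) (by positivity)]
        ring
    _ ≤ _ := by
        refine mul_le_mul_left (ENNReal.ofReal_le_ofReal ?_) _
        have h1 : 0 ≤ B ^ 2 := sq_nonneg B
        have h2 : 0 ≤ L ^ 2 := sq_nonneg L
        nlinarith [mul_nonneg (mul_nonneg S.bd_nonneg (sub_nonneg.2 hbd)) h1,
          mul_nonneg (mul_nonneg S.bd_nonneg S.bd_nonneg) h2]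

/-! ### Density of Schwartz functions in `H^a` -/

theorem exists_schwartz_sobolevENorm_sub_le {f : L2 n} (hf : InSobolev a f) {ε : ℝ} (hε : 0 < ε) :
    ∃ g : 𝓢(E n, ℂ), sobolevENorm a (f - g.toLp 2 volume) ≤ ENNReal.ofReal ε := by
  have hw' : (fun x : E n => (((1 + ‖x‖ ^ 2) ^ (-a / 2) : ℝ) : ℂ)).HasTemperateGrowth := by fun_prop
  have hww : ∀ x : E n,
      (((1 + ‖x‖ ^ 2) ^ (a / 2) : ℝ) : ℂ) * (((1 + ‖x‖ ^ 2) ^ (-a / 2) : ℝ) : ℂ) = 1 := by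
    intro x
    rw [← Complex.ofReal_mul, ← Real.rpow_add (by positivity)]
    simp [neg_div]
  have hW : MemLp (fun ξ : E n => ((((1 + ‖ξ‖ ^ 2) ^ (a / 2) : ℝ) : ℂ)) * (𝓕 f : L2 n) ξ) 2 volume :=
    ⟨aestronglyMeasurable_sobolev a f, hf⟩
  obtain ⟨u, ⟨θ, rfl⟩, hu⟩ := Metric.mem_closure_iff.1 ((SchwartzMap.denseRange_toLpCLM (E := E n)
    (F := ℂ) (μ := volume) (p := 2) ENNReal.ofNat_ne_top) (hW.toLp _)) ε hε
  refine ⟨𝓕⁻ (SchwartzMap.smulLeftCLM ℂ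
    (fun x : E n => (((1 + ‖x‖ ^ 2) ^ (-a / 2) : ℝ) : ℂ)) θ), ?_⟩
  have heq : sobolevENorm a (f - (𝓕⁻ (SchwartzMap.smulLeftCLM ℂ
      (fun x : E n => (((1 + ‖x‖ ^ 2) ^ (-a / 2) : ℝ) : ℂ)) θ)).toLp 2 volume) =
      ‖hW.toLp _ - θ.toLp 2 volume‖ₑ := by
    rw [Lp.enorm_def, sobolevENorm, fourier_sub_L2, SchwartzMap.toLp_fourier_eq,
      fourier_fourierInv_eq]
    refine eLpNorm_congr_ae ?_
    filter_upwards [Lp.coeFn_sub (𝓕 f : L2 n) ((SchwartzMap.smulLeftCLM ℂ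
      (fun x : E n => (((1 + ‖x‖ ^ 2) ^ (-a / 2) : ℝ) : ℂ)) θ).toLp 2),
      (SchwartzMap.smulLeftCLM ℂ
      (fun x : E n => (((1 + ‖x‖ ^ 2) ^ (-a / 2) : ℝ) : ℂ)) θ).coeFn_toLp 2 volume,
      Lp.coeFn_sub (hW.toLp _) (θ.toLp 2 volume), hW.coeFn_toLp, θ.coeFn_toLp 2 volume]
      with x h1 h2 h3 h4 h5
    rw [h1, h3, Pi.sub_apply, Pi.sub_apply, h2, h4, h5, SchwartzMap.smulLeftCLM_apply_apply hw',
      smul_eq_mul, mul_sub, ← mul_assoc, hww, one_mul]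
  rw [heq, ← ofReal_norm]
  refine ENNReal.ofReal_le_ofReal ?_
  rw [dist_eq_norm] at hu
  exact hu.le

/-! ### Cut-offs at large radius -/

theorem SmoothCutoff.exists_bounds (F : SmoothCutoff) : ∃ B L : ℝ, 0 ≤ B ∧ 0 ≤ L ∧
    (∀ k, |F.toFun k| ≤ B) ∧ ∀ k l, |F.toFun k - F.toFun l| ≤ L * |k - l| := by
  obtain ⟨B, hB⟩ := F.exists_bound
  have hd : Continuous (deriv F.toFun) := F.smooth.continuous_deriv (by simp)
  obtain ⟨L, hL⟩ := (isCompact_Icc (a := (1 / 2 : ℝ)) (b := 1)).exists_bound_of_continuousOn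
    hd.continuousOn
  have hL0 : 0 ≤ L := (norm_nonneg _).trans (hL 1 ⟨by norm_num, le_rfl⟩)
  have hbound : ∀ k, ‖deriv F.toFun k‖ ≤ L := by
    intro k
    by_cases h1 : 1 < k
    · have : F.toFun =ᶠ[𝓝 k] fun _ => 1 := by
        filter_upwards [lt_mem_nhds h1] with x hx using F.eq_one x hx.le
      rw [this.deriv_eq]
      simpa using hL0
    by_cases h0 : k < 1 / 2
    · have : F.toFun =ᶠ[𝓝 k] fun _ => 0 := by
        filter_upwards [gt_mem_nhds h0] with x hx using F.eq_zero x hx.le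
      rw [this.deriv_eq]
      simpa using hL0
    · exact hL k ⟨by linarith, by linarith⟩
  refine ⟨B, L, (norm_nonneg _).trans (hB 0), hL0, hB, fun k l => ?_⟩
  have := Convex.norm_image_sub_le_of_norm_deriv_le (s := Set.univ) (f := F.toFun) (C := L)
    (fun x _ => (F.smooth.differentiable (by simp)).differentiableAt) (fun x _ => hbound x)
    convex_univ (Set.mem_univ l) (Set.mem_univ k)
  simpa using this

theorem SmoothCutoff.radial_apply (F : SmoothCutoff) (r : ℝ) (x : E n) :
    F.radial n r x = ((F.toFun (‖x‖ / r) : ℝ) : ℂ) := rfl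

theorem SmoothCutoff.radial_lipschitz (F : SmoothCutoff) {L : ℝ} (hL0 : 0 ≤ L)
    (hL : ∀ k l, |F.toFun k - F.toFun l| ≤ L * |k - l|) {r : ℝ} (hr : 0 < r) (x y : E n) :
    ‖F.radial n r x - F.radial n r y‖ ≤ L / r * ‖x - y‖ := by
  rw [F.radial_apply, F.radial_apply, ← Complex.ofReal_sub, Complex.norm_real, Real.norm_eq_abs]
  refine (hL _ _).trans ?_
  rw [← sub_div, abs_div, abs_of_pos hr, div_mul_eq_mul_div, mul_div_assoc]
  gcongr
  exact abs_norm_sub_norm_le x y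

/-- `x ↦ √(1 + |x|²)` is `1`-Lipschitz. -/
theorem abs_sqrt_one_add_sub_le (x y : E n) :
    |√(1 + ‖x‖ ^ 2) - √(1 + ‖y‖ ^ 2)| ≤ ‖x - y‖ := by
  have hx := Real.sq_sqrt (by positivity : (0 : ℝ) ≤ 1 + ‖x‖ ^ 2)
  have hy := Real.sq_sqrt (by positivity : (0 : ℝ) ≤ 1 + ‖y‖ ^ 2)
  have hx0 : ‖x‖ ≤ √(1 + ‖x‖ ^ 2) := Real.le_sqrt_of_sq_le (by linarith)
  have hy0 : ‖y‖ ≤ √(1 + ‖y‖ ^ 2) := Real.le_sqrt_of_sq_le (by linarith)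
  have hpx : 0 < √(1 + ‖x‖ ^ 2) := Real.sqrt_pos.2 (by positivity)
  have hpy : 0 < √(1 + ‖y‖ ^ 2) := Real.sqrt_pos.2 (by positivity)
  have h1 : |√(1 + ‖x‖ ^ 2) - √(1 + ‖y‖ ^ 2)| * (√(1 + ‖x‖ ^ 2) + √(1 + ‖y‖ ^ 2)) =
      |‖x‖ - ‖y‖| * (‖x‖ + ‖y‖) := by
    calc _ = |(√(1 + ‖x‖ ^ 2) - √(1 + ‖y‖ ^ 2)) * (√(1 + ‖x‖ ^ 2) + √(1 + ‖y‖ ^ 2))| := by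
          rw [abs_mul, abs_of_pos (add_pos hpx hpy)]
      _ = |(‖x‖ - ‖y‖) * (‖x‖ + ‖y‖)| := by
          congr 1
          linear_combination hx - hy
      _ = _ := by rw [abs_mul, abs_of_nonneg (add_nonneg (norm_nonneg x) (norm_nonneg y))]
  refine le_trans ?_ (abs_norm_sub_norm_le x y)
  refine le_of_mul_le_mul_right ?_ (add_pos hpx hpy)
  rw [h1]
  exact mul_le_mul_of_nonneg_left (add_le_add hx0 hy0) (abs_nonneg _)

/-- Division by `√(1 + |x|²)` turns the cut-off of `|x| > r` into a multiplier of size `1/r` together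
with its Lipschitz constant. -/
theorem SmoothCutoff.exists_radial_div_sqrt (F : SmoothCutoff) {B L : ℝ} (hB0 : 0 ≤ B)
    (hL0 : 0 ≤ L) (hB : ∀ k, |F.toFun k| ≤ B)
    (hL : ∀ k l, |F.toFun k - F.toFun l| ≤ L * |k - l|) {r : ℝ} (hr : 0 < r) :
    ∃ q : E n →ᵇ ℂ, (∀ x, F.radial n r x = q x * ((√(1 + ‖x‖ ^ 2) : ℝ) : ℂ)) ∧
      (∀ x, ‖q x‖ ≤ 2 * B / r) ∧ ∀ x y, ‖q x - q y‖ ≤ (L + 2 * B) / r * ‖x - y‖ := by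
  have hpos : ∀ x : E n, 0 < √(1 + ‖x‖ ^ 2) := fun x => Real.sqrt_pos.2 (by positivity)
  have hle : ∀ x : E n, ‖x‖ ≤ √(1 + ‖x‖ ^ 2) := fun x => Real.le_sqrt_of_sq_le (by linarith)
  have hone : ∀ x : E n, 1 ≤ √(1 + ‖x‖ ^ 2) := fun x => by
    rw [Real.one_le_sqrt]; nlinarith [sq_nonneg ‖x‖]
  have hdecay : ∀ x : E n, |F.toFun (‖x‖ / r)| * (√(1 + ‖x‖ ^ 2))⁻¹ ≤ 2 * B / r := by
    intro x
    by_cases hx : ‖x‖ / r ≤ 1 / 2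
    · rw [F.eq_zero _ hx, abs_zero, zero_mul]
      positivity
    · rw [not_le, lt_div_iff₀ hr] at hx
      rw [← div_eq_mul_inv, div_le_div_iff₀ (hpos x) hr]
      have := hB (‖x‖ / r)
      have h2 : r ≤ 2 * √(1 + ‖x‖ ^ 2) := by linarith [hle x]
      calc |F.toFun (‖x‖ / r)| * r ≤ B * (2 * √(1 + ‖x‖ ^ 2)) :=
            mul_le_mul this h2 hr.le hB0
        _ = _ := by ring
  have hnorm : ∀ x : E n, ‖((F.toFun (‖x‖ / r) * (√(1 + ‖x‖ ^ 2))⁻¹ : ℝ) : ℂ)‖ ≤ 2 * B / r :=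
    fun x => by
      rw [Complex.norm_real, Real.norm_eq_abs, abs_mul, abs_of_pos (inv_pos.2 (hpos x))]
      exact hdecay x
  have hcont : Continuous fun x : E n => ((F.toFun (‖x‖ / r) * (√(1 + ‖x‖ ^ 2))⁻¹ : ℝ) : ℂ) :=
    Complex.continuous_ofReal.comp ((F.smooth.continuous.comp (continuous_norm.div_const r)).mul
      (Continuous.inv₀ (by fun_prop) fun x => (hpos x).ne'))
  refine ⟨BoundedContinuousFunction.ofNormedAddCommGroup _ hcont _ hnorm, fun x => ?_, hnorm,
    fun x y => ?_⟩
  · have h5 : ((√(1 + ‖x‖ ^ 2) : ℝ) : ℂ) ≠ 0 := Complex.ofReal_ne_zero.2 (hpos x).ne'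
    rw [F.radial_apply, BoundedContinuousFunction.coe_ofNormedAddCommGroup, Complex.ofReal_mul,
      Complex.ofReal_inv, mul_assoc, inv_mul_cancel₀ h5, mul_one]
  · rw [BoundedContinuousFunction.coe_ofNormedAddCommGroup, ← Complex.ofReal_sub, Complex.norm_real,
      Real.norm_eq_abs]
    have e : F.toFun (‖x‖ / r) * (√(1 + ‖x‖ ^ 2))⁻¹ - F.toFun (‖y‖ / r) * (√(1 + ‖y‖ ^ 2))⁻¹ =
        (F.toFun (‖x‖ / r) - F.toFun (‖y‖ / r)) * (√(1 + ‖y‖ ^ 2))⁻¹ +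
        (F.toFun (‖x‖ / r) * (√(1 + ‖x‖ ^ 2))⁻¹) *
          ((√(1 + ‖y‖ ^ 2) - √(1 + ‖x‖ ^ 2)) * (√(1 + ‖y‖ ^ 2))⁻¹) := by
      have h1 := (hpos x).ne'
      have h2 := (hpos y).ne'
      field_simp
      ring
    have hinv : |(√(1 + ‖y‖ ^ 2))⁻¹| ≤ 1 := by
      rw [abs_of_pos (inv_pos.2 (hpos y))]
      exact inv_le_one_of_one_le₀ (hone y)
    have h3 : |F.toFun (‖x‖ / r) - F.toFun (‖y‖ / r)| ≤ L / r * ‖x - y‖ := by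
      have := F.radial_lipschitz hL0 hL hr x y
      rwa [F.radial_apply, F.radial_apply, ← Complex.ofReal_sub, Complex.norm_real,
        Real.norm_eq_abs] at this
    have h4 : |√(1 + ‖y‖ ^ 2) - √(1 + ‖x‖ ^ 2)| ≤ ‖x - y‖ := by
      rw [norm_sub_rev]
      exact abs_sqrt_one_add_sub_le y x
    have h6 : |F.toFun (‖x‖ / r) * (√(1 + ‖x‖ ^ 2))⁻¹| ≤ 2 * B / r := by
      rw [abs_mul, abs_of_pos (inv_pos.2 (hpos x))]
      exact hdecay x
    rw [e]
    refine (abs_add_le _ _).trans ?_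
    rw [abs_mul _ (√(1 + ‖y‖ ^ 2))⁻¹, abs_mul _ ((_ - _) * _), abs_mul _ (√(1 + ‖y‖ ^ 2))⁻¹]
    calc _ ≤ L / r * ‖x - y‖ * 1 + 2 * B / r * (‖x - y‖ * 1) :=
          add_le_add (mul_le_mul h3 hinv (abs_nonneg _) (by positivity))
            (mul_le_mul h6 (mul_le_mul h4 hinv (abs_nonneg _) (norm_nonneg _))
              (by positivity) (by positivity))
      _ = _ := by ring

theorem inSobolev_schwartz (ha : 0 ≤ a) (g : 𝓢(E n, ℂ)) : InSobolev a (g.toLp 2 volume) := by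
  rw [inSobolev_iff_memSobolev ha]
  have := SchwartzMap.memSobolev (s := a) (p := 2) g
  rwa [← Lp.toTemperedDistribution_toLp_eq (p := 2)] at this

/-- The far part of a Schwartz function is small in `H^a`. -/
theorem exists_sobolevENorm_radial_schwartz_le (S : DiffScheme n a) (ha : 0 ≤ a) (F : SmoothCutoff)
    (g : 𝓢(E n, ℂ)) : ∃ K : ℝ≥0∞, K ≠ ⊤ ∧ ∀ r : ℝ, 0 < r →
      sobolevENorm a (mulOp (F.radial n r) (g.toLp 2)) ^ 2 ≤ ENNReal.ofReal ((r⁻¹) ^ 2) * K := by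
  obtain ⟨B, L, hB0, hL0, hB, hL⟩ := F.exists_bounds
  have hw : (fun x : E n => ((√(1 + ‖x‖ ^ 2) : ℝ) : ℂ)).HasTemperateGrowth := by
    simp only [Real.sqrt_eq_rpow]
    fun_prop
  obtain ⟨f, hf⟩ : ∃ f : 𝓢(E n, ℂ), ∀ x, f x = ((√(1 + ‖x‖ ^ 2) : ℝ) : ℂ) * g x :=
    ⟨SchwartzMap.smulLeftCLM ℂ (fun x : E n => ((√(1 + ‖x‖ ^ 2) : ℝ) : ℂ)) g, fun x => by
      rw [SchwartzMap.smulLeftCLM_apply_apply hw, smul_eq_mul]⟩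
  refine ⟨ENNReal.ofReal (3 * S.bd ^ 2 * ((2 * B) ^ 2 + (L + 2 * B) ^ 2)) *
    sobolevENorm a (f.toLp 2 volume) ^ 2, ENNReal.mul_ne_top ENNReal.ofReal_ne_top
    (ENNReal.pow_ne_top (inSobolev_schwartz ha f).ne), fun r hr => ?_⟩
  obtain ⟨q, hq, hqB, hqL⟩ := F.exists_radial_div_sqrt (n := n) hB0 hL0 hB hL hr
  have heq : mulOp (F.radial n r) (g.toLp 2) = mulOp q (f.toLp 2) := by
    apply Lp.ext
    filter_upwards [mulOp_coeFn (F.radial n r) (g.toLp 2), mulOp_coeFn q (f.toLp 2),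
      g.coeFn_toLp 2 volume, f.coeFn_toLp 2 volume] with x h1 h2 h3 h4
    rw [h1, h2, h3, h4, hf, hq, mul_assoc]
  rw [heq]
  refine (S.sobolevENorm_mulOp_sq_le ha hqB hqL _).trans_eq ?_
  rw [← mul_assoc, ← ENNReal.ofReal_mul (sq_nonneg _)]
  congr 2
  rw [div_pow, div_pow, inv_pow]
  field_simp

/-- `F̄(|x|/r)` is, uniformly for `r ≥ r₀`, a bounded multiplier of `H^a`. -/
theorem exists_sobolevENorm_radial_le (S : DiffScheme n a) (ha : 0 ≤ a) (F : SmoothCutoff) {r₀ : ℝ}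
    (hr₀ : 0 < r₀) : ∃ C : ℝ≥0, ∀ r : ℝ, r₀ ≤ r → ∀ f : L2 n,
      sobolevENorm a (mulOp (F.radial n r) f) ≤ C * sobolevENorm a f := by
  obtain ⟨B, L, hB0, hL0, hB, hL⟩ := F.exists_bounds
  refine ⟨(√(3 * S.bd ^ 2 * (B ^ 2 + (L / r₀) ^ 2))).toNNReal, fun r hr f => ?_⟩
  rw [← ENNReal.pow_le_pow_left_iff two_ne_zero, mul_pow]
  have h := S.sobolevENorm_mulOp_sq_le ha (m := F.radial n r) (B := B) (L := L / r₀)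
    (fun x => by rw [F.radial_apply, Complex.norm_real]; exact hB _)
    (fun x y => (F.radial_lipschitz hL0 hL (hr₀.trans_le hr) x y).trans (by gcongr)) f
  refine h.trans_eq ?_
  congr 1
  rw [ENNReal.ofNNReal_toNNReal, ← ENNReal.ofReal_pow (Real.sqrt_nonneg _),
    Real.sq_sqrt (by positivity)]

theorem tendsto_radial (S : DiffScheme n a) (ha : 0 ≤ a) (F : SmoothCutoff) {f : L2 n}
    (hf : InSobolev a f) :
    Tendsto (fun r : ℝ => sobolevENorm a (mulOp (F.radial n r) f)) atTop (𝓝 0) := by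
  obtain ⟨C, hC⟩ := exists_sobolevENorm_radial_le (n := n) S ha F one_pos
  rw [ENNReal.tendsto_nhds_zero]
  intro ε hε
  -- split `f` into a Schwartz function and a remainder that is small in `H^a`
  obtain ⟨δ, hδ, hδε⟩ : ∃ δ : ℝ, 0 < δ ∧ C * ENNReal.ofReal δ ≤ ε / 2 := by
    obtain ⟨δ, hδ, h⟩ := ENNReal.exists_nnreal_pos_mul_lt (a := (C : ℝ≥0∞)) (b := ε / 2)
      ENNReal.coe_ne_top (ENNReal.half_pos hε.ne').ne'
    refine ⟨δ, hδ, ?_⟩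
    rw [ENNReal.ofReal_coe_nnreal, mul_comm]
    exact h.le
  obtain ⟨g, hg⟩ := exists_schwartz_sobolevENorm_sub_le hf hδ
  obtain ⟨K, hK, hKr⟩ := exists_sobolevENorm_radial_schwartz_le S ha F g
  have hlim : Tendsto (fun r : ℝ => ENNReal.ofReal ((r⁻¹) ^ 2) * K) atTop (𝓝 0) := by
    have h1 : Tendsto (fun r : ℝ => (r⁻¹) ^ 2) atTop (𝓝 0) := by
      have h0 : Tendsto (fun r : ℝ => r⁻¹) atTop (𝓝 0) := tendsto_inv_atTop_zero
      simpa using h0.pow 2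
    have h2 := ENNReal.Tendsto.mul_const (ENNReal.tendsto_ofReal h1) (b := K) (Or.inr hK)
    simpa using h2
  have hpos : 0 < (ε / 2) ^ 2 := ENNReal.pow_pos (ENNReal.half_pos hε.ne') 2
  filter_upwards [eventually_ge_atTop 1, (ENNReal.tendsto_nhds_zero.1 hlim) _ hpos] with r hr1 hr2
  have hg2 : sobolevENorm a (mulOp (F.radial n r) (g.toLp 2)) ≤ ε / 2 :=
    (ENNReal.pow_le_pow_left_iff two_ne_zero).1 ((hKr r (by linarith)).trans hr2)
  have hg1 : sobolevENorm a (mulOp (F.radial n r) (f - g.toLp 2 volume)) ≤ ε / 2 :=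
    ((hC r hr1 _).trans (mul_le_mul_right hg _)).trans hδε
  have hsplit := sobolevENorm_add_le a (mulOp (F.radial n r) (f - g.toLp 2 volume))
    (mulOp (F.radial n r) (g.toLp 2 volume))
  rw [← mulOp_add, sub_add_cancel] at hsplit
  exact (hsplit.trans (add_le_add hg1 hg2)).trans_eq (ENNReal.add_halves ε)

/-! ### Pointwise bounds by duality -/

/-- An `L²` function whose pairings with Schwartz functions are bounded by `M` times the `L¹` norm
is bounded by `M` almost everywhere. -/
theorem ae_enorm_le_of_forall_integral_le {u : L2 n} {M : ℝ≥0∞}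
    (h : ∀ η : 𝓢(E n, ℂ), ‖∫ x, η x * u x‖ₑ ≤ M * ENNReal.ofReal (∫ x, ‖η x‖)) :
    ∀ᵐ x, ‖u x‖ₑ ≤ M := by
  -- test against bump functions of integral one that concentrate at a Lebesgue point
  let b : ℕ → ContDiffBump (0 : E n) := fun k =>
    ⟨1 / ((k : ℝ) + 1), 2 / ((k : ℝ) + 1), by positivity, by gcongr; norm_num⟩
  have hb0 : Tendsto (fun k => (b k).rOut) atTop (𝓝 0) := by
    have h1 := (tendsto_one_div_add_atTop_nhds_zero_nat (𝕜 := ℝ)).const_mul 2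
    rw [mul_zero] at h1
    refine h1.congr fun k => ?_
    change 2 * (1 / ((k : ℝ) + 1)) = 2 / ((k : ℝ) + 1)
    ring
  have hloc : LocallyIntegrable (u : E n → ℂ) volume :=
    (Lp.memLp u).locallyIntegrable (by norm_num)
  have hae := ContDiffBump.ae_convolution_tendsto_right_of_locallyIntegrable
    (μ := (volume : Measure (E n))) (K := 2) hb0 (Eventually.of_forall fun k => by
      change 2 / ((k : ℝ) + 1) ≤ 2 * (1 / ((k : ℝ) + 1))
      rw [mul_one_div]) hloc
  filter_upwards [hae] with x hx
  refine le_of_tendsto hx.enorm (Eventually.of_forall fun k => ?_)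
  rw [convolution_lsmul_swap]
  have hsmooth : ContDiff ℝ ∞ fun t : E n => (((b k).normed volume (x - t) : ℝ) : ℂ) :=
    Complex.ofRealCLM.contDiff.comp ((b k).contDiff_normed.comp (contDiff_const.sub contDiff_id))
  have hcs : HasCompactSupport fun t : E n => (((b k).normed volume (x - t) : ℝ) : ℂ) := by
    have h1 : HasCompactSupport fun t : E n => (b k).normed volume (x - t) :=
      (b k).hasCompactSupport_normed.comp_homeomorph (Homeomorph.subLeft x)
    exact h1.comp_left (g := fun r : ℝ => (r : ℂ)) Complex.ofReal_zero
  have := h (hcs.toSchwartzMap hsmooth)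
  change ‖∫ t, (((b k).normed volume (x - t) : ℝ) : ℂ) * u t‖ₑ ≤
    M * ENNReal.ofReal (∫ t, ‖(((b k).normed volume (x - t) : ℝ) : ℂ)‖) at this
  refine le_trans (le_of_eq ?_) (this.trans_eq ?_)
  · congr 1
  · have h2 : ∫ t : E n, ‖(((b k).normed volume (x - t) : ℝ) : ℂ)‖ = 1 := by
      rw [← (b k).integral_normed (μ := (volume : Measure (E n))),
        ← integral_sub_left_eq_self ((b k).normed volume) volume x]
      refine integral_congr_ae (Eventually.of_forall fun t => ?_)
      simp only
      rw [Complex.norm_real, Real.norm_of_nonneg ((b k).nonneg_normed _)]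
    rw [h2, ENNReal.ofReal_one, mul_one]

/-! ### Differences in the dispersive estimate -/

theorem evol_compSubConstCLM (t : ℝ) (η : 𝓢(E n, ℂ)) (h : E n) :
    evol t (η.compSubConstCLM ℂ h) = (evol t η).compSubConstCLM ℂ h := by
  have hinj : Function.Injective (fun u : 𝓢(E n, ℂ) => 𝓕 u) := fun u w h => by
    have := congrArg (fun z : 𝓢(E n, ℂ) => 𝓕⁻ z) h
    simpa using this
  apply hinj
  ext ξ
  have h1 := fourier_compSubConstCLM η (-h) ξ
  have h2 := fourier_compSubConstCLM (evol t η) (-h) ξ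
  rw [neg_neg] at h1 h2
  simp only
  rw [h2, fourier_evol, fourier_evol, h1]
  ring

theorem integral_mul_diff (η : 𝓢(E n, ℂ)) (h : E n) (f : L2 n) :
    ∫ x, η x * diff h f x = ∫ x, (η.compSubConstCLM ℂ h - η) x * f x := by
  have h1 : ∫ x, η.compSubConstCLM ℂ h x * f x = ∫ x, η x * shift h f x := by
    rw [← integral_add_right_eq_self _ h]
    refine integral_congr_ae ?_
    filter_upwards [shift_coeFn h f] with x hx
    rw [hx, SchwartzMap.compSubConstCLM_apply, add_sub_cancel_right]
  have h2 : ∫ x, (η.compSubConstCLM ℂ h - η) x * f x =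
      (∫ x, η.compSubConstCLM ℂ h x * f x) - ∫ x, η x * f x := by
    rw [← integral_sub (integrable_schwartz_mul _ _) (integrable_schwartz_mul _ _)]
    refine integral_congr_ae (Eventually.of_forall fun x => ?_)
    simp only [sub_apply]
    ring
  rw [h2, h1, ← integral_sub (integrable_schwartz_mul _ _) (integrable_schwartz_mul _ _)]
  refine integral_congr_ae ?_
  filter_upwards [Lp.coeFn_sub (shift h f) f] with x hx
  rw [diff, hx, Pi.sub_apply]
  ring

/-- The Leibniz rule for differences of a product, tested against a Schwartz function. -/
theorem integral_compSubConst_sub_mul (η : 𝓢(E n, ℂ)) (h : E n) (f g : L2 n) :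
    ∫ x, (η.compSubConstCLM ℂ h - η) x * (f x * g x) =
      (∫ x, η x * (diff h f x * shift h g x)) + ∫ x, η x * (f x * diff h g x) := by
  have h1 : ∫ x, η.compSubConstCLM ℂ h x * (f x * g x) =
      ∫ x, η x * (shift h f x * shift h g x) := by
    rw [← integral_add_right_eq_self _ h]
    refine integral_congr_ae ?_
    filter_upwards [shift_coeFn h f, shift_coeFn h g] with x hx hx'
    rw [hx, hx', SchwartzMap.compSubConstCLM_apply, add_sub_cancel_right]
  have h2 : ∫ x, (η.compSubConstCLM ℂ h - η) x * (f x * g x) =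
      (∫ x, η.compSubConstCLM ℂ h x * (f x * g x)) - ∫ x, η x * (f x * g x) := by
    rw [← integral_sub (integrable_schwartz_mul_mul _ _ _) (integrable_schwartz_mul_mul _ _ _)]
    refine integral_congr_ae (Eventually.of_forall fun x => ?_)
    simp only [sub_apply]
    ring
  rw [h2, h1, ← integral_sub (integrable_schwartz_mul_mul _ _ _)
    (integrable_schwartz_mul_mul _ _ _), ← integral_add (integrable_schwartz_mul_mul _ _ _)
    (integrable_schwartz_mul_mul _ _ _)]
  refine integral_congr_ae ?_
  filter_upwards [Lp.coeFn_sub (shift h f) f, Lp.coeFn_sub (shift h g) g] with x hx hx'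
  rw [diff, diff, hx, hx', Pi.sub_apply, Pi.sub_apply]
  ring

/-- The decay rate `(4πr)^{-n/2}` of the free evolution from `L¹` to `L^∞`. -/
def decay (n : ℕ) (r : ℝ) : ℝ≥0∞ := ENNReal.ofReal ((4 * Real.pi * r) ^ (-(n / 2 : ℝ)))

theorem measurable_decay (n : ℕ) : Measurable (decay n) := by
  unfold decay
  fun_prop

theorem enorm_integral_evol_mul_mul_le {r : ℝ} (hr : 0 < r) (η : 𝓢(E n, ℂ)) (f g : L2 n) :
    ‖∫ x, evol r η x * (f x * g x)‖ₑ ≤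
      decay n r * (‖f‖ₑ * ‖g‖ₑ) * ENNReal.ofReal (∫ x, ‖η x‖) := by
  have h := norm_integral_mul_mul_le (norm_evol_le hr η) f g
  rw [← ofReal_norm, ← ofReal_norm f, ← ofReal_norm g, decay, ← ENNReal.ofReal_mul (norm_nonneg _),
    ← ENNReal.ofReal_mul (by positivity), ← ENNReal.ofReal_mul (by positivity)]
  refine ENNReal.ofReal_le_ofReal (h.trans_eq ?_)
  ring

/-! ### The flow in the interaction picture -/

/-- The interaction picture `e^{itH₀}ψ(t)`. -/
def inter (ψ : ℝ → L2 n) (t : ℝ) : L2 n := freeGroup (-t) (ψ t)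

/-- `ψ` is a global solution, and the constant `K` bounds both the potential (for almost every time)
and the solution (for every time) in `H^a`. -/
structure BoundedSolution (a : ℝ) (K : ℝ≥0) (V ψ : ℝ → L2 n) : Prop where
  measurable_potential : AEStronglyMeasurable V volume
  potential_le : ∀ᵐ t : ℝ, sobolevENorm a (V t) ≤ K
  solution : IsGlobalSolution V ψ
  solution_le : ∀ t : ℝ, sobolevENorm a (ψ t) ≤ K

/-- The rate at which the `h`-difference of `e^{itH₀}ψ(t)` is driven by the interaction. -/
def driveRate (K : ℝ≥0) (V ψ : ℝ → L2 n) (h : E n) (r : ℝ) : ℝ≥0∞ :=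
  K * (‖diff h (V r)‖ₑ + ‖diff h (ψ r)‖ₑ)

section Interaction

variable {K : ℝ≥0} {V ψ : ℝ → L2 n}

theorem BoundedSolution.ae_enorm_potential_le (hs : BoundedSolution a K V ψ) (ha : 0 ≤ a) :
    ∀ᵐ t : ℝ, ‖V t‖ₑ ≤ K := by
  filter_upwards [hs.potential_le] with t ht using (enorm_le_sobolevENorm ha _).trans ht

theorem BoundedSolution.enorm_solution_le (hs : BoundedSolution a K V ψ) (ha : 0 ≤ a) (t : ℝ) :
    ‖ψ t‖ₑ ≤ K := (enorm_le_sobolevENorm ha _).trans (hs.solution_le t)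

theorem enorm_inter (ψ : ℝ → L2 n) (t : ℝ) : ‖inter ψ t‖ₑ = ‖ψ t‖ₑ := by
  rw [inter, ← enorm_fourier, fourier_freeGroup, ← enorm_fourier (ψ t)]
  have : ‖mulOp (freeSymbol n (-t)) (𝓕 (ψ t) : L2 n)‖ₑ ^ 2 = ‖(𝓕 (ψ t) : L2 n)‖ₑ ^ 2 := by
    rw [enorm_mulOp_sq, enorm_sq_eq_lintegral]
    refine lintegral_congr fun x => ?_
    rw [← ofReal_norm (freeSymbol n (-t) x), norm_freeSymbol]
    simp
  exact le_antisymm ((ENNReal.pow_le_pow_left_iff two_ne_zero).1 this.le)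
    ((ENNReal.pow_le_pow_left_iff two_ne_zero).1 this.ge)

/-- The Duhamel formula bounds the increments of the interaction picture. -/
theorem BoundedSolution.enorm_integral_inter_sub_le (hs : BoundedSolution a K V ψ) (ha : 0 ≤ a)
    (η : 𝓢(E n, ℂ)) {g : ℝ → ℝ≥0∞}
    (hg : ∀ᵐ r : ℝ, 0 < r → ‖∫ x, evol r η x * (V r x * ψ r x)‖ₑ ≤ g r) {s t : ℝ} (h0 : 0 < s)
    (hst : s ≤ t) :
    ‖∫ x, η x * (inter ψ t - inter ψ s) x‖ₑ ≤ ∫⁻ r in Set.Ioi s, g r := by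
  have hV : ∀ᵐ r, ‖V r‖ ≤ K := by
    filter_upwards [hs.ae_enorm_potential_le ha] with r hr
    exact_mod_cast enorm_le_coe.1 hr
  have hψ : ∀ r, ‖ψ r‖ ≤ K := fun r => by exact_mod_cast enorm_le_coe.1 (hs.enorm_solution_le ha r)
  have h1 : ∫ x, η x * (inter ψ t - inter ψ s) x =
      (∫ x, η x * inter ψ t x) - ∫ x, η x * inter ψ s x := by
    rw [← integral_sub (integrable_schwartz_mul _ _) (integrable_schwartz_mul _ _)]
    refine integral_congr_ae ?_
    filter_upwards [Lp.coeFn_sub (inter ψ t) (inter ψ s)] with x hx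
    rw [hx, Pi.sub_apply]
    ring
  rw [h1, inter, inter, integral_mul_freeGroup, integral_mul_freeGroup,
    duhamel hs.measurable_potential hV hs.solution hψ, enorm_mul, enorm_neg,
    ← ofReal_norm Complex.I, Complex.norm_I, ENNReal.ofReal_one, one_mul,
    intervalIntegral.integral_of_le hst]
  refine (enorm_integral_le_lintegral_enorm _).trans ?_
  refine (lintegral_mono_set (Set.Ioc_subset_Ioi_self)).trans ?_
  refine lintegral_mono_ae ?_
  rw [ae_restrict_iff' measurableSet_Ioi]
  filter_upwards [hg] with r hr hrs using hr (h0.trans hrs)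

theorem BoundedSolution.ae_inter_sub_le (hs : BoundedSolution a K V ψ) (ha : 0 ≤ a) {s t : ℝ}
    (h0 : 0 < s) (hst : s ≤ t) :
    ∀ᵐ x, ‖(inter ψ t - inter ψ s) x‖ₑ ≤ ∫⁻ r in Set.Ioi s, decay n r * (K * K) := by
  refine ae_enorm_le_of_forall_integral_le fun η => ?_
  rw [← lintegral_mul_const' _ _ ENNReal.ofReal_ne_top]
  refine hs.enorm_integral_inter_sub_le ha η ?_ h0 hst
  filter_upwards [hs.ae_enorm_potential_le ha] with r hr hr0
  refine (enorm_integral_evol_mul_mul_le hr0 η _ _).trans ?_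
  gcongr
  exact hs.enorm_solution_le ha r

theorem BoundedSolution.ae_diff_inter_sub_le (hs : BoundedSolution a K V ψ) (ha : 0 ≤ a) (h : E n)
    {s t : ℝ} (h0 : 0 < s) (hst : s ≤ t) :
    ∀ᵐ x, ‖diff h (inter ψ t - inter ψ s) x‖ₑ ≤
      ∫⁻ r in Set.Ioi s, decay n r * driveRate K V ψ h r := by
  refine ae_enorm_le_of_forall_integral_le fun η => ?_
  rw [integral_mul_diff, ← lintegral_mul_const' _ _ ENNReal.ofReal_ne_top]
  refine hs.enorm_integral_inter_sub_le ha _ ?_ h0 hst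
  filter_upwards [hs.ae_enorm_potential_le ha] with r hr hr0
  have hev : evol r (η.compSubConstCLM ℂ h - η) = (evol r η).compSubConstCLM ℂ h - evol r η := by
    rw [← evol_compSubConstCLM]
    exact map_sub (SchwartzMap.fourierMultiplierCLM ℂ (freeSymbol n (-r))) _ _
  rw [hev, integral_compSubConst_sub_mul]
  refine (enorm_add_le _ _).trans ((add_le_add (enorm_integral_evol_mul_mul_le hr0 η _ _)
    (enorm_integral_evol_mul_mul_le hr0 η _ _)).trans ?_)
  have hshift : ‖shift h (ψ r)‖ₑ = ‖ψ r‖ₑ := by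
    rw [← ofReal_norm, ← ofReal_norm, (shift h).norm_map]
  rw [← add_mul, ← mul_add, hshift, driveRate, mul_add (K : ℝ≥0∞)]
  have hK := hs.enorm_solution_le ha r
  have h1 : ‖diff h (V r)‖ₑ * ‖ψ r‖ₑ ≤ K * ‖diff h (V r)‖ₑ := by
    rw [mul_comm]
    gcongr
  gcongr

end Interaction

/-! ### The wave operator as a pointwise limit -/

/-- In dimension at least three the decay rate is integrable at infinity. -/
theorem exists_lintegral_decay_le (hn : 3 ≤ n) : ∃ c : ℝ≥0, ∀ s : ℝ, 0 < s →
    ∫⁻ r in Set.Ioi s, decay n r ≤ c * ENNReal.ofReal (s ^ (1 - n / 2 : ℝ)) := by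
  have hn' : (3 : ℝ) ≤ n := by exact_mod_cast hn
  have he : -(n / 2 : ℝ) < -1 := by linarith
  refine ⟨((4 * Real.pi) ^ (-(n / 2 : ℝ)) * (n / 2 - 1 : ℝ)⁻¹).toNNReal, fun s hs => ?_⟩
  have h1 : ∫⁻ r in Set.Ioi s, decay n r =
      ∫⁻ r in Set.Ioi s, ENNReal.ofReal ((4 * Real.pi) ^ (-(n / 2 : ℝ)) * r ^ (-(n / 2 : ℝ))) := by
    refine setLIntegral_congr_fun measurableSet_Ioi fun r hr => ?_
    have hr' : 0 < r := hs.trans hr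
    simp only [decay]
    rw [Real.mul_rpow (by positivity) hr'.le]
  rw [h1, ← ofReal_integral_eq_lintegral_ofReal
    ((integrableOn_Ioi_rpow_of_lt he hs).const_mul _)
    ((ae_restrict_iff' measurableSet_Ioi).2 (Eventually.of_forall fun r hr => by
      have hr' : 0 < r := hs.trans hr
      positivity)), integral_const_mul, integral_Ioi_rpow_of_lt he hs, ENNReal.ofNNReal_toNNReal,
    ← ENNReal.ofReal_mul (by
      have : 0 < (n / 2 - 1 : ℝ) := by linarith
      positivity)]
  refine ENNReal.ofReal_le_ofReal (le_of_eq ?_)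
  rw [show -(n / 2 : ℝ) + 1 = -(n / 2 - 1) by ring, show (1 - n / 2 : ℝ) = -(n / 2 - 1) by ring,
    neg_div_neg_eq]
  ring

theorem tendsto_lintegral_decay (hn : 3 ≤ n) :
    Tendsto (fun s : ℝ => ∫⁻ r in Set.Ioi s, decay n r) atTop (𝓝 0) := by
  have hn' : (3 : ℝ) ≤ n := by exact_mod_cast hn
  obtain ⟨c, hc⟩ := exists_lintegral_decay_le hn
  have h1 : Tendsto (fun s : ℝ => (c : ℝ≥0∞) * ENNReal.ofReal (s ^ (1 - n / 2 : ℝ))) atTop (𝓝 0) := by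
    have h2 : Tendsto (fun s : ℝ => s ^ (1 - n / 2 : ℝ)) atTop (𝓝 0) := by
      rw [show (1 - n / 2 : ℝ) = -(n / 2 - 1) by ring]
      exact tendsto_rpow_neg_atTop (by linarith)
    have h3 := ENNReal.Tendsto.const_mul (ENNReal.tendsto_ofReal h2)
      (Or.inr (ENNReal.coe_ne_top (r := c)))
    simpa using h3
  exact tendsto_of_tendsto_of_tendsto_of_le_of_le' tendsto_const_nhds h1
    (Eventually.of_forall fun _ => zero_le) ((eventually_gt_atTop 0).mono hc)

theorem ae_tendsto_diff (h : E n) {u : ℕ → L2 n} {w : L2 n}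
    (hu : ∀ᵐ x, Tendsto (fun k => u k x) atTop (𝓝 (w x))) :
    ∀ᵐ x, Tendsto (fun k => diff h (u k) x) atTop (𝓝 (diff h w x)) := by
  have hq := (measurePreserving_add_right (volume : Measure (E n)) h).quasiMeasurePreserving
  filter_upwards [hu, hq.ae hu, diff_coeFn h w, ae_all_iff.2 fun k => diff_coeFn h (u k)]
    with x h1 h2 h3 h4
  simp only [h3, h4]
  exact h2.sub h1

/-- Difference energies are lower semicontinuous along almost everywhere convergence. -/
theorem DiffScheme.energy_le_of_ae_tendsto (S : DiffScheme n a) (N : ℕ) {u : ℕ → L2 n} {w : L2 n}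
    (hu : ∀ᵐ x, Tendsto (fun k => u k x) atTop (𝓝 (w x))) {Q : ℝ≥0∞}
    (hQ : ∀ k, S.energy N (u k) ≤ Q) : S.energy N w ≤ Q := by
  have hmeas : ∀ (f : L2 n) k, Measurable fun x =>
      ENNReal.ofReal (S.wt N k) * ‖diff (S.vec k) f x‖ₑ ^ 2 := fun f k =>
    (measurable_enorm_sq _).const_mul _
  have heq : ∀ f : L2 n, S.energy N f =
      ∫⁻ x, ∑ k ∈ S.idx N, ENNReal.ofReal (S.wt N k) * ‖diff (S.vec k) f x‖ₑ ^ 2 := by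
    intro f
    rw [lintegral_finsetSum _ fun k _ => hmeas f k]
    refine Finset.sum_congr rfl fun k _ => ?_
    rw [lintegral_const_mul _ (measurable_enorm_sq _), enorm_sq_eq_lintegral]
  rw [heq]
  calc _ ≤ ∫⁻ x, liminf (fun j => ∑ k ∈ S.idx N,
        ENNReal.ofReal (S.wt N k) * ‖diff (S.vec k) (u j) x‖ₑ ^ 2) atTop := by
        refine lintegral_mono_ae ?_
        filter_upwards [ae_all_iff.2 fun k => ae_tendsto_diff (S.vec k) hu] with x hx
        refine le_of_eq (Tendsto.liminf_eq ?_).symm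
        refine tendsto_finsetSum _ fun k _ => ?_
        exact ENNReal.Tendsto.const_mul (((ENNReal.continuous_pow 2).tendsto _).comp (hx k).enorm)
          (Or.inr ENNReal.ofReal_ne_top)
    _ ≤ liminf (fun j => ∫⁻ x, ∑ k ∈ S.idx N,
        ENNReal.ofReal (S.wt N k) * ‖diff (S.vec k) (u j) x‖ₑ ^ 2) atTop :=
        lintegral_liminf_le fun j => Finset.measurable_fun_sum _ fun k _ => hmeas (u j) k
    _ ≤ Q := by
        refine liminf_le_of_le (by isBoundedDefault) fun b hb => ?_
        obtain ⟨j, hj⟩ := hb.exists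
        exact hj.trans ((heq (u j)).symm.trans_le (hQ j))

theorem sobolevENorm_inter (ψ : ℝ → L2 n) (t : ℝ) :
    sobolevENorm a (inter ψ t) = sobolevENorm a (ψ t) := sobolevENorm_freeGroup _ _ _

section Limit

variable {K : ℝ≥0} {V ψ : ℝ → L2 n}

/-- The interaction picture converges almost everywhere along integer times: its increments are
bounded pointwise by the tails of the integrable decay rate. -/
theorem BoundedSolution.exists_limit (hs : BoundedSolution a K V ψ) (ha : 0 ≤ a) (hn : 3 ≤ n) :
    ∃ Ω : L2 n, (∀ᵐ x, Tendsto (fun k : ℕ => inter ψ k x) atTop (𝓝 (Ω x))) ∧ ‖Ω‖ₑ ≤ K := by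
  have hcauchy : ∀ᵐ x, ∃ l, Tendsto (fun k : ℕ => inter ψ k x) atTop (𝓝 l) := by
    have h1 : ∀ᵐ x, ∀ k l : ℕ, 0 < k → k ≤ l → ‖inter ψ l x - inter ψ k x‖ₑ ≤
        (∫⁻ r in Set.Ioi (k : ℝ), decay n r) * (K * K) := by
      refine ae_all_iff.2 fun k => ae_all_iff.2 fun l => ?_
      by_cases hk : 0 < k
      · by_cases hkl : k ≤ l
        · filter_upwards [hs.ae_inter_sub_le ha (s := k) (t := l) (by exact_mod_cast hk)
            (by exact_mod_cast hkl), Lp.coeFn_sub (inter ψ l) (inter ψ k)] with x hx hx'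
          intro _ _
          rw [hx', Pi.sub_apply, lintegral_mul_const _ (measurable_decay n)] at hx
          exact hx
        · exact Eventually.of_forall fun _ _ h => absurd h hkl
      · exact Eventually.of_forall fun _ h => absurd h hk
    have h2 : Tendsto (fun k : ℕ => (∫⁻ r in Set.Ioi (k : ℝ), decay n r) * ((K : ℝ≥0∞) * K)) atTop
        (𝓝 0) := by
      have := ENNReal.Tendsto.mul_const (b := (K : ℝ≥0∞) * K)
        ((tendsto_lintegral_decay hn).comp tendsto_natCast_atTop_atTop)
        (Or.inr (by finiteness))
      simpa using this
    filter_upwards [h1] with x hx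
    refine cauchySeq_tendsto_of_complete (EMetric.cauchySeq_iff'.2 fun ε hε => ?_)
    obtain ⟨k, hk, hk0⟩ := ((h2.eventually (gt_mem_nhds hε)).and (eventually_gt_atTop 0)).exists
    refine ⟨k, fun l hl => ?_⟩
    rw [edist_eq_enorm_sub]
    exact (hx k l hk0 hl).trans_lt hk
  obtain ⟨w, hw, hlim⟩ := exists_stronglyMeasurable_limit_of_tendsto_ae
    (fun k : ℕ => Lp.aestronglyMeasurable (inter ψ k)) hcauchy
  have hnorm : eLpNorm w 2 volume ≤ K := by
    refine (Lp.eLpNorm_lim_le_liminf_eLpNorm (fun k : ℕ => Lp.aestronglyMeasurable (inter ψ k)) w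
      hlim).trans ?_
    refine liminf_le_of_le (by isBoundedDefault) fun b hb => ?_
    obtain ⟨k, hk⟩ := hb.exists
    refine hk.trans ?_
    rw [← Lp.enorm_def, enorm_inter]
    exact hs.enorm_solution_le ha k
  have hmem : MemLp w 2 volume := ⟨hw.aestronglyMeasurable, hnorm.trans_lt ENNReal.coe_lt_top⟩
  refine ⟨hmem.toLp w, ?_, ?_⟩
  · filter_upwards [hlim, hmem.coeFn_toLp] with x h1 h2
    rwa [h2]
  · rw [Lp.enorm_def, eLpNorm_congr_ae hmem.coeFn_toLp]
    exact hnorm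

variable {Ω : L2 n}

theorem BoundedSolution.inSobolev_limit (hs : BoundedSolution a K V ψ) (S : DiffScheme n a)
    (hΩ : ∀ᵐ x, Tendsto (fun k : ℕ => inter ψ k x) atTop (𝓝 (Ω x))) : InSobolev a Ω := by
  have h := S.sobolevENorm_sq_le (f := Ω) (Q := ENNReal.ofReal S.bd * (K : ℝ≥0∞) ^ 2) fun N => by
    refine S.energy_le_of_ae_tendsto N hΩ fun k => (S.energy_le N _).trans ?_
    gcongr
    rw [sobolevENorm_inter]
    exact hs.solution_le k
  have h2 : sobolevENorm a Ω ^ 2 < ⊤ := h.trans_lt (by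
    have : ‖Ω‖ₑ ≠ ⊤ := enorm_ne_top
    finiteness)
  exact (ENNReal.pow_lt_top_iff.1 h2).resolve_right two_ne_zero

theorem BoundedSolution.ae_inter_sub_limit_le (hs : BoundedSolution a K V ψ) (ha : 0 ≤ a)
    (hΩ : ∀ᵐ x, Tendsto (fun k : ℕ => inter ψ k x) atTop (𝓝 (Ω x))) {t : ℝ} (ht : 0 < t) :
    ∀ᵐ x, ‖(inter ψ t - Ω) x‖ₑ ≤ ∫⁻ r in Set.Ioi t, decay n r * (K * K) := by
  have h1 : ∀ᵐ x, ∀ k : ℕ, t ≤ k → ‖inter ψ k x - inter ψ t x‖ₑ ≤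
      ∫⁻ r in Set.Ioi t, decay n r * (K * K) := by
    refine ae_all_iff.2 fun k => ?_
    by_cases hk : t ≤ k
    · filter_upwards [hs.ae_inter_sub_le ha ht hk, Lp.coeFn_sub (inter ψ k) (inter ψ t)]
        with x hx hx' _
      rwa [hx', Pi.sub_apply] at hx
    · exact Eventually.of_forall fun _ h => absurd h hk
  filter_upwards [h1, hΩ, Lp.coeFn_sub (inter ψ t) Ω] with x h2 h3 h4
  rw [h4, Pi.sub_apply, ← enorm_neg, neg_sub]
  refine le_of_tendsto (h3.sub_const _).enorm ?_
  filter_upwards [tendsto_natCast_atTop_atTop.eventually_ge_atTop t] with k hk using h2 k hk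

theorem BoundedSolution.ae_diff_inter_sub_limit_le (hs : BoundedSolution a K V ψ) (ha : 0 ≤ a)
    (hΩ : ∀ᵐ x, Tendsto (fun k : ℕ => inter ψ k x) atTop (𝓝 (Ω x))) (h : E n) {t : ℝ}
    (ht : 0 < t) :
    ∀ᵐ x, ‖diff h (inter ψ t - Ω) x‖ₑ ≤
      ∫⁻ r in Set.Ioi t, decay n r * driveRate K V ψ h r := by
  have h1 : ∀ᵐ x, ∀ k : ℕ, t ≤ k → ‖diff h (inter ψ k) x - diff h (inter ψ t) x‖ₑ ≤
      ∫⁻ r in Set.Ioi t, decay n r * driveRate K V ψ h r := by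
    refine ae_all_iff.2 fun k => ?_
    by_cases hk : t ≤ k
    · filter_upwards [hs.ae_diff_inter_sub_le ha h ht hk,
        Lp.coeFn_sub (diff h (inter ψ k)) (diff h (inter ψ t))] with x hx hx' _
      rwa [diff_sub, hx', Pi.sub_apply] at hx
    · exact Eventually.of_forall fun _ h => absurd h hk
  filter_upwards [h1, ae_tendsto_diff h hΩ, Lp.coeFn_sub (diff h (inter ψ t)) (diff h Ω)]
    with x h2 h3 h4
  rw [diff_sub, h4, Pi.sub_apply, ← enorm_neg, neg_sub]
  refine le_of_tendsto (h3.sub_const _).enorm ?_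
  filter_upwards [tendsto_natCast_atTop_atTop.eventually_ge_atTop t] with k hk using h2 k hk

end Limit

/-! ### The near part of the interaction picture -/

theorem lintegral_mul_sq_le {α : Type*} [MeasurableSpace α] {μ : Measure α} {f g : α → ℝ≥0∞}
    (hf : AEMeasurable f μ) (hg : AEMeasurable g μ) :
    (∫⁻ x, f x * g x ∂μ) ^ 2 ≤ (∫⁻ x, f x ∂μ) * ∫⁻ x, f x * g x ^ 2 ∂μ := by
  have hs : ∀ y : ℝ≥0∞, y ^ (1 / 2 : ℝ) * y ^ (1 / 2 : ℝ) = y := fun y => by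
    rw [← ENNReal.rpow_add_of_nonneg _ _ (by norm_num) (by norm_num)]
    norm_num
  have hs2 : ∀ y : ℝ≥0∞, (y ^ (1 / 2 : ℝ)) ^ 2 = y := fun y => by rw [sq, hs]
  have h := ENNReal.lintegral_mul_le_Lp_mul_Lq μ Real.HolderConjugate.two_two
    (hf.pow_const (1 / 2 : ℝ)) ((hf.pow_const (1 / 2 : ℝ)).mul hg)
  simp only [Pi.mul_apply, ← mul_assoc, hs, ENNReal.rpow_two, mul_pow, hs2] at h
  refine (pow_le_pow_left₀ zero_le h 2).trans_eq ?_
  rw [mul_pow, hs2, hs2]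

theorem driveRate_sq_le (K : ℝ≥0) (V ψ : ℝ → L2 n) (h : E n) (r : ℝ) :
    driveRate K V ψ h r ^ 2 ≤ 2 * K ^ 2 * (‖diff h (V r)‖ₑ ^ 2 + ‖diff h (ψ r)‖ₑ ^ 2) := by
  have h1 : (‖diff h (V r)‖ₑ + ‖diff h (ψ r)‖ₑ) ^ 2 ≤
      2 * (‖diff h (V r)‖ₑ ^ 2 + ‖diff h (ψ r)‖ₑ ^ 2) := by
    rw [enorm_eq_nnnorm, enorm_eq_nnnorm]
    exact_mod_cast add_sq_le (a := ‖diff h (V r)‖₊) (b := ‖diff h (ψ r)‖₊)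
  rw [driveRate, mul_pow, mul_comm 2, mul_assoc]
  gcongr

/-- Multiplication by a square integrable function of a function that is bounded pointwise. -/
theorem enorm_mulOp_sq_le_of_ae_le {m : E n →ᵇ ℂ} {u : L2 n} {M : ℝ≥0∞}
    (hu : ∀ᵐ x, ‖u x‖ₑ ≤ M) : ‖mulOp m u‖ₑ ^ 2 ≤ (∫⁻ x, ‖m x‖ₑ ^ 2) * M ^ 2 := by
  rw [enorm_mulOp_sq, ← lintegral_mul_const _ (m.continuous.enorm.measurable.pow_const 2)]
  refine lintegral_mono_ae ?_
  filter_upwards [hu] with x hx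
  gcongr

theorem SmoothCutoff.lintegral_one_sub_radial_sq_le (F : SmoothCutoff) {B : ℝ}
    (hB : ∀ k, |F.toFun k| ≤ B) {r : ℝ} (hr : 0 < r) :
    ∫⁻ x, ‖(1 - F.radial n r) x‖ₑ ^ 2 ≤
      ENNReal.ofReal ((1 + B) ^ 2) * volume (Metric.ball (0 : E n) 1) * ENNReal.ofReal (r ^ n) := by
  have h1 : ∀ x, ‖(1 - F.radial n r) x‖ₑ ^ 2 ≤
      (Metric.ball (0 : E n) r).indicator (fun _ => ENNReal.ofReal ((1 + B) ^ 2)) x := by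
    intro x
    have hx : (1 - F.radial n r) x = ((1 - F.toFun (‖x‖ / r) : ℝ) : ℂ) := by
      simp [F.radial_apply]
    rw [hx]
    by_cases hxr : x ∈ Metric.ball (0 : E n) r
    · rw [Set.indicator_of_mem hxr, enorm_sq_eq_ofReal, Complex.norm_real, Real.norm_eq_abs]
      refine ENNReal.ofReal_le_ofReal (pow_le_pow_left₀ (abs_nonneg _) ?_ 2)
      refine (abs_sub _ _).trans ?_
      rw [abs_one]
      exact add_le_add le_rfl (hB _)
    · rw [Set.indicator_of_notMem hxr, F.eq_one _ ((one_le_div hr).2 (by simpa using hxr))]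
      simp
  refine (lintegral_mono h1).trans_eq ?_
  rw [lintegral_indicator_const Metric.isOpen_ball.measurableSet, Measure.addHaar_ball_of_pos _ _ hr,
    finrank_euclideanSpace_fin]
  ring

section Near

variable {K : ℝ≥0} {V ψ : ℝ → L2 n} {Ω : L2 n}

theorem BoundedSolution.aemeasurable_driveRate (hs : BoundedSolution a K V ψ) (h : E n) :
    AEMeasurable (driveRate K V ψ h) volume := by
  have h1 : AEMeasurable (fun r => ‖diff h (V r)‖ₑ) volume :=
    ((continuous_diff h).comp_aestronglyMeasurable hs.measurable_potential).enorm
  have h2 : AEMeasurable (fun r => ‖diff h (ψ r)‖ₑ) volume :=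
    ((continuous_diff h).comp_aestronglyMeasurable
      hs.solution.stronglyMeasurable.aestronglyMeasurable).enorm
  exact (h1.add h2).const_mul _

/-- The pointwise bounds on the differences, summed over a difference scheme. -/
theorem BoundedSolution.sum_sq_lintegral_driveRate_le (hs : BoundedSolution a K V ψ)
    (S : DiffScheme n a) (N : ℕ) (t : ℝ) :
    ∑ k ∈ S.idx N, ENNReal.ofReal (S.wt N k) *
        (∫⁻ r in Set.Ioi t, decay n r * driveRate K V ψ (S.vec k) r) ^ 2 ≤
      4 * ENNReal.ofReal S.bd * (K : ℝ≥0∞) ^ 4 * (∫⁻ r in Set.Ioi t, decay n r) ^ 2 := by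
  set D := ∫⁻ r in Set.Ioi t, decay n r with hD
  have hm : ∀ k, AEMeasurable (fun r => ENNReal.ofReal (S.wt N k) *
      (decay n r * driveRate K V ψ (S.vec k) r ^ 2)) (volume.restrict (Set.Ioi t)) := fun k =>
    (((measurable_decay n).aemeasurable.mul
      ((hs.aemeasurable_driveRate _).pow_const 2)).const_mul _).restrict
  have hsum : ∀ᵐ r : ℝ, ∑ k ∈ S.idx N, ENNReal.ofReal (S.wt N k) *
      (decay n r * driveRate K V ψ (S.vec k) r ^ 2) ≤
      decay n r * (4 * ENNReal.ofReal S.bd * (K : ℝ≥0∞) ^ 4) := by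
    filter_upwards [hs.potential_le] with r hr
    have h1 : S.energy N (V r) ≤ ENNReal.ofReal S.bd * (K : ℝ≥0∞) ^ 2 :=
      (S.energy_le N _).trans (by gcongr)
    have h2 : S.energy N (ψ r) ≤ ENNReal.ofReal S.bd * (K : ℝ≥0∞) ^ 2 :=
      (S.energy_le N _).trans (by gcongr; exact hs.solution_le r)
    calc _ ≤ ∑ k ∈ S.idx N, decay n r * (2 * (K : ℝ≥0∞) ^ 2) * (ENNReal.ofReal (S.wt N k) *
          (‖diff (S.vec k) (V r)‖ₑ ^ 2) + ENNReal.ofReal (S.wt N k) *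
            ‖diff (S.vec k) (ψ r)‖ₑ ^ 2) := by
          refine Finset.sum_le_sum fun k _ => ?_
          refine (mul_le_mul_right (mul_le_mul_right (driveRate_sq_le K V ψ _ r) _) _).trans_eq ?_
          ring
      _ = decay n r * (2 * (K : ℝ≥0∞) ^ 2) * (S.energy N (V r) + S.energy N (ψ r)) := by
          rw [← Finset.mul_sum, Finset.sum_add_distrib]
          rfl
      _ ≤ decay n r * (2 * (K : ℝ≥0∞) ^ 2) * (ENNReal.ofReal S.bd * (K : ℝ≥0∞) ^ 2 +
          ENNReal.ofReal S.bd * (K : ℝ≥0∞) ^ 2) := by gcongr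
      _ = _ := by ring
  calc _ ≤ ∑ k ∈ S.idx N, D * ∫⁻ r in Set.Ioi t, ENNReal.ofReal (S.wt N k) *
        (decay n r * driveRate K V ψ (S.vec k) r ^ 2) := by
        refine Finset.sum_le_sum fun k _ => ?_
        rw [lintegral_const_mul' _ _ ENNReal.ofReal_ne_top, mul_left_comm]
        gcongr
        exact lintegral_mul_sq_le (measurable_decay n).aemeasurable
          (hs.aemeasurable_driveRate _).restrict
    _ = D * ∫⁻ r in Set.Ioi t, ∑ k ∈ S.idx N, ENNReal.ofReal (S.wt N k) *
        (decay n r * driveRate K V ψ (S.vec k) r ^ 2) := by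
        rw [← Finset.mul_sum, lintegral_finsetSum' _ fun k _ => hm k]
    _ ≤ D * ∫⁻ r in Set.Ioi t, decay n r * (4 * ENNReal.ofReal S.bd * (K : ℝ≥0∞) ^ 4) := by
        gcongr D * ?_
        exact lintegral_mono_ae (ae_restrict_of_ae hsum)
    _ = _ := by
        rw [lintegral_mul_const _ (measurable_decay n), ← hD]
        ring

/-- The near part of `e^{itH₀}ψ(t) - Ω` in `H^a`: the pointwise decay of the function and its
differences beats the volume of the region where the cut-off lives. -/
theorem BoundedSolution.sobolevENorm_near_sq_le (hs : BoundedSolution a K V ψ) (ha : 0 ≤ a)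
    (S : DiffScheme n a) (hΩ : ∀ᵐ x, Tendsto (fun k : ℕ => inter ψ k x) atTop (𝓝 (Ω x)))
    {m : E n →ᵇ ℂ} {L : ℝ} (hL : ∀ x y, ‖m x - m y‖ ≤ L * ‖x - y‖) {t : ℝ} (ht : 0 < t) :
    sobolevENorm a (mulOp m (inter ψ t - Ω)) ^ 2 ≤
      ENNReal.ofReal S.bd * ((1 + 8 * ENNReal.ofReal S.bd) * (K : ℝ≥0∞) ^ 4 *
        ((∫⁻ x, ‖m x‖ₑ ^ 2) * (∫⁻ r in Set.Ioi t, decay n r) ^ 2) +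
        2 * (ENNReal.ofReal (L ^ 2 * S.bd) * ‖inter ψ t - Ω‖ₑ ^ 2)) := by
  set D := ∫⁻ r in Set.Ioi t, decay n r with hD
  set X := ∫⁻ x, ‖m x‖ₑ ^ 2
  set u := inter ψ t - Ω with hu
  have h1 : ‖mulOp m u‖ₑ ^ 2 ≤ (K : ℝ≥0∞) ^ 4 * (X * D ^ 2) := by
    refine (enorm_mulOp_sq_le_of_ae_le (hs.ae_inter_sub_limit_le ha hΩ ht)).trans_eq ?_
    rw [lintegral_mul_const _ (measurable_decay n), ← hD]
    ring
  have h2 : ∀ N, S.energy N (mulOp m u) ≤ 2 * (X * (4 * ENNReal.ofReal S.bd * (K : ℝ≥0∞) ^ 4 *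
      D ^ 2)) + 2 * (ENNReal.ofReal (L ^ 2 * S.bd) * ‖u‖ₑ ^ 2) := by
    intro N
    refine (S.energy_mulOp_le N hL u).trans ?_
    gcongr
    refine le_trans ?_ (mul_le_mul_right (hs.sum_sq_lintegral_driveRate_le S N t) X)
    rw [Finset.mul_sum]
    refine Finset.sum_le_sum fun k _ => ?_
    rw [mul_left_comm X]
    gcongr
    exact enorm_mulOp_sq_le_of_ae_le (hs.ae_diff_inter_sub_limit_le ha hΩ _ ht)
  refine (S.sobolevENorm_sq_le h2).trans ?_
  refine mul_le_mul_right ((add_le_add h1 le_rfl).trans_eq ?_) _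
  ring

/-- The squared norm is a sum of two negative powers of `t`: the exponent `αn + 2 - n` collects the
volume of the ball of radius `t^α` and the square of the pointwise decay `t^{1-n/2}`, and the
exponent `-2α` comes from the Lipschitz constant of the cut-off. -/
theorem BoundedSolution.tendsto_near (hs : BoundedSolution a K V ψ) (ha : 0 ≤ a) (hn : 3 ≤ n)
    (S : DiffScheme n a) (hΩ : ∀ᵐ x, Tendsto (fun k : ℕ => inter ψ k x) atTop (𝓝 (Ω x)))
    (hΩK : ‖Ω‖ₑ ≤ K) (F : SmoothCutoff) {α : ℝ} (hα₀ : 0 < α) (hα₁ : α < 1 - 2 / (n : ℝ)) :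
    Tendsto (fun t : ℝ => sobolevENorm a (mulOp (1 - F.radial n (t ^ α)) (inter ψ t - Ω)))
      atTop (𝓝 0) := by
  have hn' : (0 : ℝ) < n := by exact_mod_cast (by omega : 0 < n)
  obtain ⟨c, hc⟩ := exists_lintegral_decay_le hn
  obtain ⟨B, L, hB0, hL0, hB, hL⟩ := F.exists_bounds
  have hexp : 0 < (n : ℝ) - 2 - α * n := by
    have := mul_lt_mul_of_pos_right hα₁ hn'
    rw [sub_mul, div_mul_cancel₀ _ hn'.ne'] at this
    linarith
  -- the two contributions to the squared norm decay like these powers of `t`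
  let A₁ : ℝ≥0∞ := (1 + 8 * ENNReal.ofReal S.bd) * (K : ℝ≥0∞) ^ 4 *
    (ENNReal.ofReal ((1 + B) ^ 2) * volume (Metric.ball (0 : E n) 1) * (c : ℝ≥0∞) ^ 2)
  let A₂ : ℝ≥0∞ := 2 * (ENNReal.ofReal (L ^ 2 * S.bd) * (2 * K : ℝ≥0∞) ^ 2)
  have hA₁ : A₁ ≠ ⊤ := by
    have : volume (Metric.ball (0 : E n) 1) ≠ ⊤ := measure_ball_lt_top.ne
    finiteness
  have hA₂ : A₂ ≠ ⊤ := by finiteness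
  have hbound : ∀ t : ℝ, 0 < t →
      sobolevENorm a (mulOp (1 - F.radial n (t ^ α)) (inter ψ t - Ω)) ^ 2 ≤
        ENNReal.ofReal S.bd * (A₁ * ENNReal.ofReal (t ^ (-((n : ℝ) - 2 - α * n))) +
          A₂ * ENNReal.ofReal (t ^ (-(2 * α)))) := by
    intro t ht
    have htα : 0 < t ^ α := Real.rpow_pos_of_pos ht α
    have hlip : ∀ x y, ‖(1 - F.radial n (t ^ α)) x - (1 - F.radial n (t ^ α)) y‖ ≤
        L / t ^ α * ‖x - y‖ := by
      intro x y
      have h : (1 - F.radial n (t ^ α)) x - (1 - F.radial n (t ^ α)) y =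
          -(F.radial n (t ^ α) x - F.radial n (t ^ α) y) := by simp
      rw [h, norm_neg]
      exact F.radial_lipschitz hL0 hL htα x y
    refine (hs.sobolevENorm_near_sq_le ha S hΩ hlip ht).trans ?_
    refine mul_le_mul_right (add_le_add ?_ ?_) _
    · have h1 : (∫⁻ x, ‖(1 - F.radial n (t ^ α)) x‖ₑ ^ 2) *
          (∫⁻ r in Set.Ioi t, decay n r) ^ 2 ≤
          ENNReal.ofReal ((1 + B) ^ 2) * volume (Metric.ball (0 : E n) 1) *
            ENNReal.ofReal ((t ^ α) ^ n) * (c * ENNReal.ofReal (t ^ (1 - n / 2 : ℝ))) ^ 2 :=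
        mul_le_mul' (F.lintegral_one_sub_radial_sq_le hB htα)
          (pow_le_pow_left₀ zero_le (hc t ht) 2)
      have h2 : t ^ (-((n : ℝ) - 2 - α * n)) = (t ^ α) ^ n * (t ^ (1 - n / 2 : ℝ)) ^ 2 := by
        rw [← Real.rpow_natCast, ← Real.rpow_natCast, ← Real.rpow_mul ht.le, ← Real.rpow_mul ht.le,
          ← Real.rpow_add ht]
        congr 1
        push_cast
        ring
      refine (mul_le_mul_right h1 _).trans_eq ?_
      rw [h2, ENNReal.ofReal_mul (by positivity),
        ENNReal.ofReal_pow (p := t ^ (1 - n / 2 : ℝ)) (by positivity) 2]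
      simp only [A₁]
      ring
    · have h1 : ‖inter ψ t - Ω‖ₑ ≤ 2 * K := by
        refine enorm_sub_le.trans ?_
        rw [two_mul, enorm_inter]
        exact add_le_add (hs.enorm_solution_le ha t) hΩK
      have h2 : (L / t ^ α) ^ 2 * S.bd = L ^ 2 * S.bd * t ^ (-(2 * α)) := by
        rw [Real.rpow_neg ht.le, mul_comm 2 α, Real.rpow_mul ht.le, Real.rpow_two]
        ring
      rw [h2, ENNReal.ofReal_mul (mul_nonneg (sq_nonneg _) S.bd_nonneg)]
      refine (mul_le_mul_right (mul_le_mul_right (pow_le_pow_left₀ zero_le h1 2) _) _).trans_eq ?_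
      simp only [A₂]
      ring
  have hlim : Tendsto (fun t : ℝ => ENNReal.ofReal S.bd *
      (A₁ * ENNReal.ofReal (t ^ (-((n : ℝ) - 2 - α * n))) +
        A₂ * ENNReal.ofReal (t ^ (-(2 * α))))) atTop (𝓝 0) := by
    have h1 := ENNReal.Tendsto.const_mul (ENNReal.tendsto_ofReal (tendsto_rpow_neg_atTop hexp))
      (Or.inr hA₁)
    have h2 := ENNReal.Tendsto.const_mul (ENNReal.tendsto_ofReal
      (tendsto_rpow_neg_atTop (by linarith : 0 < 2 * α))) (Or.inr hA₂)
    have h3 := ENNReal.Tendsto.const_mul (h1.add h2) (Or.inr (ENNReal.ofReal_ne_top (r := S.bd)))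
    simpa using h3
  have hsq : Tendsto (fun t : ℝ =>
      sobolevENorm a (mulOp (1 - F.radial n (t ^ α)) (inter ψ t - Ω)) ^ 2) atTop (𝓝 0) :=
    tendsto_of_tendsto_of_tendsto_of_le_of_le' tendsto_const_nhds hlim
      (Eventually.of_forall fun _ => zero_le) ((eventually_gt_atTop 0).mono hbound)
  have hroot := ((ENNReal.continuous_rpow_const (y := (1 / 2 : ℝ))).tendsto 0).comp hsq
  rw [ENNReal.zero_rpow_of_pos (by norm_num)] at hroot
  refine hroot.congr fun t => ?_
  rw [Function.comp_apply, ← ENNReal.rpow_natCast, ← ENNReal.rpow_mul]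
  norm_num

end Near

/-! ### Weak convergence of the far part -/

/-- The function `(1 + |ξ|²)^(a/2) 𝓕f(ξ)` as an element of `L²`, for `f ∈ H^a`. -/
def bessel (f : L2 n) (hf : InSobolev a f) : L2 n :=
  MemLp.toLp (fun ξ : E n => ((((1 + ‖ξ‖ ^ 2) ^ (a / 2) : ℝ) : ℂ)) * (𝓕 f : L2 n) ξ)
    ⟨aestronglyMeasurable_sobolev a f, hf⟩

theorem bessel_coeFn (f : L2 n) (hf : InSobolev a f) : bessel f hf =ᵐ[volume]
    fun ξ : E n => ((((1 + ‖ξ‖ ^ 2) ^ (a / 2) : ℝ) : ℂ)) * (𝓕 f : L2 n) ξ :=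
  MemLp.coeFn_toLp _

theorem enorm_bessel (f : L2 n) (hf : InSobolev a f) : ‖bessel f hf‖ₑ = sobolevENorm a f := by
  rw [Lp.enorm_def, eLpNorm_congr_ae (bessel_coeFn f hf), sobolevENorm]

theorem sobolevInner_eq_inner_bessel (f g : L2 n) (hf : InSobolev a f) (hg : InSobolev a g) :
    sobolevInner a f g = inner ℂ (bessel f hf) (bessel g hg) := by
  rw [L2.inner_def, sobolevInner]
  refine integral_congr_ae ?_
  filter_upwards [bessel_coeFn f hf, bessel_coeFn g hg] with ξ h1 h2
  rw [h1, h2, RCLike.inner_apply, map_mul, Complex.conj_ofReal]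
  have : (((1 + ‖ξ‖ ^ 2) ^ a : ℝ) : ℂ) =
      (((1 + ‖ξ‖ ^ 2) ^ (a / 2) : ℝ) : ℂ) * (((1 + ‖ξ‖ ^ 2) ^ (a / 2) : ℝ) : ℂ) := by
    rw [← Complex.ofReal_mul, ← Real.rpow_add (by positivity), add_halves]
  rw [this]
  ring

/-- Testing the Bessel transform of `f` against a Schwartz function amounts to testing `f` itself
against another one. -/
theorem exists_inner_toLp_bessel_eq (a : ℝ) (θ : 𝓢(E n, ℂ)) : ∃ p : 𝓢(E n, ℂ),
    ∀ (f : L2 n) (hf : InSobolev a f),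
      inner ℂ (θ.toLp 2 volume) (bessel f hf) = inner ℂ (p.toLp 2 volume) f := by
  have hw : (fun x : E n => (((1 + ‖x‖ ^ 2) ^ (a / 2) : ℝ) : ℂ)).HasTemperateGrowth := by fun_prop
  refine ⟨𝓕⁻ (SchwartzMap.smulLeftCLM ℂ
    (fun x : E n => (((1 + ‖x‖ ^ 2) ^ (a / 2) : ℝ) : ℂ)) θ), fun f hf => ?_⟩
  rw [← Lp.inner_fourier_eq _ f, SchwartzMap.toLp_fourier_eq, fourier_fourierInv_eq, L2.inner_def,
    L2.inner_def]
  refine integral_congr_ae ?_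
  filter_upwards [bessel_coeFn f hf, θ.coeFn_toLp 2 volume, (SchwartzMap.smulLeftCLM ℂ
    (fun x : E n => (((1 + ‖x‖ ^ 2) ^ (a / 2) : ℝ) : ℂ)) θ).coeFn_toLp 2 volume] with ξ h1 h2 h3
  rw [h1, h2, h3, SchwartzMap.smulLeftCLM_apply_apply hw, RCLike.inner_apply, RCLike.inner_apply,
    smul_eq_mul, map_mul, Complex.conj_ofReal]
  ring

theorem inner_mulOp_radial (F : SmoothCutoff) (r : ℝ) (f g : L2 n) :
    inner ℂ f (mulOp (F.radial n r) g) = inner ℂ (mulOp (F.radial n r) f) g := by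
  rw [L2.inner_def, L2.inner_def]
  refine integral_congr_ae ?_
  filter_upwards [mulOp_coeFn (F.radial n r) f, mulOp_coeFn (F.radial n r) g] with x h1 h2
  rw [h1, h2, RCLike.inner_apply, RCLike.inner_apply, map_mul, F.radial_apply,
    Complex.conj_ofReal]
  ring

/-- Functions bounded in `H^a` and cut off to larger and larger radii tend weakly to zero. -/
theorem tendsto_sobolevInner_radial (S : DiffScheme n a) (ha : 0 ≤ a) (F : SmoothCutoff)
    {u : ℝ → L2 n} {K : ℝ≥0} (hu : ∀ t, sobolevENorm a (u t) ≤ K) {r : ℝ → ℝ}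
    (hr : Tendsto r atTop atTop) {g : L2 n} (hg : InSobolev a g) :
    Tendsto (fun t => sobolevInner a g (mulOp (F.radial n (r t)) (u t))) atTop (𝓝 0) := by
  obtain ⟨C, hC⟩ := exists_sobolevENorm_radial_le (n := n) S ha F one_pos
  rw [tendsto_zero_iff_norm_tendsto_zero, Metric.tendsto_nhds]
  intro ε hε
  have hCK : (0 : ℝ) < 2 * (C * K + 1) := by positivity
  -- replace `(1 + |ξ|²)^(a/2) 𝓕g` by a Schwartz function
  obtain ⟨_, ⟨θ, rfl⟩, hθ⟩ := Metric.mem_closure_iff.1 ((SchwartzMap.denseRange_toLpCLM (E := E n)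
    (F := ℂ) (μ := volume) (p := 2) ENNReal.ofNat_ne_top) (bessel g hg)) (ε / (2 * (C * K + 1)))
    (div_pos hε hCK)
  obtain ⟨p, hp⟩ := exists_inner_toLp_bessel_eq a θ
  rw [SchwartzMap.toLpCLM_apply, dist_eq_norm] at hθ
  have hlim : Tendsto (fun t => ‖mulOp (F.radial n (r t)) (p.toLp 2 volume)‖ₑ) atTop (𝓝 0) :=
    tendsto_of_tendsto_of_tendsto_of_le_of_le tendsto_const_nhds
      ((tendsto_radial S ha F (inSobolev_schwartz ha p)).comp hr) (fun _ => zero_le)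
      fun _ => enorm_le_sobolevENorm ha _
  have hsmall : (0 : ℝ≥0∞) < ENNReal.ofReal (ε / (2 * (K + 1))) := by
    rw [ENNReal.ofReal_pos]
    positivity
  filter_upwards [hr.eventually_ge_atTop 1, hlim.eventually (gt_mem_nhds hsmall)] with t ht1 ht2
  have hv : sobolevENorm a (mulOp (F.radial n (r t)) (u t)) ≤ ((C * K : ℝ≥0) : ℝ≥0∞) := by
    refine (hC _ ht1 _).trans ?_
    push_cast
    gcongr
    exact hu t
  have hvS : InSobolev a (mulOp (F.radial n (r t)) (u t)) := hv.trans_lt ENNReal.coe_lt_top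
  have hvn : ‖bessel _ hvS‖ ≤ C * K := by
    rw [← enorm_bessel _ hvS, enorm_le_coe] at hv
    exact_mod_cast hv
  have hun : ‖u t‖ ≤ K := by
    have := (enorm_le_sobolevENorm ha (u t)).trans (hu t)
    rw [enorm_le_coe] at this
    exact_mod_cast this
  have hpn : ‖mulOp (F.radial n (r t)) (p.toLp 2 volume)‖ ≤ ε / (2 * (K + 1)) := by
    rw [← ofReal_norm] at ht2
    exact (ENNReal.ofReal_le_ofReal_iff (by positivity)).1 ht2.le
  have hsplit : sobolevInner a g (mulOp (F.radial n (r t)) (u t)) =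
      inner ℂ (bessel g hg - θ.toLp 2 volume) (bessel _ hvS) +
        inner ℂ (mulOp (F.radial n (r t)) (p.toLp 2 volume)) (u t) := by
    rw [sobolevInner_eq_inner_bessel _ _ hg hvS, ← inner_mulOp_radial, ← hp _ hvS,
      ← inner_add_left, sub_add_cancel]
  rw [dist_zero_right, norm_norm, hsplit]
  have h1 : ‖(inner ℂ (bessel g hg - θ.toLp 2 volume) (bessel _ hvS) : ℂ)‖ < ε / 2 := by
    refine (norm_inner_le_norm _ _).trans_lt ?_
    calc _ ≤ ‖bessel g hg - θ.toLp 2 volume‖ * (C * K + 1) := by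
          gcongr
          linarith
      _ < ε / (2 * (C * K + 1)) * (C * K + 1) := by
          gcongr
      _ = ε / 2 := by
          have : (C * K + 1 : ℝ) ≠ 0 := by positivity
          field_simp
  have h2 : ‖(inner ℂ (mulOp (F.radial n (r t)) (p.toLp 2 volume)) (u t) : ℂ)‖ ≤ ε / 2 := by
    refine (norm_inner_le_norm _ _).trans ?_
    calc _ ≤ ε / (2 * (K + 1)) * (K + 1) := by
          gcongr
          linarith
      _ = ε / 2 := by
          have : (K + 1 : ℝ) ≠ 0 := by positivity
          field_simp
  calc _ ≤ _ := norm_add_le _ _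
    _ < ε / 2 + ε / 2 := add_lt_add_of_lt_of_le h1 h2
    _ = ε := add_halves ε

/-! ### The free channel -/

theorem SmoothCutoff.freeGroup_neg_channelLE (F : SmoothCutoff) (ψ : ℝ → L2 n) (t r : ℝ) :
    freeGroup (-t) (F.channelLE t r (ψ t)) = mulOp (1 - F.radial n r) (inter ψ t) :=
  freeGroup_neg_freeGroup _ _

theorem SmoothCutoff.freeGroup_neg_channelGT (F : SmoothCutoff) (ψ : ℝ → L2 n) (t r : ℝ) :
    freeGroup (-t) (F.channelGT t r (ψ t)) = mulOp (F.radial n r) (inter ψ t) :=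
  freeGroup_neg_freeGroup _ _

theorem inSobolev_mulOp_radial (S : DiffScheme n a) (ha : 0 ≤ a) (F : SmoothCutoff) {r : ℝ}
    (hr : 0 < r) {f : L2 n} (hf : InSobolev a f) : InSobolev a (mulOp (F.radial n r) f) := by
  obtain ⟨C, hC⟩ := exists_sobolevENorm_radial_le (n := n) S ha F hr
  exact (hC r le_rfl f).trans_lt (ENNReal.mul_lt_top ENNReal.coe_lt_top hf)

/-- The near part of `e^{itH₀}ψ(t)` tends to the pointwise limit `Ω`. -/
theorem BoundedSolution.tendsto_near_sub {K : ℝ≥0} {V ψ : ℝ → L2 n} {Ω : L2 n}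
    (hs : BoundedSolution a K V ψ) (ha : 0 ≤ a) (hn : 3 ≤ n) (S : DiffScheme n a)
    (hΩ : ∀ᵐ x, Tendsto (fun k : ℕ => inter ψ k x) atTop (𝓝 (Ω x))) (hΩK : ‖Ω‖ₑ ≤ K)
    (F : SmoothCutoff) {α : ℝ} (hα₀ : 0 < α) (hα₁ : α < 1 - 2 / (n : ℝ)) :
    Tendsto (fun t : ℝ => sobolevENorm a (mulOp (1 - F.radial n (t ^ α)) (inter ψ t) - Ω))
      atTop (𝓝 0) := by
  have h1 := hs.tendsto_near ha hn S hΩ hΩK F hα₀ hα₁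
  have h2 := (tendsto_radial S ha F (hs.inSobolev_limit S hΩ)).comp (tendsto_rpow_atTop hα₀)
  have h3 := h1.add h2
  rw [add_zero] at h3
  refine tendsto_of_tendsto_of_tendsto_of_le_of_le tendsto_const_nhds h3 (fun _ => zero_le)
    fun t => ?_
  have heq : mulOp (1 - F.radial n (t ^ α)) (inter ψ t) - Ω =
      mulOp (1 - F.radial n (t ^ α)) (inter ψ t - Ω) - mulOp (F.radial n (t ^ α)) Ω := by
    rw [mulOp_sub, mulOp_one_sub _ Ω]
    abel
  simp only [Function.comp_apply]
  rw [heq]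
  exact sobolevENorm_sub_le _ _ _

end Channel

end

theorem theoremA1 (n : ℕ) (hn : 3 ≤ n) (a : ℝ) (ha₀ : 0 ≤ a) (ha₁ : a ≤ 1)
    (V ψ : ℝ → Channel.L2 n)
    (hV : Channel.LinftySobolev a V)
    (hψ : Channel.IsGlobalSolution V ψ)
    (hbd : Channel.UniformlyBounded a ψ)
    (α : ℝ) (hα₀ : 0 < α) (hα₁ : α < 1 - 2 / (n : ℝ))
    (F : Channel.SmoothCutoff) :
    (∀ t : ℝ, 0 < t →
      Channel.InSobolev a (Channel.freeGroup (-t) (F.channelLE t (t ^ α) (ψ t))) ∧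
      Channel.InSobolev a (Channel.freeGroup (-t) (F.channelGT t (t ^ α) (ψ t)))) ∧
    ∃ Ωψ : Channel.L2 n, Channel.InSobolev a Ωψ ∧
      Channel.TendstoSobolev a
        (fun t => Channel.freeGroup (-t) (F.channelLE t (t ^ α) (ψ t))) Ωψ ∧
      Channel.TendstoWeaklySobolev a
        (fun t => Channel.freeGroup (-t) (F.channelGT t (t ^ α) (ψ t))) 0 ∧
      Channel.TendstoSobolev a
        (fun t => ψ t - Channel.freeGroup t Ωψ - F.channelGT t (t ^ α) (ψ t)) 0 := by
  obtain ⟨S⟩ := Channel.nonempty_diffScheme (n := n) ha₀ ha₁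
  obtain ⟨hVm, C₁, hC₁⟩ := hV
  obtain ⟨C₂, hC₂⟩ := hbd
  have hs : Channel.BoundedSolution a (max C₁ C₂) V ψ :=
    ⟨hVm, hC₁.mono fun t ht => ht.trans (by gcongr; exact le_max_left _ _), hψ,
      fun t => (hC₂ t).trans (by gcongr; exact le_max_right _ _)⟩
  have hφ : ∀ t, Channel.sobolevENorm a (Channel.inter ψ t) ≤ ((max C₁ C₂ : ℝ≥0) : ℝ≥0∞) :=
    fun t => (Channel.sobolevENorm_inter ψ t).trans_le (hs.solution_le t)
  have hφS : ∀ t, Channel.InSobolev a (Channel.inter ψ t) :=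
    fun t => (hφ t).trans_lt ENNReal.coe_lt_top
  obtain ⟨Ω, hΩ, hΩK⟩ := hs.exists_limit ha₀ hn
  have hnear := hs.tendsto_near_sub ha₀ hn S hΩ hΩK F hα₀ hα₁
  refine ⟨fun t ht => ?_, Ω, hs.inSobolev_limit S hΩ, ?_, ?_, ?_⟩
  · have hfar := Channel.inSobolev_mulOp_radial S ha₀ F (Real.rpow_pos_of_pos ht α) (hφS t)
    rw [F.freeGroup_neg_channelLE, F.freeGroup_neg_channelGT, Channel.mulOp_one_sub]
    exact ⟨(Channel.sobolevENorm_sub_le _ _ _).trans_lt (ENNReal.add_lt_top.2 ⟨hφS t, hfar⟩), hfar⟩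
  · refine hnear.congr fun t => ?_
    simp only [F.freeGroup_neg_channelLE]
  · intro g hg
    have h0 : Channel.sobolevInner a g (0 : Channel.L2 n) = 0 := by
      have hz : Channel.InSobolev a (0 : Channel.L2 n) := by
        rw [Channel.InSobolev, Channel.sobolevENorm_zero]
        exact ENNReal.zero_lt_top
      have hb : Channel.bessel 0 hz = 0 := by
        rw [← enorm_eq_zero, Channel.enorm_bessel, Channel.sobolevENorm_zero]
      rw [Channel.sobolevInner_eq_inner_bessel _ _ hg hz, hb, inner_zero_right]
    rw [h0]
    refine (Channel.tendsto_sobolevInner_radial S ha₀ F hφ (tendsto_rpow_atTop hα₀) hg).congr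
      fun t => ?_
    simp only [F.freeGroup_neg_channelGT]
  · refine hnear.congr fun t => ?_
    -- both sides are the same vector, seen in the two pictures
    have heq : ψ t - Channel.freeGroup t Ω - F.channelGT t (t ^ α) (ψ t) - 0 =
        Channel.freeGroup t
          (Channel.mulOp (1 - F.radial n (t ^ α)) (Channel.inter ψ t) - Ω) := by
      rw [Channel.mulOp_one_sub, Channel.freeGroup_sub, Channel.freeGroup_sub, Channel.inter,
        Channel.freeGroup_freeGroup_neg, Channel.SmoothCutoff.channelGT]
      abel
    rw [heq, Channel.sobolevENorm_freeGroup]
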